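/- Let $k=\mathbf{F}_q$ be a finite field of characteristic $p$, let $\mathbf{Z}_q=W(k)$ be its ring of Witt vectors and $\mathbf{Q}_q$ the fraction field of $\mathbf{Z}_q$. Let $\mathcal{Q}\in\mathbf{Z}_q[x,y]$ be monic in $y$ of degree $d_x$, with reduction modulo $p$ irreducible in $\mathbf{F}_q[x,y]$ and separable as a polynomial in $y$ over $\mathbf{F}_q(x)$. Let $\Delta\in\mathbf{Z}_q[x]$ be the discriminant of $\mathcal{Q}$ with respect to $y$ and $r=\Delta/\gcd(\Delta,\frac{d\Delta}{dx})$ (defined up to a unit). Put $\mathcal{V}=\operatorname{Spec}\mathbf{Z}_q[x,1/r]$ and $\mathcal{U}=\operatorname{Spec}\mathbf{Z}_q[x,1/r,y]/(\mathcal{Q})$, with generic fibre $\mathbb{U}$ over $\mathbf{Q}_q$. Assume: 1. $\mathcal{U}=\mathcal{X}\setminus\mathcal{D}_{\mathcal{X}}$ over $\mathbf{Z}_q$, where $\mathcal{X}$ is a smooth proper curve over $\mathbf{Z}_q$ and $\mathcal{D}_{\mathcal{X}}$ is a smooth relative divisor on it (a closed subscheme étale over $\mathbf{Z}_q$); 2.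 $\mathcal{V}=\mathbf{P}^1_{\mathbf{Z}_q}\setminus\mathcal{D}_{\mathbf{P}^1}$ for a smooth relative divisor $\mathcal{D}_{\mathbf{P}^1}$ on $\mathbf{P}^1_{\mathbf{Z}_q}$; 3. the zero locus of $\mathcal{Q}$ in $\mathbf{A}^2_{\mathbf{Q}_q}$ is smooth over $\mathbf{Q}_q$. Let $e$ be the maximum of the ramification indices $e_P$ of the map $x$ at the points $P$ of the generic fibre of $\mathcal{X}$ with $P\notin\mathcal{U}$ and $x(P)\neq\infty$ (with $e=0$ if there are no such points). For $m\geq 1$ and $w\in\mathbf{Q}_q[x]^{\oplus d_x}$, a reduction step at level $m$ replaces $w$ by a vector $w'\in\mathbf{Q}_q[x]^{\oplus d_x}$ such that, for some $v\in\mathbf{Q}_q[x]^{\oplus d_x}$ with all $\deg v_i<\deg r$, $$\frac{\sum_{i=0}^{d_x-1} w_i y^i}{r^{m}}\frac{dx}{r}=d\left(\frac{\sum_{i=0}^{d_x-1} v_i y^i}{r^{m}}\right)+\frac{\sum_{i=0}^{d_x-1} w'_i y^i}{r^{m-1}}\frac{dx}{r}\qquad\text{in }\Omega^1(\mathbb{U}).$$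 Let $\ell\geq 1$ and let $w\in\mathbf{Z}_q[x]^{\oplus d_x}$ satisfy $\deg w_i<\deg r$ for all $i$. Then there is a vector $u\in\mathbf{Q}_q[x]^{\oplus d_x}$ obtained from $w$ by successive reduction steps at levels $\ell,\ell-1,\dots,1$ (so that $\left(\sum_i w_iy^i/r^{\ell}\right)\frac{dx}{r}$ and $\left(\sum_i u_i y^i\right)\frac{dx}{r}$ differ by an exact form), and every $u$ so obtained satisfies $$p^{\lfloor \log_p(\ell e)\rfloor}\,u\in\mathbf{Z}_q[x]^{\oplus d_x},$$ where, if $\ell e=0$, the exponent is read as $0$. -/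

import Mathlib

open Polynomial AlgebraicGeometry CategoryTheory
open scoped KaehlerDifferential

universe u

noncomputable section

namespace PlaneCurve

/-- The ring `ℤ_q` of Witt vectors of the field `k = 𝔽_q`. -/
abbrev Zq (p : ℕ) [Fact p.Prime] (k : Type u) [Field k] : Type u := WittVector p k

/-- The fraction field `ℚ_q` of `ℤ_q`. -/
abbrev Qq (p : ℕ) [Fact p.Prime] (k : Type u) [Field k] [CharP k p] : Type u :=
  FractionRing (Zq p k)

/-- The inclusion `ℤ_q[x] → ℚ_q[x]`. -/
abbrev toQq (p : ℕ) [Fact p.Prime] (k : Type u) [Field k] [CharP k p] :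
    (Zq p k)[X] →+* (Qq p k)[X] :=
  mapRingHom (algebraMap (Zq p k) (Qq p k))

/-- Reduction modulo `p`, as a map `ℤ_q[x] → 𝔽_q[x]`. -/
abbrev modp (p : ℕ) [Fact p.Prime] (k : Type u) [Field k] : (Zq p k)[X] →+* k[X] :=
  mapRingHom WittVector.constantCoeff

/-- `r` is the squarefree part `Δ / gcd(Δ, dΔ/dx)` of `Δ`; the greatest common divisor,
hence also `r`, is only defined up to a unit, and every choice is allowed. -/
def IsSquarefreePart {R : Type u} [CommRing R] (Δ r : R[X]) : Prop :=
  ∃ g : R[X], (g ∣ Δ ∧ g ∣ derivative Δ ∧ ∀ h : R[X], h ∣ Δ → h ∣ derivative Δ → h ∣ g) ∧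
    Δ = g * r

/-- For `Q ∈ R[x][y]` and `r ∈ R[x]`, the ring `R[x, 1/r, y]/(Q)`. -/
abbrev OpenRing {R : Type u} [CommRing R] (Q : R[X][X]) (r : R[X]) : Type u :=
  AdjoinRoot (Q.map (algebraMap R[X] (Localization.Away r)))

namespace OpenRing

variable {R : Type u} [CommRing R] (Q : R[X][X]) (r : R[X])

/-- The function `x`. -/
def x : OpenRing Q r := algebraMap R[X] (OpenRing Q r) X

/-- The function `1/r`. -/
def invr : OpenRing Q r :=
  algebraMap (Localization.Away r) (OpenRing Q r) (IsLocalization.Away.invSelf r)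

/-- The function `∑ i, w_i y^i` attached to a vector `w` of polynomials in `x`. -/
def ofVec {d : ℕ} (w : Fin d → R[X]) : OpenRing Q r :=
  ∑ i, algebraMap R[X] (OpenRing Q r) (w i) * (AdjoinRoot.root _) ^ (i : ℕ)

/-- The differential form `((∑ i, w_i y^i) / r^ℓ) dx/r`. -/
def form (ℓ : ℕ) {d : ℕ} (w : Fin d → R[X]) : Ω[OpenRing Q r⁄R] :=
  (ofVec Q r w * invr Q r ^ ℓ * invr Q r) • KaehlerDifferential.D R (OpenRing Q r) (x Q r)

end OpenRing

/-- `FiniteReduction Q r ℓ w u`: the vector `u` is obtained from the form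
`((∑ w_i y^i) / r^ℓ) dx/r` by lowering the exponent `ℓ` to `0` one step at a time, where
a step replaces `((∑ w_i y^i) / r^(ℓ+1)) dx/r` by `((∑ w'_i y^i) / r^ℓ) dx/r`,
subtracting the differential of some `(∑ v_i y^i) / r^(ℓ+1)` with `deg v < deg r`. -/
inductive FiniteReduction {R : Type u} [CommRing R] (Q : R[X][X]) (r : R[X]) {d : ℕ} :
    ℕ → (Fin d → R[X]) → (Fin d → R[X]) → Prop
  | done (u : Fin d → R[X]) : FiniteReduction Q r 0 u u
  | step (ℓ : ℕ) (w v w' u : Fin d → R[X])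
      (hv : ∀ i, (v i).degree < r.degree)
      (h : OpenRing.form Q r (ℓ + 1) w =
        KaehlerDifferential.D R (OpenRing Q r)
            (OpenRing.ofVec Q r v * OpenRing.invr Q r ^ (ℓ + 1)) +
          OpenRing.form Q r ℓ w')
      (hu : FiniteReduction Q r ℓ w' u) :
      FiniteReduction Q r (ℓ + 1) w u

/-- `U` is the complement in `Y` of a smooth relative divisor of the relative curve `f : Y ⟶ S`,
that is, of a closed subscheme which is étale (smooth of relative dimension `0`) over `S`. -/
def IsSmoothDivisorComplement {Y S : Scheme.{u}} (f : Y ⟶ S) (U : Set Y) : Prop :=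
  ∃ (D : Scheme.{u}) (i : D ⟶ Y), IsClosedImmersion i ∧ Etale (i ≫ f) ∧ U = (Set.range i)ᶜ

attribute [local instance] MvPolynomial.gradedAlgebra

/-- The projective line over `R`, with homogeneous coordinates `X 0`, `X 1`. -/
abbrev ProjLine (R : Type u) [CommRing R] : Scheme.{u} :=
  Proj (MvPolynomial.homogeneousSubmodule (Fin 2) R)

/-- The structure morphism of the projective line. -/
def ProjLine.toSpec (R : Type u) [CommRing R] : ProjLine R ⟶ Spec (.of R) :=
  Proj.toSpecZero (MvPolynomial.homogeneousSubmodule (Fin 2) R) ≫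
    Spec.map (CommRingCat.ofHom
      (algebraMap R (MvPolynomial.homogeneousSubmodule (Fin 2) R 0)))

/-- The open subset `Spec R[x, 1/r]` of the projective line, where `x = X 0 / X 1`: the locus where
neither `X 1` nor the homogenization of `r` vanishes. -/
def ProjLine.openOf {R : Type u} [CommRing R] (r : R[X]) : (ProjLine R).Opens :=
  Proj.basicOpen (MvPolynomial.homogeneousSubmodule (Fin 2) R)
    (MvPolynomial.X 1 * r.homogenize r.natDegree)

section Ramification

variable {R : Type u} [CommRing R] {Q : R[X][X]} {r : R[X]} {𝒳 : Scheme.{u}}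

/-- The morphism `x : Spec R[x, 1/r, y]/(Q) ⟶ 𝔸¹`. -/
def xMor (Q : R[X][X]) (r : R[X]) : Spec (.of (OpenRing Q r)) ⟶ Spec (.of R[X]) :=
  Spec.map (CommRingCat.ofHom (algebraMap R[X] (OpenRing Q r)))

/-- Let `𝒳` contain `Spec R[x, 1/r, y]/(Q)` as an open subscheme via `j`.
`HasRamificationIndex j P n` says that `x(P) ≠ ∞`, i.e. `x` extends to a morphism `g` to the
affine line on some open neighbourhood of `P`, and that `n` is the ramification index of `x` at `P`,
i.e. the maximal ideal of the local ring at `g P` generates the `n`-th power of the maximal ideal of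
the local ring at `P`. -/
def HasRamificationIndex (j : Spec (.of (OpenRing Q r)) ⟶ 𝒳) (P : 𝒳) (n : ℕ) : Prop :=
  ∃ (V : 𝒳.Opens) (P' : V.toScheme) (g : V.toScheme ⟶ Spec (.of R[X])),
    V.ι P' = P ∧ (j ∣_ V) ≫ g = (j ⁻¹ᵁ V).ι ≫ xMor Q r ∧
    (IsLocalRing.maximalIdeal ((Spec (.of R[X])).presheaf.stalk (g P'))).map
        (g.stalkMap P').hom =
      IsLocalRing.maximalIdeal (V.toScheme.presheaf.stalk P') ^ n

/-- The maximum of the ramification indices `e_P` over the points `P` of the generic fibre of `π`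
with `P ∉ 𝒰` and `x(P) ≠ ∞` (and `0` if there are none). -/
def maxFiniteRamification (π : 𝒳 ⟶ Spec (.of R)) (j : Spec (.of (OpenRing Q r)) ⟶ 𝒳) : ℕ :=
  sSup {n : ℕ | ∃ P : 𝒳, P ∉ Set.range j ∧
    (π P : PrimeSpectrum R).asIdeal = ⊥ ∧ HasRamificationIndex j P n}

end Ramification

end PlaneCurve

end

namespace PlaneCurve

/-! ### Local computation: polar parts of t d/dt (f / t^m) and of f / t^m -/

section LocalExpansion

variable {S : Type*} [CommRing S] (D : Derivation ℤ S S) {t : S} {p : ℕ}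

/-! Write O for `Zq`, with uniformizer p, K for `Qq`, A for the coordinate ring of the generic
fibre, B ⊂ A for the image of O[x,y]/(Q), and Δ for d/dx. A reduction step reads w/r^m = rΔ(v/r^m) +
w'/r^(m-1), so a full reduction telescopes to w/r^ℓ = rΔ(V/r^ℓ) + u with deg V < ℓ deg r
(`exists_degree_lt_of_finiteReduction`). It suffices that p^N V is integral for N = ⌊log_p(ℓe)⌋:
then r^ℓ p^N u is integral, and r^ℓ can be divided out because r has unit leading coefficient.

Integrality of p^N V is a descent. Let a > N and let g = p^a V be integral. At a maximal ideal of B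
containing r there is a coordinate t on 𝒳 with r = t^e' · unit, e' ≤ e, and rΔ = unit · t d/dt, and
the polar part of t d/dt (g/t^m), m = ℓe', is divisible by p^a. For an expansion in t with constant
coefficients, t d/dt multiplies the coefficient of t^(-j) by -j, where 1 ≤ j ≤ m and v_p(j) ≤ log_p
m < a; hence the polar part of g/t^m would be divisible by p. In the absence of such expansions,
`mem_span_of_log_lt` uses p^a-th powers as approximate constants: the residue field is perfect, and
their derivatives are divisible by p^a. Gluing the local statements (`exists_eq_add_of_charts`)
gives g/r^ℓ ∈ B + pB[1/r]. Modulo p this says that r^ℓ divides g, whose degree is too small, so p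
divides g (`natCast_dvd_of_pow_mul_eq`) and p^(a-1) V is integral.

The charts come from `exists_chart_of_mem`. A valuation ring dominating B at the maximal ideal 𝔫 has
a centre on 𝒳; it lies on the divisor because 1/r is not in the valuation ring. As the divisor is
étale, it has a local equation t with dt generating the differentials (`exists_local_equation`), so
the local ring S of 𝒳 there has maximal ideal (p, t) and t is prime. Since B is integrally closed
(`mem_planeSubring_of_isIntegral`) and S has finite fibre over B, Zariski's main theorem makes every
element of S a fraction with denominator in B outside 𝔫. The hypothesis on the projective line makes
the leading coefficient of r a unit and r coprime to r'. The generic point of t = 0 lies in the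
generic fibre and has ramification index exactly e' (`DivisorialChart.exists_hasRamificationIndex`).

Existence of a reduction is linear algebra: v ↦ r^m · rΔ(v/r^m) modulo r is injective on vectors of
degree < deg r, again by a local computation (`exists_pow_dvd_of_pow_dvd`), hence bijective by
dimension (`exists_eq_sub_mul`). -/

lemma pow_dvd_of_pow_dvd_mul [IsDomain S] (ht : t ≠ 0) {x : S}
    (reg : ∀ s, t ∣ x * s → t ∣ s) (m : ℕ) : ∀ s, t ^ m ∣ x * s → t ^ m ∣ s := by
  induction m with
  | zero => simp
  | succ m ih =>
    intro s hs
    obtain ⟨u, rfl⟩ := ih s ((pow_dvd_pow t m.le_succ).trans hs)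
    rw [mul_left_comm, pow_succ] at hs
    rw [pow_succ]
    exact mul_dvd_mul_left _ (reg _ ((mul_dvd_mul_iff_left (pow_ne_zero _ ht)).1 hs))

lemma dvd_of_dvd_pow_mul {x : S} (reg : ∀ s, t ∣ x * s → t ∣ s) (a : ℕ) :
    ∀ s, t ∣ x ^ a * s → t ∣ s := by
  induction a with
  | zero => simp
  | succ a ih =>
    intro s hs
    rw [pow_succ, mul_assoc] at hs
    exact reg _ (ih _ hs)

lemma exists_sub_pow_pow_mem {J : Ideal S} (frob : ∀ s : S, ∃ c, s - c ^ p ∈ J) (n : ℕ) :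
    ∀ s : S, ∃ c, s - c ^ (p ^ n) ∈ J := by
  induction n with
  | zero => exact fun s => ⟨s, by simp⟩
  | succ n ih =>
    intro s
    obtain ⟨c, hc⟩ := frob s
    obtain ⟨c', hc'⟩ := ih c
    refine ⟨c', ?_⟩
    have h : c ^ p - (c' ^ (p ^ n)) ^ p ∈ J := J.mem_of_dvd (sub_dvd_pow_sub_pow _ _ _) hc'
    rw [← pow_mul, ← pow_succ] at h
    simpa using add_mem hc h

/-- A p^a-th power has derivative divisible by p^a, so it serves as a constant. Writing s as c^(p^a)
+ p u modulo t and iterating on u gives a truncated Teichmüller expansion of s modulo (p^n, t). -/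
lemma exists_constant_approx (frob : ∀ s : S, ∃ c, s - c ^ p ∈ Ideal.span {(p : S), t})
    (a n : ℕ) : ∀ s : S, ∃ c, (p : S) ^ a ∣ D c ∧ s - c ∈ Ideal.span {(p : S) ^ n, t} := by
  induction n with
  | zero => exact fun s => ⟨0, by simp, by simp [Ideal.span_insert]⟩
  | succ n ih =>
    intro s
    obtain ⟨c, hc⟩ := exists_sub_pow_pow_mem frob a s
    obtain ⟨u, v, huv⟩ := Ideal.mem_span_pair.1 hc
    obtain ⟨c₁, hc₁, hu⟩ := ih u
    obtain ⟨u', v', huv'⟩ := Ideal.mem_span_pair.1 hu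
    refine ⟨c ^ p ^ a + p * c₁, ?_, ?_⟩
    · rw [map_add, Derivation.leibniz_pow, Derivation.leibniz, Derivation.map_natCast]
      refine dvd_add ?_ ?_
      · rw [nsmul_eq_mul]; push_cast; exact Dvd.intro _ rfl
      · simpa using hc₁.mul_left _
    · exact Ideal.mem_span_pair.2 ⟨u', v + p * v', by linear_combination huv + p * huv'⟩

/-- If the polar part of `t ∂(f / t ^ m)` is divisible by `p ^ a`, where `p ^ a > m`, then the polar
part of `f / t ^ m` is divisible by `p`. -/
lemma mem_span_of_log_lt [IsDomain S] [hp : Fact p.Prime] (hDt : D t = 1)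
    (reg : ∀ s, t ∣ p * s → t ∣ s) (frob : ∀ s : S, ∃ c, s - c ^ p ∈ Ideal.span {(p : S), t})
    {a m : ℕ} (ha : Nat.log p m < a) (f : S)
    (hf : t * D f - m * f ∈ Ideal.span {(p : S) ^ a, t ^ m}) :
    f ∈ Ideal.span {(p : S), t ^ m} := by
  have ht : t ≠ 0 := by rintro rfl; simp at hDt
  -- The pole of order j = m - i is treated at each stage: modulo p, the element is shown to be
  -- divisible by one more power of t.
  suffices H : ∀ j i, i + j = m → ∀ s, t * D (t ^ i * s) - m * (t ^ i * s) ∈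
      Ideal.span {(p : S) ^ a, t ^ m} → t ^ i * s ∈ Ideal.span {(p : S), t ^ m} by
    simpa using H m 0 (by simp) f (by simpa using hf)
  have hD (i j : ℕ) (hij : i + j = m) (s : S) :
      t * D (t ^ i * s) - m * (t ^ i * s) = t ^ i * (t * D s - j * s) := by
    have : t * (i * t ^ (i - 1)) = i * t ^ i := by
      cases i <;> simp [pow_succ]; ring
    rw [Derivation.leibniz, Derivation.leibniz_pow, hDt, ← hij]
    simp only [nsmul_eq_mul, smul_eq_mul, mul_one]
    push_cast
    linear_combination s * this
  intro j
  induction j with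
  | zero =>
    intro i hi s _
    rw [add_zero] at hi
    subst hi
    exact Ideal.mem_span_pair.2 ⟨0, s, by ring⟩
  | succ j ih =>
    intro i hi s hs
    have hs' := hs
    rw [hD i (j + 1) hi] at hs
    obtain ⟨α, β, h⟩ := Ideal.mem_span_pair.1 hs
    -- Both other terms of h are divisible by t^i, hence so is p^a α, and p is regular modulo t.
    obtain ⟨α', rfl⟩ : t ^ i ∣ α := by
      refine pow_dvd_of_pow_dvd_mul ht (dvd_of_dvd_pow_mul reg a) i α ?_
      rw [← hi, pow_add] at h
      exact ⟨(t * D s - (j + 1 : ℕ) * s) - β * t ^ (j + 1), by linear_combination h⟩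
    have h1 : t * D s - (j + 1 : ℕ) * s = α' * p ^ a + β * t ^ (j + 1) := by
      refine mul_left_cancel₀ (pow_ne_zero i ht) ?_
      rw [← h, ← hi]; ring
    obtain ⟨v, n, hn, hv⟩ := Nat.exists_eq_pow_mul_and_not_dvd (by omega : j + 1 ≠ 0) p hp.1.ne_one
    have hva : v < a := by
      refine lt_of_le_of_lt ?_ ha
      refine (Nat.le_log_of_pow_le hp.1.one_lt ?_).trans (Nat.log_mono_right (b := p) (by omega :
        j + 1 ≤ m))
      exact Nat.le_of_dvd (Nat.succ_pos j) ⟨n, hv⟩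
    obtain ⟨b, rfl⟩ : ∃ b, a = v + (b + 1) := ⟨a - v - 1, by omega⟩
    have hvS : ((j + 1 : ℕ) : S) = p ^ v * n := by rw [hv]; push_cast; ring
    -- Leading coefficients: j + 1 = p^v n kills only v of the a powers of p, so b + 1 = a - v ≥ 1
    -- of them remain on s modulo t.
    obtain ⟨β', hβ'⟩ : t ∣ n * s + p ^ (b + 1) * α' := by
      refine dvd_of_dvd_pow_mul reg v _ ⟨D s - β * t ^ j, ?_⟩
      rw [hvS] at h1
      linear_combination -h1
    have hcop : IsCoprime (n : ℤ) ((p ^ (b + 1) : ℕ) : ℤ) :=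
      Nat.isCoprime_iff_coprime.2 (((Nat.Prime.coprime_iff_not_dvd hp.1).2 hn).symm.pow_right _)
    obtain ⟨A, B, hAB⟩ := hcop
    have hAB' : (A : S) * n + B * p ^ (b + 1) = 1 := by exact_mod_cast congrArg (Int.cast : ℤ → S) hAB
    -- By the Bézout relation, s ≡ p^(b+1) (B s - A α') modulo t. The approximation error p^v u
    -- becomes p^a u after multiplication by p^(b+1), and D c is divisible by p^a, so subtracting
    -- both terms preserves the hypothesis on the polar part.
    obtain ⟨c, hc, hg⟩ := exists_constant_approx D frob (v + (b + 1)) v (B * s - A * α')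
    obtain ⟨u, w, huw⟩ := Ideal.mem_span_pair.1 hg
    have hs2 : s = p ^ (b + 1) * c + p ^ (v + (b + 1)) * u + t * (A * β' + p ^ (b + 1) * w) := by
      linear_combination (-s) * hAB' - A * hβ'.symm - p ^ (b + 1) * huw
    set s₂ := A * β' + p ^ (b + 1) * w
    obtain ⟨c', hc'⟩ := hc
    have key := ih (i + 1) (by omega) s₂ ?_
    · have : t ^ i * s = t ^ (i + 1) * s₂ +
          p * (p ^ b * t ^ i * c + p ^ (v + b) * t ^ i * u) := by
        rw [hs2]; ring
      rw [this]
      exact add_mem key (Ideal.mul_mem_right _ _ (Ideal.subset_span (by simp)))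
    · have : t ^ (i + 1) * s₂ = t ^ i * s - p ^ (b + 1) * (t ^ i * c)
        - p ^ (v + (b + 1)) * (t ^ i * u) := by
        rw [hs2]; ring
      have hpD (k : ℕ) (z : S) : D (p ^ k * z) = p ^ k * D z := by
        have : D ((p : S) ^ k) = 0 := by
          rw [← Nat.cast_pow]; exact D.map_natCast _
        rw [Derivation.leibniz, this]; simp
      have e1 : t * D (t ^ (i + 1) * s₂) - m * (t ^ (i + 1) * s₂) =
          (t * D (t ^ i * s) - m * (t ^ i * s)) -
          p ^ (b + 1) * (t * D (t ^ i * c) - m * (t ^ i * c)) -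
          p ^ (v + (b + 1)) * (t * D (t ^ i * u) - m * (t ^ i * u)) := by
        rw [this, map_sub, map_sub, hpD, hpD]; ring
      rw [e1]
      refine sub_mem (sub_mem hs' ?_) (Ideal.mul_mem_right _ _ (Ideal.subset_span (by simp)))
      rw [hD i (j + 1) hi, hc', hvS]
      refine Ideal.mem_of_dvd _ ?_ (Ideal.subset_span (Set.mem_insert _ _))
      exact ⟨p ^ (b + 1) * t ^ (i + 1) * c' - n * t ^ i * c, by ring⟩

/-- If the residues of `t ∂(g / t ^ m)` vanish up to bounded powers of `p` in order `> m - e`, then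
so do those of `g / t ^ m`. -/
lemma exists_pow_dvd_of_pow_dvd [IsDomain S] [hp : Fact p.Prime] (hDt : D t = 1)
    (reg : ∀ s, t ∣ p * s → t ∣ s) (unit : ∀ n : ℕ, n.Coprime p → IsUnit (n : S))
    {e m : ℕ} (he : e ≤ m) (k : ℕ) (g : S) (hg : t ^ e ∣ p ^ k * (t * D g - m * g)) :
    ∃ N, t ^ e ∣ p ^ N * g := by
  have ht : t ≠ 0 := by rintro rfl; simp at hDt
  suffices H : ∀ i ≤ e, ∃ N, t ^ i ∣ p ^ N * g from H e le_rfl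
  intro i
  induction i with
  | zero => exact fun _ => ⟨0, by simp⟩
  | succ i ih =>
    intro hi
    obtain ⟨N, g', hg'⟩ := ih (by omega)
    -- The leading coefficient gets multiplied by m - i, which is nonzero since i < e ≤ m; its
    -- prime-to-p part is a unit and its p-part is regular modulo t.
    obtain ⟨v, n, hn, hv⟩ :=
      Nat.exists_eq_pow_mul_and_not_dvd (by omega : m - i ≠ 0) p hp.1.ne_one
    have hu := unit n (((Nat.Prime.coprime_iff_not_dvd hp.1).2 hn).symm)
    have hpD (k : ℕ) (z : S) : D (p ^ k * z) = p ^ k * D z := by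
      have : D ((p : S) ^ k) = 0 := by
        rw [← Nat.cast_pow]; exact D.map_natCast _
      rw [Derivation.leibniz, this]; simp
    have h1 : p ^ N * (t * D g - m * g) = t ^ i * (t * D g' - (m - i : ℕ) * g') := by
      have : t * (i * t ^ (i - 1)) = i * t ^ i := by
        cases i <;> simp [pow_succ]; ring
      have h2 := hpD N g
      rw [hg', Derivation.leibniz, Derivation.leibniz_pow, hDt] at h2
      simp only [nsmul_eq_mul, smul_eq_mul, mul_one] at h2
      rw [Nat.cast_sub (by omega)]
      linear_combination (-t) * h2 - m * hg' + g' * this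
    have h2 : t ∣ p ^ k * (t * D g' - (m - i : ℕ) * g') := by
      have : t ^ (i + 1) ∣ p ^ N * (p ^ k * (t * D g - m * g)) :=
        ((pow_dvd_pow t hi).trans hg).mul_left _
      rw [mul_left_comm, h1, mul_left_comm, pow_succ] at this
      exact (mul_dvd_mul_iff_left (pow_ne_zero _ ht)).1 this
    have h3 : t ∣ g' := by
      have h4 := dvd_of_dvd_pow_mul reg k _ h2
      have h5 : t ∣ ((m - i : ℕ) : S) * g' := by
        simpa using (dvd_mul_right t (D g')).sub h4
      rw [hv] at h5
      push_cast at h5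
      rw [mul_assoc] at h5
      exact hu.dvd_mul_left.1 (dvd_of_dvd_pow_mul reg v _ h5)
    refine ⟨N, ?_⟩
    rw [hg', pow_succ]
    exact mul_dvd_mul_left _ h3

end LocalExpansion

/-! ### Charts along the zero locus of r, and gluing -/

section Charts

variable {L : Type u} [Field L]

/-- A smooth chart of a ring `B` of functions on a relative curve at a maximal ideal `𝔫`: a
localization `S` of `B` with a coordinate `t` whose zero locus is étale over the base and contains
the zero locus of `r = t ^ e * ε`; `D` is the derivation `d/dt`. -/
structure Chart (B : Subring L) (θ : Derivation ℤ L L) (p : ℕ) (r : L) (𝔫 : Ideal B) (e : ℕ) where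
  S : Type u
  [ring : CommRing S]
  ι : S →+* L
  inj : Function.Injective ι
  D : Derivation ℤ S S
  t : S
  ε : Sˣ
  η : Sˣ
  le : ∀ b : B, ∃ s, ι s = b
  frac : ∀ s, ∃ c : B, c ∉ 𝔫 ∧ (c : L) * ι s ∈ B
  eq_pow : r = ι (t ^ e * ε)
  D_t : D t = 1
  map_D : ∀ s, θ (ι s) = ι (η * t * D s)
  reg : ∀ s, t ∣ p * s → t ∣ s
  frob : ∀ s : S, ∃ c, s - c ^ p ∈ Ideal.span {(p : S), t}
  unit : ∀ n : ℕ, n.Coprime p → IsUnit (n : S)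

attribute [instance] Chart.ring

/-- The conductor ideal {b : b z ∈ N} contains a power of r. If it were proper, a maximal ideal
containing it would contain r, contradicting the local hypothesis there. -/
lemma mem_of_forall_exists_notMem (B : Subring L) (r : B) (N : Submodule B L) (z : L)
    (hz : ∃ n, r ^ n • z ∈ N)
    (H : ∀ 𝔫 : Ideal B, 𝔫.IsMaximal → r ∈ 𝔫 → ∃ c ∉ 𝔫, c • z ∈ N) : z ∈ N := by
  let J : Ideal B := N.comap (LinearMap.toSpanSingleton B L z)
  have hJ : J = ⊤ := by
    by_contra hJ
    obtain ⟨𝔪, h𝔪, hle⟩ := Ideal.exists_le_maximal J hJ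
    obtain ⟨n, hn⟩ := hz
    obtain ⟨c, hc, hcz⟩ := H 𝔪 h𝔪 (h𝔪.isPrime.mem_of_pow_mem n (hle hn))
    exact hc (hle hcz)
  have : (1 : B) ∈ J := hJ ▸ Submodule.mem_top
  simpa [J] using this

variable {B : Subring L} {θ : Derivation ℤ L L} {p : ℕ} {r : B}

lemma Chart.isDomain {𝔫 : Ideal B} {e : ℕ} (c : Chart B θ p r 𝔫 e) : IsDomain c.S :=
  c.inj.isDomain c.ι

lemma Chart.frac₂ {𝔫 : Ideal B} [𝔫.IsPrime] {e : ℕ} (c : Chart B θ p r 𝔫 e) (s s' : c.S) :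
    ∃ a : B, a ∉ 𝔫 ∧ (a : L) * c.ι s ∈ B ∧ (a : L) * c.ι s' ∈ B := by
  obtain ⟨a, ha, h⟩ := c.frac s
  obtain ⟨b, hb, h'⟩ := c.frac s'
  refine ⟨a * b, fun hab => ((Ideal.IsPrime.mem_or_mem ‹_› hab).elim ha hb), ?_, ?_⟩
  · have := B.mul_mem b.2 h
    convert this using 1
    push_cast; ring
  · have := B.mul_mem a.2 h'
    convert this using 1
    push_cast; ring

lemma map_mem_of_charts
    (charts : ∀ 𝔫 : Ideal B, 𝔫.IsMaximal → r ∈ 𝔫 → ∃ e, Nonempty (Chart B θ p r 𝔫 e))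
    (f : B) (hf : ∃ n, (r : L) ^ n * θ f ∈ B) : θ f ∈ B := by
  have : θ f ∈ LinearMap.range (Algebra.linearMap B L) := by
    refine mem_of_forall_exists_notMem B r _ _ ?_ ?_
    · obtain ⟨n, hn⟩ := hf
      exact ⟨n, ⟨_, hn⟩, by simp [Subring.smul_def]; rfl⟩
    · intro 𝔫 h𝔫 hr
      obtain ⟨e, ⟨c⟩⟩ := charts 𝔫 h𝔫 hr
      obtain ⟨s, hs⟩ := c.le f
      obtain ⟨a, ha, h⟩ := c.frac (c.η * c.t * c.D s)
      refine ⟨a, ha, ⟨_, h⟩, ?_⟩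
      rw [← hs, c.map_D]
      simp [Subring.smul_def]
      rfl
  obtain ⟨b, hb⟩ := this
  rw [← hb]
  exact b.2

/-- Since θ is a unit times t d/dt, it is logarithmic along t = 0 and does not raise the order of a
pole. -/
lemma Chart.map_div_pow {𝔫 : Ideal B} {e : ℕ} (c : Chart B θ p r 𝔫 e) (s : c.S) (m : ℕ) :
    θ (c.ι s / c.ι c.t ^ m) * c.ι c.t ^ m = c.ι (c.η * (c.t * c.D s - m * s)) := by
  have := c.isDomain
  have ht : c.ι c.t ≠ 0 := by
    rw [map_ne_zero_iff _ c.inj]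
    intro h
    have := c.D_t
    simp [h] at this
  have h1 := c.map_D c.t
  rw [c.D_t, mul_one, map_mul] at h1
  have h2 : θ (c.ι s) = θ (c.ι s / c.ι c.t ^ m) * c.ι c.t ^ m +
      (c.ι s / c.ι c.t ^ m) * (m * (c.ι c.η * c.ι c.t ^ m)) := by
    conv_lhs => rw [← div_mul_cancel₀ (c.ι s) (pow_ne_zero m ht)]
    rw [Derivation.leibniz, Derivation.leibniz_pow, h1]
    have : (m : L) * c.ι c.t ^ (m - 1) * c.ι c.t = m * c.ι c.t ^ m := by
      cases m <;> simp [pow_succ]; ring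
    simp only [smul_eq_mul, nsmul_eq_mul]
    linear_combination (c.ι s / c.ι c.t ^ m) * c.ι c.η * this
  rw [c.map_D] at h2
  have h3 : c.ι s / c.ι c.t ^ m * c.ι c.t ^ m = c.ι s := div_mul_cancel₀ _ (pow_ne_zero m ht)
  simp only [map_mul, map_sub, map_natCast] at h2 ⊢
  linear_combination -h2 - m * c.ι c.η * h3

/-- This globalizes `exists_pow_dvd_of_pow_dvd`; it will give the injectivity of one reduction step
over K. The exponent N may depend on the chart, so the gluing is done for the module of all z having
some exponent. -/
lemma exists_pow_mul_mem_of_charts [Fact p.Prime]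
    (charts : ∀ 𝔫 : Ideal B, 𝔫.IsMaximal → r ∈ 𝔫 → ∃ e, Nonempty (Chart B θ p r 𝔫 e))
    {ℓ : ℕ} (hℓ : 1 ≤ ℓ) (f : B) (k : ℕ) (b : B)
    (h : (p : L) ^ k * (θ (f / r ^ ℓ) * r ^ ℓ) = r * b) :
    ∃ (N : ℕ) (b' : B), (p : L) ^ N * f = r * b' := by
  let N : Submodule B L :=
    { carrier := {z | ∃ (N : ℕ) (b' : B), (p : L) ^ N * z = r * b'}
      zero_mem' := ⟨0, 0, by simp⟩
      add_mem' := by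
        rintro z z' ⟨N, b, h⟩ ⟨N', b', h'⟩
        refine ⟨N + N', p ^ N' * b + p ^ N * b', ?_⟩
        push_cast
        linear_combination p ^ N' * h + p ^ N * h'
      smul_mem' := by
        rintro a z ⟨N, b, h⟩
        refine ⟨N, a * b, ?_⟩
        rw [Subring.smul_def, smul_eq_mul]
        push_cast
        linear_combination a * h }
  suffices (f : L) ∈ N from this
  refine mem_of_forall_exists_notMem B r _ _ ⟨1, 0, f, ?_⟩ ?_
  · simp [Subring.smul_def]
  · intro 𝔫 h𝔫 hrn
    obtain ⟨e, ⟨c⟩⟩ := charts 𝔫 h𝔫 hrn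
    have := c.isDomain
    obtain ⟨s, hs⟩ := c.le f
    obtain ⟨sb, hsb⟩ := c.le b
    have ht : c.ι c.t ≠ 0 := by
      rw [map_ne_zero_iff _ c.inj]
      intro h
      have := c.D_t
      simp [h] at this
    have hε : c.ι c.ε ≠ 0 := (c.ε.isUnit.map c.ι).ne_zero
    have hrt : (r : L) ^ ℓ = c.ι c.t ^ (e * ℓ) * c.ι c.ε ^ ℓ := by
      have := congrArg (· ^ ℓ) c.eq_pow
      simp only [map_mul, map_pow] at this
      rw [this]; ring
    set g : c.S := s * ↑(c.ε⁻¹) ^ ℓ with hg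
    have hεi : c.ι c.ε * c.ι ↑c.ε⁻¹ = 1 := by rw [← map_mul]; simp
    have hfg : (f : L) / r ^ ℓ = c.ι g / c.ι c.t ^ (e * ℓ) := by
      rw [hrt, hg, div_eq_div_iff (mul_ne_zero (pow_ne_zero _ ht) (pow_ne_zero _ hε))
        (pow_ne_zero _ ht), ← hs, map_mul, map_pow]
      have : c.ι c.ε ^ ℓ * c.ι ↑c.ε⁻¹ ^ ℓ = 1 := by rw [← mul_pow, hεi, one_pow]
      linear_combination (-(c.ι s) * c.ι c.t ^ (e * ℓ)) * this
    have key := c.map_div_pow g (e * ℓ)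
    obtain ⟨N, u, hu⟩ := exists_pow_dvd_of_pow_dvd c.D (m := e * ℓ) c.D_t c.reg c.unit
      (Nat.le_mul_of_pos_right e hℓ) k g <| by
        refine ⟨↑(c.η⁻¹) * c.ε * sb * ↑(c.ε⁻¹) ^ ℓ, c.inj ?_⟩
        have hηi : c.ι c.η * c.ι ↑c.η⁻¹ = 1 := by rw [← map_mul]; simp
        have hr' := c.eq_pow
        rw [hfg, hrt, ← hsb] at h
        simp only [map_mul, map_pow, map_sub, map_natCast] at h key hr' ⊢
        have : c.ι c.ε ^ ℓ * c.ι ↑c.ε⁻¹ ^ ℓ = 1 := by rw [← mul_pow, hεi, one_pow]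
        set E := c.ι c.ε ^ ℓ
        set E' := c.ι ↑c.ε⁻¹ ^ ℓ
        set T := θ (c.ι g / c.ι c.t ^ (e * ℓ))
        set h' := c.ι ↑c.η⁻¹
        set X := c.ι c.t * c.ι (c.D g) - ((e * ℓ : ℕ) : L) * c.ι g
        linear_combination (h' * E') * h - (p : L) ^ k * h' * key - (p : L) ^ k * X * hηi
          - p ^ k * h' * T * c.ι c.t ^ (e * ℓ) * this + h' * E' * c.ι sb * hr'
    obtain ⟨a, ha, hab⟩ := c.frac (u * ↑(c.ε⁻¹) * c.ε ^ ℓ)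
    refine ⟨a, ha, N, ⟨_, hab⟩, ?_⟩
    have hu' := congrArg c.ι hu
    have hr' := c.eq_pow
    rw [Subring.smul_def, smul_eq_mul, ← hs]
    simp only [map_mul, map_pow, map_natCast, hg] at hu' hr' ⊢
    have : c.ι c.ε ^ ℓ * c.ι ↑c.ε⁻¹ ^ ℓ = 1 := by rw [← mul_pow, hεi, one_pow]
    linear_combination (a * c.ι c.ε ^ ℓ) * hu' - (p : L) ^ N * a * c.ι s * this -
      c.ι c.t ^ e * a * c.ι u * c.ι c.ε ^ ℓ * hεi - a * c.ι u * c.ι ↑c.ε⁻¹ * c.ι c.ε ^ ℓ * hr'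

/-- Gluing of `mem_span_of_log_lt` for the module B + pB[1/r]. The hypothesis says that θ(f/r^ℓ)
agrees with p^a w/r^ℓ up to a function which is regular after multiplication by p^b. -/
lemma exists_eq_add_of_charts [Fact p.Prime] {M a : ℕ} {ℓ : ℕ} (hM : Nat.log p (ℓ * M) < a)
    (charts : ∀ 𝔫 : Ideal B, 𝔫.IsMaximal → r ∈ 𝔫 → ∃ e ≤ M, Nonempty (Chart B θ p r 𝔫 e))
    (hr : (r : L) ≠ 0) (f w z : B) (b : ℕ)
    (h : (p : L) ^ b * (θ (f / r ^ ℓ) - p ^ a * (w / r ^ ℓ)) = z) :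
    ∃ (b α : B) (n : ℕ), (f : L) / r ^ ℓ = b + p * (α / r ^ n) := by
  let N : Submodule B L :=
    { carrier := {z | ∃ (b α : B) (n : ℕ), z = b + p * (α / r ^ n)}
      zero_mem' := ⟨0, 0, 0, by simp⟩
      add_mem' := by
        rintro z z' ⟨b, α, n, h⟩ ⟨b', α', n', h'⟩
        refine ⟨b + b', r ^ n' * α + r ^ n * α', n + n', ?_⟩
        rw [h, h', pow_add]
        push_cast
        field_simp
        ring
      smul_mem' := by
        rintro a z ⟨b, α, n, h⟩
        refine ⟨a * b, a * α, n, ?_⟩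
        rw [Subring.smul_def, smul_eq_mul, h]
        push_cast
        ring }
  suffices (f : L) / r ^ ℓ ∈ N from this
  refine mem_of_forall_exists_notMem B r _ _ ⟨ℓ, f, 0, 0, ?_⟩ ?_
  · simp [Subring.smul_def, mul_div_cancel₀, hr]
  · intro 𝔫 h𝔫 hrn
    obtain ⟨e, heM, ⟨c⟩⟩ := charts 𝔫 h𝔫 hrn
    have := c.isDomain
    obtain ⟨s, hs⟩ := c.le f
    obtain ⟨sw, hsw⟩ := c.le w
    obtain ⟨sz, hsz⟩ := c.le z
    have ht0 : c.t ≠ 0 := by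
      intro h
      have := c.D_t
      simp [h] at this
    have ht : c.ι c.t ≠ 0 := by
      rwa [map_ne_zero_iff _ c.inj]
    have hε : c.ι c.ε ≠ 0 := (c.ε.isUnit.map c.ι).ne_zero
    have hrt : (r : L) ^ ℓ = c.ι c.t ^ (e * ℓ) * c.ι c.ε ^ ℓ := by
      have := congrArg (· ^ ℓ) c.eq_pow
      simp only [map_mul, map_pow] at this
      rw [this]; ring
    set g : c.S := s * ↑(c.ε⁻¹) ^ ℓ with hg
    have hεi : c.ι c.ε * c.ι ↑c.ε⁻¹ = 1 := by rw [← map_mul]; simp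
    have hηi : c.ι c.η * c.ι ↑c.η⁻¹ = 1 := by rw [← map_mul]; simp
    have hE : c.ι c.ε ^ ℓ * c.ι ↑c.ε⁻¹ ^ ℓ = 1 := by rw [← mul_pow, hεi, one_pow]
    have hdiv (s : c.S) : (c.ι s) / r ^ ℓ = c.ι (s * ↑(c.ε⁻¹) ^ ℓ) / c.ι c.t ^ (e * ℓ) := by
      rw [hrt, div_eq_div_iff (mul_ne_zero (pow_ne_zero _ ht) (pow_ne_zero _ hε))
        (pow_ne_zero _ ht), map_mul, map_pow]
      linear_combination (-(c.ι s) * c.ι c.t ^ (e * ℓ)) * hE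
    have key := c.map_div_pow g (e * ℓ)
    have hmem : c.t * c.D g - (e * ℓ : ℕ) * g ∈ Ideal.span {(p : c.S) ^ a, c.t ^ (e * ℓ)} := by
      set y := c.t * c.D g - (e * ℓ : ℕ) * g - ↑(c.η⁻¹) * p ^ a * (sw * ↑(c.ε⁻¹) ^ ℓ) with hy
      -- A regular function has no polar part, so after multiplication by t^(eℓ) it is divisible by
      -- t^(eℓ); the factor p^b is then cancelled modulo powers of t.
      have h1 : c.t ^ (e * ℓ) ∣ p ^ b * y := by
        refine ⟨↑(c.η⁻¹) * sz, c.inj ?_⟩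
        rw [← hs, ← hsw, ← hsz, hdiv, hdiv, ← hg] at h
        have h2 : c.ι (sw * ↑(c.ε⁻¹) ^ ℓ) / c.ι c.t ^ (e * ℓ) * c.ι c.t ^ (e * ℓ) =
          c.ι (sw * ↑(c.ε⁻¹) ^ ℓ) := div_mul_cancel₀ _ (pow_ne_zero _ ht)
        rw [hy]
        simp only [map_mul, map_pow, map_sub, map_natCast] at h h2 key ⊢
        set T := θ (c.ι g / c.ι c.t ^ (e * ℓ))
        set h' := c.ι ↑c.η⁻¹
        set X := c.ι c.t * c.ι (c.D g) - ((e * ℓ : ℕ) : L) * c.ι g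
        set V := c.ι sw * c.ι ↑c.ε⁻¹ ^ ℓ / c.ι c.t ^ (e * ℓ)
        linear_combination (h' * c.ι c.t ^ (e * ℓ)) * h - (p : L) ^ b * h' * key -
          p ^ b * X * hηi + p ^ b * h' * p ^ a * h2
      obtain ⟨y', hy'⟩ : c.t ^ (e * ℓ) ∣ y :=
        pow_dvd_of_pow_dvd_mul ht0 (dvd_of_dvd_pow_mul c.reg b) _ _ h1
      refine Ideal.mem_span_pair.2 ⟨↑(c.η⁻¹) * (sw * ↑(c.ε⁻¹) ^ ℓ), y', ?_⟩
      linear_combination hy - hy'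
    have hlog : Nat.log p (e * ℓ) < a :=
      (Nat.log_mono_right (by rw [mul_comm]; exact Nat.mul_le_mul_left _ heM)).trans_lt hM
    obtain ⟨α, β, hαβ⟩ := Ideal.mem_span_pair.1
      (mem_span_of_log_lt c.D c.D_t c.reg c.frob hlog g hmem)
    obtain ⟨a', ha', h1, h2⟩ := c.frac₂ (α * c.ε ^ ℓ) β
    refine ⟨a', ha', ⟨_, h2⟩, ⟨_, h1⟩, ℓ, ?_⟩
    rw [← hs, hdiv, ← hg, ← hαβ, hrt, Subring.smul_def, smul_eq_mul]
    simp only [map_add, map_mul, map_pow, map_natCast]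
    field_simp
    ring

end Charts

/-! ### Local equations of étale divisors -/

section LocalEquation

open TensorProduct

variable {R C E : Type u} [CommRing R] [CommRing C] [CommRing E] [Algebra R C] [Algebra R E]
  [Algebra C E] [IsScalarTower R C E]

/-- A closed subscheme of a relative curve which is étale over the base is locally defined by one
equation, the differential of which generates the module of differentials. -/
lemma exists_local_equation [Nontrivial C] [Algebra.IsStandardSmoothOfRelativeDimension 1 R C]
    [IsNoetherianRing C]
    [Algebra.Etale R E] (hs : Function.Surjective (algebraMap C E)) :
    ∃ (ω : Module.Basis Unit C Ω[C⁄R]) (t τ b : C), t ∈ RingHom.ker (algebraMap C E) ∧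
      KaehlerDifferential.D R C t = τ • ω () ∧ τ - 1 ∈ RingHom.ker (algebraMap C E) ∧
      b - 1 ∈ RingHom.ker (algebraMap C E) ∧ ∀ x ∈ RingHom.ker (algebraMap C E), t ∣ b * x := by
  have : Algebra.IsStandardSmooth R C :=
    Algebra.IsStandardSmoothOfRelativeDimension.isStandardSmooth 1
  have hrank : Module.rank C Ω[C⁄R] = 1 := by
    simpa using Algebra.IsStandardSmoothOfRelativeDimension.rank_kaehlerDifferential (R := R)
      (S := C) 1
  have hfin : Module.finrank C Ω[C⁄R] = 1 := Module.rank_eq_one_iff_finrank_eq_one.1 hrank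
  let ω : Module.Basis Unit C Ω[C⁄R] := Module.basisUnique Unit hfin
  let ωE : Module.Basis Unit E (E ⊗[C] Ω[C⁄R]) := ω.baseChange E
  have hω (z : Ω[C⁄R]) : z = ω.repr z () • ω () := by
    conv_lhs => rw [← ω.sum_repr z]
    simp
  have hωE (z : Ω[C⁄R]) : ωE.repr (1 ⊗ₜ z) () = algebraMap C E (ω.repr z ()) := by
    simp [ωE, Algebra.algebraMap_eq_smul_one]
  -- Smoothness of E over R makes the conormal sequence exact on the left, and Ω[E⁄R] = 0 makes I/I²
  -- → E ⊗ Ω[C⁄R] onto. So I/I² is free of rank one, and t lifts the generator corresponding to ω.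
  have hinj : Function.Injective (KaehlerDifferential.kerCotangentToTensor R C E) :=
    (Algebra.FormallySmooth.kerCotangentToTensor_injective_iff hs).2 inferInstance
  have hrange := KaehlerDifferential.range_kerCotangentToTensor R C E hs
  have hsub : Subsingleton Ω[E⁄R] := inferInstance
  obtain ⟨t, ht⟩ : ∃ t : RingHom.ker (algebraMap C E),
      (1 : E) ⊗ₜ[C] KaehlerDifferential.D R C t = 1 ⊗ₜ ω () := by
    have : (1 : E) ⊗ₜ[C] ω () ∈
        LinearMap.range (KaehlerDifferential.kerCotangentToTensor R C E) := by
      rw [hrange]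
      exact Subsingleton.elim _ _
    obtain ⟨z, hz⟩ := this
    obtain ⟨t, rfl⟩ := Ideal.toCotangent_surjective _ z
    exact ⟨t, hz⟩
  have hle : RingHom.ker (algebraMap C E) ≤ Ideal.span {(t : C)} ⊔
      RingHom.ker (algebraMap C E) • RingHom.ker (algebraMap C E) := by
    intro x hx
    set ξ := ω.repr (KaehlerDifferential.D R C x) ()
    have h1 : KaehlerDifferential.kerCotangentToTensor R C E
        (Ideal.toCotangent _ (⟨x, hx⟩ - ξ • t)) = 0 := by
      rw [map_sub, map_smul, map_sub, map_smul,
        KaehlerDifferential.kerCotangentToTensor_toCotangent,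
        KaehlerDifferential.kerCotangentToTensor_toCotangent, ht, ← TensorProduct.tmul_smul, ← hω,
        sub_self]
    have h2 := (Ideal.toCotangent_eq_zero _ _).1 (hinj (h1.trans (map_zero _).symm))
    rw [smul_eq_mul, ← sq]
    have : x = ξ * t + (x - ξ * t) := by ring
    rw [this]
    exact add_mem (Ideal.mem_sup_left (Ideal.mul_mem_left _ _ (Ideal.mem_span_singleton_self _)))
      (Ideal.mem_sup_right (by simpa using h2))
  -- Nakayama in global form: b ≡ 1 modulo I is the function to be inverted so that t generates I.
  obtain ⟨b, hb, hbx⟩ := Submodule.exists_sub_one_mem_and_smul_le_of_fg_of_le_sup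
    (IsNoetherian.noetherian _) le_rfl hle
  refine ⟨ω, t, ω.repr (KaehlerDifferential.D R C t) (), b, t.2, hω _, ?_, hb, fun x hx => ?_⟩
  · rw [RingHom.mem_ker, map_sub, ← hωE, ht, hωE]
    simp
  · exact Ideal.mem_span_singleton.1 (hbx (Submodule.smul_mem_pointwise_smul x b _ hx))

/-- As τ becomes a unit, dt is a basis of the differentials of the local ring, and d/dt is the dual
coordinate. -/
lemma exists_derivation_of_local_equation (𝔭 : Ideal C) [𝔭.IsPrime] (S : Type u) [CommRing S]
    [Algebra C S] [Algebra R S] [IsScalarTower R C S] [IsLocalization.AtPrime S 𝔭]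
    (ω : Module.Basis Unit C Ω[C⁄R]) {t τ : C} (hτ : τ ∉ 𝔭)
    (ht : KaehlerDifferential.D R C t = τ • ω ()) :
    (∃ δ : Derivation R S S, δ (algebraMap C S t) = 1) ∧
      Submodule.span S {KaehlerDifferential.D R S (algebraMap C S t)} = ⊤ := by
  have : Algebra.FormallyEtale C S := .of_isLocalization 𝔭.primeCompl
  let e := KaehlerDifferential.tensorKaehlerEquivOfFormallyEtale R C S
  let ωS : Module.Basis Unit S Ω[S⁄R] := (ω.baseChange S).map e
  have hu : IsUnit (algebraMap C S τ) := IsLocalization.map_units S (⟨τ, hτ⟩ : 𝔭.primeCompl)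
  have htS : KaehlerDifferential.D R S (algebraMap C S t) = algebraMap C S τ • ωS () := by
    have h1 : KaehlerDifferential.D R S (algebraMap C S t) =
        e (1 ⊗ₜ KaehlerDifferential.D R C t) := by simp [e]
    rw [h1, ht, TensorProduct.tmul_smul, ← algebraMap_smul S τ, map_smul]
    simp [ωS]
  obtain ⟨u, hu⟩ := hu
  refine ⟨⟨((↑u⁻¹ : S) • ωS.coord ()).compDer (KaehlerDifferential.D R S), ?_⟩, ?_⟩
  · change (↑u⁻¹ : S) • ωS.coord () (KaehlerDifferential.D R S (algebraMap C S t)) = 1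
    rw [htS, ← hu]
    simp
  · rw [htS, Submodule.span_singleton_smul_eq (hu ▸ u.isUnit)]
    have := ωS.span_eq
    rwa [Set.range_unique] at this

end LocalEquation

/-! ### Affine charts of 𝒳 and the valuative criterion -/

noncomputable section SchemeCharts

open Limits

variable {R : Type u} [CommRing R] {X D : Scheme.{u}}

/-- An affine open chart of a scheme over `R`. -/
structure AffineChart (π : X ⟶ Spec (.of R)) (C : Type u) [CommRing C] [Algebra R C] where
  f : Spec (.of C) ⟶ X
  open_f : IsOpenImmersion f
  fac : f ≫ π = Spec.map (CommRingCat.ofHom (algebraMap R C))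

attribute [instance] AffineChart.open_f

/-- The restriction of an affine chart to a principal open subset. -/
def AffineChart.localize {π : X ⟶ Spec (.of R)} {C : Type u} [CommRing C] [Algebra R C]
    (c : AffineChart π C) (a : C) (C' : Type u) [CommRing C'] [Algebra R C'] [Algebra C C']
    [IsScalarTower R C C'] [IsLocalization.Away a C'] : AffineChart π C' where
  f := Spec.map (CommRingCat.ofHom (algebraMap C C')) ≫ c.f
  open_f := by
    have := IsOpenImmersion.of_isLocalization (R := C) (S := C') a
    infer_instance
  fac := by
    rw [Category.assoc, c.fac, ← Spec.map_comp, ← CommRingCat.ofHom_comp,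
      ← IsScalarTower.algebraMap_eq]

lemma exists_smooth_chart (π : X ⟶ Spec (.of R)) [SmoothOfRelativeDimension 1 π] (P : X) :
    ∃ (C : Type u) (_ : CommRing C) (_ : Algebra R C) (c : AffineChart π C),
      P ∈ Set.range c.f ∧ Algebra.IsStandardSmoothOfRelativeDimension 1 R C := by
  obtain ⟨U, hU, hP⟩ : ∃ U : X.Opens, IsAffineOpen U ∧ P ∈ U := by
    obtain ⟨_, ⟨U, hU, rfl⟩, hxU, -⟩ :=
      X.isBasis_affineOpens.exists_subset_of_mem_open (Set.mem_univ P) isOpen_univ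
    exact ⟨U, hU, hxU⟩
  have h1 : SmoothOfRelativeDimension 1 (hU.fromSpec ≫ π) :=
    inferInstanceAs (SmoothOfRelativeDimension (0 + 1) (hU.fromSpec ≫ π))
  let φ := Spec.preimage (hU.fromSpec ≫ π)
  have hφ : Spec.map φ = hU.fromSpec ≫ π := Spec.map_preimage _
  rw [← hφ, HasRingHomProperty.Spec_iff (P := @SmoothOfRelativeDimension 1)] at h1
  obtain ⟨s, hs, h⟩ := h1
  obtain ⟨z, hz⟩ : P ∈ Set.range hU.fromSpec := by rwa [hU.range_fromSpec]
  obtain ⟨a, ha, haz⟩ : ∃ a ∈ s, a ∉ z.asIdeal := by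
    by_contra! H
    exact z.2.ne_top (top_le_iff.1 (hs ▸ Ideal.span_le.2 H))
  let := φ.hom.toAlgebra
  let c : AffineChart π Γ(X, U) := ⟨hU.fromSpec, inferInstance, hφ.symm⟩
  refine ⟨Localization.Away a, inferInstance, inferInstance, c.localize a _, ?_, ?_⟩
  · obtain ⟨z', rfl⟩ : z ∈ Set.range (Spec.map (CommRingCat.ofHom
        (algebraMap Γ(X, U) (Localization.Away a)))) := by
      have := PrimeSpectrum.localization_away_comap_range (Localization.Away a) a
      exact this.ge haz
    exact ⟨z', hz⟩
  · rw [← RingHom.isStandardSmoothOfRelativeDimension_algebraMap,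
      IsScalarTower.algebraMap_eq R Γ(X, U)]
    exact h a ha

lemma exists_etale_quotient {π : X ⟶ Spec (.of R)} {C : Type u} [CommRing C] [Algebra R C]
    (c : AffineChart π C) (i : D ⟶ X) [IsClosedImmersion i] [Etale (i ≫ π)] :
    ∃ I : Ideal C, Algebra.Etale R (C ⧸ I) ∧ ∀ z, c.f z ∈ Set.range i ↔ I ≤ z.asIdeal := by
  have h0 : IsClosedImmersion (pullback.snd i c.f) := inferInstance
  obtain ⟨I, e, he⟩ : ∃ (I : Ideal C) (e : pullback i c.f ≅ Spec (.of (C ⧸ I))),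
    pullback.snd i c.f = e.hom ≫ Spec.map (CommRingCat.ofHom (Ideal.Quotient.mk I)) :=
    IsClosedImmersion.Spec_iff.1 h0
  have h1 : Etale (pullback.snd i c.f ≫ c.f ≫ π) := by
    rw [← Category.assoc, ← pullback.condition, Category.assoc]
    infer_instance
  have h2 : Etale (Spec.map (CommRingCat.ofHom (algebraMap R (C ⧸ I)))) := by
    have : Spec.map (CommRingCat.ofHom (algebraMap R (C ⧸ I))) =
        e.inv ≫ (pullback.snd i c.f ≫ c.f ≫ π) := by
      rw [he, c.fac, Category.assoc, e.inv_hom_id_assoc, ← Spec.map_comp]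
      rfl
    rw [this]
    infer_instance
  refine ⟨I, ?_, fun z => ?_⟩
  · rw [HasRingHomProperty.Spec_iff (P := @Etale)] at h2
    exact RingHom.etale_algebraMap.1 h2
  · have h3 := Scheme.Pullback.range_snd i c.f
    have hsurj : Set.range e.hom = Set.univ :=
      Set.range_eq_univ.2 e.hom.homeomorph.surjective
    rw [he, Scheme.Hom.comp_base, TopCat.coe_comp, Set.range_comp, hsurj, Set.image_univ] at h3
    have h4 : Set.range (Spec.map (CommRingCat.ofHom (Ideal.Quotient.mk I))) =
        PrimeSpectrum.zeroLocus (I : Set C) := by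
      have := range_comap_of_surjective _ _ (Ideal.Quotient.mk_surjective (I := I))
      rw [Ideal.mk_ker] at this
      exact this
    rw [h4] at h3
    exact (Set.ext_iff.1 h3 z).symm

lemma AffineChart.exists_algHom {π : X ⟶ Spec (.of R)} {A C : Type u} [CommRing A] [Algebra R A]
    [CommRing C] [Algebra R C] (j : AffineChart π A) (φ : Spec (.of C) ⟶ X)
    (hφ : φ ≫ π = Spec.map (CommRingCat.ofHom (algebraMap R C)))
    (h : ∀ z, φ z ∈ Set.range j.f) :
    ∃ ψ : A →ₐ[R] C, Spec.map (CommRingCat.ofHom ψ.toRingHom) ≫ j.f = φ := by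
  let l := IsOpenImmersion.lift j.f φ (Set.range_subset_iff.2 h)
  have hl : l ≫ j.f = φ := IsOpenImmersion.lift_fac _ _ _
  have hm : Spec.map (Spec.preimage l) = l := Spec.map_preimage l
  have hc : CommRingCat.ofHom (algebraMap R A) ≫ Spec.preimage l =
      CommRingCat.ofHom (algebraMap R C) := by
    apply Spec.map_injective
    rw [Spec.map_comp, hm, ← j.fac, ← hφ, ← hl, Category.assoc]
  refine ⟨⟨(Spec.preimage l).hom, fun r => ?_⟩, ?_⟩
  · exact congrArg (fun f => f.hom r) hc
  · exact (congrArg (· ≫ j.f) hm).trans hl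

lemma AffineChart.algHom_ext {π : X ⟶ Spec (.of R)} {A C : Type u} [CommRing A] [Algebra R A]
    [CommRing C] (j : AffineChart π A) {φ ψ : A →+* C}
    (h : Spec.map (CommRingCat.ofHom φ) ≫ j.f = Spec.map (CommRingCat.ofHom ψ) ≫ j.f) :
    φ = ψ := by
  have h1 := Spec.map_injective ((cancel_mono j.f).1 h)
  exact congrArg CommRingCat.Hom.hom h1

/-- Properness extends Spec L → X to the spectrum of the valuation ring. A smooth chart around the
image of the closed point contains the whole image, since every point specializes to the closed one.
-/
lemma exists_smooth_chart_of_valuationRing (π : X ⟶ Spec (.of R)) [IsProper π]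
    [SmoothOfRelativeDimension 1 π] {A L : Type u} [CommRing A] [Algebra R A] [Field L]
    [Algebra R L] (j : AffineChart π A) (ψ : A →ₐ[R] L) (𝒱 : Type u) [CommRing 𝒱] [IsDomain 𝒱]
    [ValuationRing 𝒱] [Algebra R 𝒱] [Algebra 𝒱 L] [IsScalarTower R 𝒱 L] [IsFractionRing 𝒱 L] :
    ∃ (C : Type u) (_ : CommRing C) (_ : Algebra R C) (c : AffineChart π C) (β : C →ₐ[R] 𝒱),
      Algebra.IsStandardSmoothOfRelativeDimension 1 R C ∧
      Spec.map (CommRingCat.ofHom ((algebraMap 𝒱 L).comp β.toRingHom)) ≫ c.f =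
        Spec.map (CommRingCat.ofHom ψ.toRingHom) ≫ j.f := by
  have H : ValuativeCriterion.Existence π := by
    have : UniversallyClosed π := inferInstance
    rw [UniversallyClosed.eq_valuativeCriterion] at this
    exact this.1
  let sq : ValuativeCommSq π :=
    { R := 𝒱
      K := L
      i₁ := Spec.map (CommRingCat.ofHom ψ.toRingHom) ≫ j.f
      i₂ := Spec.map (CommRingCat.ofHom (algebraMap R 𝒱))
      commSq := ⟨by
        rw [Category.assoc, j.fac, ← Spec.map_comp, ← Spec.map_comp, ← CommRingCat.ofHom_comp,
          ← CommRingCat.ofHom_comp, ← IsScalarTower.algebraMap_eq]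
        congr 2
        exact ψ.comp_algebraMap⟩ }
  obtain ⟨l, hl₁, hl₂⟩ := (H sq).exists_lift
  obtain ⟨C, _, _, c, hc, hC⟩ := exists_smooth_chart π (l (IsLocalRing.closedPoint 𝒱))
  have hopen : IsOpen (l ⁻¹' Set.range c.f) := c.open_f.base_open.isOpen_range.preimage l.continuous
  obtain ⟨β, hβ⟩ := c.exists_algHom l hl₂ fun z =>
    (IsLocalRing.specializes_closedPoint z).mem_open hopen hc
  refine ⟨C, _, _, c, β, hC, ?_⟩
  refine Eq.trans ?_ hl₁
  rw [← hβ, ← Category.assoc, ← Spec.map_comp]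
  rfl

/-- Spec C is an open subscheme of the integral scheme Spec A. The kernel of γ and the zero ideal of
C both lie over the generic point of Spec A, so they coincide. -/
lemma AffineChart.injective_of_isDomain {π : X ⟶ Spec (.of R)} {A C L : Type u} [CommRing A]
    [IsDomain A] [Algebra R A] [CommRing C] [Algebra R C] [Field L] [Algebra R L]
    (j : AffineChart π A) (c : AffineChart π C) (ψ : A →ₐ[R] L) (hψ : Function.Injective ψ)
    (γ : C →+* L) (h : Spec.map (CommRingCat.ofHom γ) ≫ c.f =
        Spec.map (CommRingCat.ofHom ψ.toRingHom) ≫ j.f)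
    (hr : ∀ z, c.f z ∈ Set.range j.f) :
    Function.Injective γ ∧ ∃ χ : A →ₐ[R] C, (γ.comp χ.toRingHom = ψ) ∧
      Spec.map (CommRingCat.ofHom χ.toRingHom) ≫ j.f = c.f := by
  obtain ⟨χ, hχ⟩ := j.exists_algHom c.f c.fac hr
  have hγχ : γ.comp χ.toRingHom = ψ := by
    apply j.algHom_ext
    rw [CommRingCat.ofHom_comp, Spec.map_comp, Category.assoc, hχ, h]
    rfl
  refine ⟨?_, χ, hγχ, hχ⟩
  have : IsOpenImmersion (Spec.map (CommRingCat.ofHom χ.toRingHom) ≫ j.f) := by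
    rw [hχ]; infer_instance
  have h1 : IsOpenImmersion (Spec.map (CommRingCat.ofHom χ.toRingHom)) := IsOpenImmersion.of_comp _ j.f
  have : Nontrivial C := γ.domain_nontrivial
  have h2 : IsIntegral (Spec (.of C)) := by
    have : Nonempty (Spec (.of C)) := inferInstanceAs (Nonempty (PrimeSpectrum C))
    exact isIntegral_of_isOpenImmersion (Spec.map (CommRingCat.ofHom χ.toRingHom))
  have h3 : IsDomain C := (affine_isIntegral_iff (.of C)).1 h2
  have hinj : Function.Injective (PrimeSpectrum.comap χ.toRingHom) := h1.base_open.injective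
  have h4 : PrimeSpectrum.comap χ.toRingHom ⟨RingHom.ker γ, RingHom.ker_isPrime γ⟩ = ⊥ := by
    ext1
    rw [PrimeSpectrum.comap_asIdeal, RingHom.comap_ker, hγχ]
    exact (RingHom.injective_iff_ker_eq_bot _).1 hψ
  have h5 : PrimeSpectrum.comap χ.toRingHom ⊥ = ⊥ := by
    refine le_bot_iff.1 (h4 ▸ ?_)
    exact Ideal.comap_mono bot_le
  have h6 := congrArg PrimeSpectrum.asIdeal (hinj (h4.trans h5.symm))
  exact (RingHom.injective_iff_ker_eq_bot _).2 h6

end SchemeCharts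

/-! ### Zariski's main theorem -/

section ZariskiMain

lemma quasiFinite_of_finite (B T : Type*) [CommRing B] [CommRing T] [Algebra B T] [Finite T] :
    Algebra.QuasiFinite B T :=
  have : Module.Finite B T := Module.Finite.of_finite
  inferInstance

/-- A local ring essentially of finite type over `B`, in which `B` is integrally closed and with
finite fibre, is a localization of `B`. -/
lemma exists_isUnit_mul_mem_of_finite_fiber {B S : Type u} [CommRing B] [CommRing S] [IsDomain S]
    [IsLocalRing S] [Algebra B S]
    (hint : ∀ s : S, IsIntegral B s → s ∈ Set.range (algebraMap B S)) (G : Set S) (hG : G.Finite)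
    (hloc : ∀ s, ∃ u ∈ Algebra.adjoin B G, IsUnit u ∧ u * s ∈ Algebra.adjoin B G)
    (hfin : Finite (S ⧸ ((IsLocalRing.maximalIdeal S).comap (algebraMap B S)).map
      (algebraMap B S))) (s : S) :
    ∃ b b', IsUnit (algebraMap B S b) ∧ algebraMap B S b * s = algebraMap B S b' := by
  let C := Algebra.adjoin B G
  have : Algebra.FiniteType B C := (Subalgebra.fg_iff_finiteType _).1 ⟨hG.toFinset, by simp [C]⟩
  let 𝔮 : Ideal C := (IsLocalRing.maximalIdeal S).comap (algebraMap C S)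
  have h𝔮 (c : C) : c ∉ 𝔮 ↔ IsUnit (c : S) := by
    simp [𝔮]
  have : IsLocalization.AtPrime S 𝔮 := by
    refine ⟨fun y => (h𝔮 _).1 y.2, fun z => ?_, fun {x y} h => ⟨1, ?_⟩⟩
    · obtain ⟨u, hu, hu', hs⟩ := hloc z
      exact ⟨⟨⟨_, hs⟩, ⟨⟨u, hu⟩, (h𝔮 _).2 hu'⟩⟩, mul_comm _ _⟩
    · simpa using Subtype.ext h
  -- The local ring of C at 𝔮 is S, so the finiteness of the fibre of S is quasi-finiteness at 𝔮.
  have hw : Algebra.WeaklyQuasiFiniteAt B 𝔮 := by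
    rw [Algebra.weaklyQuasiFiniteAt_iff]
    let e : Localization.AtPrime 𝔮 ≃ₐ[C] S := IsLocalization.algEquiv 𝔮.primeCompl _ _
    let J := ((𝔮.under B).map (algebraMap B (Localization.AtPrime 𝔮)))
    have hJ : 𝔮.under B = (IsLocalRing.maximalIdeal S).comap (algebraMap B S) := rfl
    have hle : ((IsLocalRing.maximalIdeal S).comap (algebraMap B S)).map (algebraMap B S) ≤
        J.comap e.symm.toRingHom := by
      rw [Ideal.map_le_iff_le_comap]
      intro b hb
      have : e.symm (algebraMap B S b) = algebraMap B (Localization.AtPrime 𝔮) b := by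
        rw [IsScalarTower.algebraMap_apply B C S, e.symm.commutes,
          ← IsScalarTower.algebraMap_apply]
      change e.symm (algebraMap B S b) ∈ J
      rw [this]
      exact Ideal.mem_map_of_mem _ hb
    have hf : Finite (Localization.AtPrime 𝔮 ⧸ J) := by
      refine Finite.of_surjective (Ideal.quotientMap J e.symm.toRingHom hle) ?_
      exact Ideal.quotientMap_surjective e.symm.surjective
    exact quasiFinite_of_finite B _
  -- There is r outside 𝔮, integral over B, with every element of C integral after multiplication by
  -- a power of r. As B is integrally closed in S, all these integral elements come from B.
  obtain ⟨r, hr, hri, H⟩ := Algebra.zariskisMainProperty_iff.1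
    (Algebra.ZariskisMainProperty.of_finiteType_of_weaklyQuasiFiniteAt (R := B) 𝔮)
  have hB (c : C) (hc : IsIntegral B c) : ∃ b, algebraMap B S b = c := hint _ (hc.map C.val)
  obtain ⟨ρ, hρ⟩ := hB r hri
  have key (c : C) : ∃ m b, algebraMap B S b = algebraMap B S ρ ^ m * c := by
    obtain ⟨m, hm⟩ := H c
    obtain ⟨b, hb⟩ := hB _ hm
    exact ⟨m, b, by simpa [hρ] using hb⟩
  obtain ⟨u, hu, hu', hs⟩ := hloc s
  obtain ⟨m, b, hb⟩ := key ⟨u, hu⟩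
  obtain ⟨m', b', hb'⟩ := key ⟨_, hs⟩
  have hρu : IsUnit (algebraMap B S ρ) := by rw [hρ]; exact (h𝔮 r).1 hr
  refine ⟨ρ ^ m' * b, ρ ^ m * b', ?_, ?_⟩
  · rw [map_mul, map_pow, hb]
    exact (hρu.pow _).mul ((hρu.pow _).mul hu')
  · simp only [map_mul, map_pow, hb, hb']
    ring

end ZariskiMain

/-! ### The local ring of 𝒳 at a closed point of the divisor -/

section LocalCurve

open IsLocalRing

variable {O S : Type u} [CommRing O] [CommRing S] [Algebra O S] {p : ℕ}

lemma isUnit_natCast_of_coprime [IsLocalRing O]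
    (hO : maximalIdeal O = Ideal.span {(p : O)}) (n : ℕ) (hn : n.Coprime p) :
    IsUnit (n : S) := by
  have : IsUnit (n : O) := by
    by_contra h
    have h1 : (n : O) ∈ maximalIdeal O := h
    have h2 : (p : O) ∈ maximalIdeal O := hO ▸ Ideal.mem_span_singleton_self _
    obtain ⟨a, b, hab⟩ := Nat.isCoprime_iff_coprime.2 hn
    have h3 : ((a * n + b * p : ℤ) : O) = 1 := by rw [hab]; simp
    push_cast at h3
    exact (Ideal.ne_top_iff_one _).1 (maximalIdeal.isMaximal O).ne_top
      (h3 ▸ add_mem (Ideal.mul_mem_left _ _ h1) (Ideal.mul_mem_left _ _ h2))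
  simpa using this.map (algebraMap O S)

lemma dvd_of_dvd_natCast_mul [IsLocalRing O] [hp : Fact p.Prime]
    (hO : maximalIdeal O = Ideal.span {(p : O)}) {t : S} (reg : ∀ s, t ∣ p * s → t ∣ s)
    {n : ℕ} (hn : n ≠ 0) (s : S) (h : t ∣ n * s) : t ∣ s := by
  obtain ⟨v, n', hn', rfl⟩ := Nat.exists_eq_pow_mul_and_not_dvd hn p hp.1.ne_one
  have hu := isUnit_natCast_of_coprime (S := S) hO n'
    (((Nat.Prime.coprime_iff_not_dvd hp.1).2 hn').symm)
  push_cast at h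
  rw [mul_assoc] at h
  exact hu.dvd_mul_left.1 (dvd_of_dvd_pow_mul reg v _ h)

/-- Differentiating t s = 0 repeatedly gives n! s = ± t^n δ^n(s). Once p is inverted, all n! are
units, so s lies in every power of (t) and Krull's intersection theorem gives s = c t s = 0. This
shows that t is a nonzerodivisor before S is known to be a domain. -/
lemma mul_eq_zero_of_derivation_eq_one [IsLocalRing O] [hp : Fact p.Prime]
    (hO : maximalIdeal O = Ideal.span {(p : O)}) [IsNoetherianRing S]
    (htf : ∀ s : S, p * s = 0 → s = 0) {t : S} (δ : Derivation O S S) (hδ : δ t = 1)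
    (s : S) (h : t * s = 0) : s = 0 := by
  let T := Localization.Away (p : S)
  have hinj : Function.Injective (algebraMap S T) := by
    refine IsLocalization.injective T (M := Submonoid.powers (p : S)) ?_
    refine Submonoid.powers_le.2 ?_
    rw [mem_nonZeroDivisors_iff_right]
    exact fun x hx => htf x (by rwa [mul_comm])
  have hpu : IsUnit (algebraMap S T p) := IsLocalization.Away.algebraMap_isUnit _
  have hu (n : ℕ) (hn : n ≠ 0) : IsUnit (n : T) := by
    obtain ⟨v, n', hn', rfl⟩ := Nat.exists_eq_pow_mul_and_not_dvd hn p hp.1.ne_one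
    have hu := isUnit_natCast_of_coprime (S := T) hO n'
      (((Nat.Prime.coprime_iff_not_dvd hp.1).2 hn').symm)
    rw [map_natCast] at hpu
    rw [Nat.cast_mul, Nat.cast_pow]
    exact (hpu.pow v).mul hu
  have hder (n : ℕ) : t * δ^[n + 1] s + (n + 1 : ℕ) * δ^[n] s = 0 := by
    induction n with
    | zero =>
      have := congrArg δ h
      rw [Derivation.leibniz, hδ, map_zero] at this
      simpa using this
    | succ n ih =>
      have := congrArg δ ih
      rw [map_add, Derivation.leibniz, Derivation.leibniz, hδ, map_zero, Derivation.map_natCast,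
        ← Function.iterate_succ_apply' δ, ← Function.iterate_succ_apply' δ] at this
      rw [← this]
      simp only [smul_eq_mul]
      push_cast
      ring
  have hmem (n : ℕ) : algebraMap S T s ∈ Ideal.span {algebraMap S T t} ^ n := by
    rw [Ideal.span_singleton_pow, Ideal.mem_span_singleton]
    have : algebraMap S T t ^ n ∣ algebraMap S T (n.factorial * s) := by
      have : (n.factorial : S) * s = (-1) ^ n * t ^ n * δ^[n] s := by
        induction n with
        | zero => simp
        | succ n ih =>
          rw [Nat.factorial_succ, Nat.cast_mul, mul_assoc, ih]
          linear_combination ((-1) ^ n * t ^ n) * hder n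
      rw [this, map_mul, map_mul, map_pow _ t]
      exact (dvd_mul_left _ _).mul_right _
    rw [map_mul, map_natCast] at this
    exact (hu _ n.factorial_ne_zero).dvd_mul_left.1 this
  obtain ⟨⟨a, ha⟩, hr⟩ := (Ideal.mem_iInf_smul_pow_eq_bot_iff
    (Ideal.span {algebraMap S T t}) (algebraMap S T s)).1 (by simpa using hmem)
  obtain ⟨c, rfl⟩ := Ideal.mem_span_singleton.1 ha
  apply hinj
  rw [map_zero, ← hr, smul_eq_mul, mul_right_comm, ← map_mul, h, map_zero, zero_mul]

/-- As dt generates the differentials, S/(t) has none over O. It is therefore unramified and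
essentially of finite type over O, so its maximal ideal is generated by p and its residue field is
finite over that of O. -/
lemma frobenius_surjective_mod [IsLocalRing O] [Fact p.Prime]
    (hO : maximalIdeal O = Ideal.span {(p : O)}) [Finite (ResidueField O)] [IsLocalRing S]
    [Algebra.EssFiniteType O S]
    {t : S} (ht : t ∈ maximalIdeal S) (hpS : (p : S) ∈ maximalIdeal S)
    (hspan : Submodule.span S {KaehlerDifferential.D O S t} = ⊤) :
    maximalIdeal S = Ideal.span {(p : S), t} ∧ Finite (ResidueField S) := by
  let T := S ⧸ Ideal.span {t}
  have : Nontrivial T := Ideal.Quotient.nontrivial_iff.2 (ne_top_of_le_ne_top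
    (maximalIdeal.isMaximal S).ne_top ((Ideal.span_singleton_le_iff_mem _).2 ht))
  have : IsLocalRing T := .of_surjective' _ Ideal.Quotient.mk_surjective
  have hmk : (maximalIdeal T).comap (Ideal.Quotient.mk (Ideal.span {t})) = maximalIdeal S :=
    eq_maximalIdeal (Ideal.comap_isMaximal_of_surjective _ Ideal.Quotient.mk_surjective)
  have : IsLocalHom (algebraMap O T) := by
    refine ((local_hom_TFAE (algebraMap O T)).out 0 2 rfl rfl).2 ?_
    rw [hO, Ideal.map_span, Set.image_singleton, Ideal.span_singleton_le_iff_mem, map_natCast,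
      ← map_natCast (Ideal.Quotient.mk (Ideal.span {t})), ← Ideal.mem_comap, hmk]
    exact hpS
  have : Algebra.FormallyUnramified O T := by
    constructor
    have hsurj : Function.Surjective (KaehlerDifferential.map O O S T) :=
      KaehlerDifferential.map_surjective_of_surjective O O S T Ideal.Quotient.mk_surjective
    refine subsingleton_of_forall_eq 0 fun z => ?_
    obtain ⟨z, rfl⟩ := hsurj z
    obtain ⟨c, rfl⟩ := Submodule.mem_span_singleton.1 (hspan ▸ Submodule.mem_top : z ∈ _)
    rw [map_smul, KaehlerDifferential.map_D]
    have : algebraMap S T t = 0 :=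
      Ideal.Quotient.eq_zero_iff_mem.2 (Ideal.mem_span_singleton_self t)
    rw [this, map_zero, smul_zero]
  have : Algebra.EssFiniteType S T := inferInstance
  have : Algebra.EssFiniteType O T := .comp O S T
  have h1 := Algebra.FormallyUnramified.map_maximalIdeal (R := O) (S := T)
  constructor
  · rw [hO, Ideal.map_span, Set.image_singleton, map_natCast] at h1
    rw [← hmk, ← h1, ← map_natCast (Ideal.Quotient.mk (Ideal.span {t})), ← Set.image_singleton,
      ← Ideal.map_span, Ideal.comap_map_of_surjective _ Ideal.Quotient.mk_surjective,
      ← RingHom.ker_eq_comap_bot, Ideal.mk_ker, Ideal.span_insert]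
  · have h2 : Finite (ResidueField T) :=
      Module.finite_of_finite (ResidueField O)
    have : IsLocalHom (Ideal.Quotient.mk (Ideal.span {t})) :=
      IsLocalHom.of_surjective _ Ideal.Quotient.mk_surjective
    exact Finite.of_injective (ResidueField.map (Ideal.Quotient.mk (Ideal.span {t})))
      (RingHom.injective _)

lemma exists_sub_pow_mem_maximalIdeal [IsLocalRing S] [Fact p.Prime] [Finite (ResidueField S)]
    (hpS : (p : S) ∈ maximalIdeal S) (s : S) : ∃ c, s - c ^ p ∈ maximalIdeal S := by
  have : CharP (ResidueField S) p := by
    refine (CharP.charP_iff_prime_eq_zero Fact.out).2 ?_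
    rw [← map_natCast (residue S)]
    exact (residue_eq_zero_iff _).2 hpS
  obtain ⟨c, hc⟩ := (bijective_frobenius (ResidueField S) p).2 (residue S s)
  obtain ⟨c, rfl⟩ := residue_surjective c
  refine ⟨c, ?_⟩
  rw [← residue_eq_zero_iff, map_sub, map_pow, ← hc, frobenius_def, sub_self]

/-- In S/(t) the maximal ideal is generated by p. If no factorization as p^a times a unit exists, a
further power of p can always be extracted, and Krull's intersection theorem shows that x vanishes
modulo t. -/
lemma dvd_or_exists_sub_mem [IsLocalRing S] [IsNoetherianRing S] {t : S}
    (ht : t ∈ maximalIdeal S)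
    (hm : maximalIdeal S = Ideal.span {(p : S), t}) (x : S) (hx : ¬ t ∣ x) :
    ∃ (a : ℕ) (u : Sˣ), t ∣ x - p ^ a * u := by
  let T := S ⧸ Ideal.span {t}
  have : Nontrivial T := Ideal.Quotient.nontrivial_iff.2 (ne_top_of_le_ne_top
    (maximalIdeal.isMaximal S).ne_top ((Ideal.span_singleton_le_iff_mem _).2 ht))
  have : IsLocalRing T := .of_surjective' _ Ideal.Quotient.mk_surjective
  by_contra! H
  have H' (n : ℕ) : x ∈ Ideal.span {(p : S) ^ n, t} := by
    induction n with
    | zero => simp [Ideal.span_insert]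
    | succ n ih =>
      obtain ⟨α, β, h⟩ := Ideal.mem_span_pair.1 ih
      by_cases hα : IsUnit α
      · exact (H n hα.unit ⟨β, by rw [IsUnit.unit_spec]; linear_combination -h⟩).elim
      · have : α ∈ maximalIdeal S := hα
        rw [hm] at this
        obtain ⟨α', γ, h'⟩ := Ideal.mem_span_pair.1 this
        exact Ideal.mem_span_pair.2 ⟨α', β + γ * p ^ n, by
          linear_combination h + (p : S) ^ n * h'⟩
  have hp : Ideal.span {(Ideal.Quotient.mk (Ideal.span {t}) (p : S))} ≠ ⊤ := by
    rw [Ne, Ideal.span_singleton_eq_top]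
    intro hu
    have : IsLocalHom (Ideal.Quotient.mk (Ideal.span {t})) :=
      IsLocalHom.of_surjective _ Ideal.Quotient.mk_surjective
    have h1 : (p : S) ∈ maximalIdeal S := hm ▸ Ideal.subset_span (by simp)
    exact h1 (isUnit_of_map_unit _ _ hu)
  have h0 := Ideal.iInf_pow_eq_bot_of_isLocalRing _ hp
  have : Ideal.Quotient.mk (Ideal.span {t}) x ∈ (⊥ : Ideal T) := by
    rw [← h0, Ideal.mem_iInf]
    intro n
    obtain ⟨α, β, h⟩ := Ideal.mem_span_pair.1 (H' n)
    rw [Ideal.span_singleton_pow, Ideal.mem_span_singleton, ← h, map_add, map_mul, map_mul,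
      Ideal.Quotient.eq_zero_iff_mem.2 (Ideal.mem_span_singleton_self t)]
    simp
  exact hx (Ideal.mem_span_singleton.1 (Ideal.Quotient.eq_zero_iff_mem.1 this))

/-- If t divided neither factor, the product would be p^(a+b) times a unit modulo t, which is
nonzero because p is regular modulo t. -/
lemma prime_of_reg [IsLocalRing S] [IsNoetherianRing S] {t : S} (ht0 : t ≠ 0)
    (ht : t ∈ maximalIdeal S) (reg : ∀ s, t ∣ p * s → t ∣ s)
    (hm : maximalIdeal S = Ideal.span {(p : S), t}) : Prime t := by
  refine ⟨ht0, ht, fun x y hxy => ?_⟩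
  by_contra! H
  obtain ⟨a, u, hu⟩ := dvd_or_exists_sub_mem ht hm x H.1
  obtain ⟨b, v, hv⟩ := dvd_or_exists_sub_mem ht hm y H.2
  have h1 : t ∣ p ^ (a + b) * (u * v) := by
    have : (p : S) ^ (a + b) * (u * v) = x * y - (x - p ^ a * u) * y -
        p ^ a * u * (y - p ^ b * v) := by ring
    rw [this]
    exact (hxy.sub (hu.mul_right _)).sub (hv.mul_left _)
  exact ht (isUnit_of_dvd_unit (dvd_of_dvd_pow_mul reg _ _ h1) (u.isUnit.mul v.isUnit))

end LocalCurve

/-! ### From the local ring of 𝒳 to a chart of B -/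

section ChartConstruction

open IsLocalRing

variable {S L : Type u} [CommRing S] [Field L] (ι : S →+* L) {t : S}

/-- The rational root argument for the denominator t: clearing denominators in a monic equation
shows that t divides a power of the numerator, hence the numerator. Only the primality of t is
needed, not the normality of S. -/
lemma exists_eq_of_isIntegralElem (hι : Function.Injective ι) (ht : Prime t) (z : L)
    (hz : ι.IsIntegralElem z) (n : ℕ) (s : S) (h : ι t ^ n * z = ι s) : ∃ s, ι s = z := by
  have : IsDomain S := hι.isDomain
  have ht0 : ι t ≠ 0 := fun h => ht.ne_zero (hι (h.trans (map_zero ι).symm))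
  induction n generalizing s with
  | zero => exact ⟨s, by simpa using h.symm⟩
  | succ n ih =>
    let := ι.toAlgebra
    have h1 : IsIntegral S (ι t ^ n * z) :=
      IsIntegral.mul ((isIntegral_algebraMap (R := S) (x := t)).pow n) hz
    have h2 : ι t * (ι t ^ n * z) = ι s := by rw [← h]; ring
    suffices t ∣ s by
      obtain ⟨s', rfl⟩ := this
      rw [map_mul] at h2
      exact ih s' (mul_left_cancel₀ ht0 h2)
    obtain ⟨P, hP, hP0⟩ := h1
    have h3 : IsRoot (P.scaleRoots t) s := by
      have := scaleRoots_eval₂_eq_zero (s := t) ι hP0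
      change eval₂ ι (ι t * (ι t ^ n * z)) _ = 0 at this
      rw [h2, eval₂_at_apply] at this
      exact hι (this.trans (map_zero ι).symm)
    have h4 : (P.scaleRoots t).Monic := (monic_scaleRoots_iff t).2 hP
    have hd : (P.scaleRoots t).natDegree = P.natDegree := natDegree_scaleRoots _ _
    rw [IsRoot, eval_eq_sum_range, Finset.sum_range_succ, h4.coeff_natDegree, one_mul] at h3
    refine ht.dvd_of_dvd_pow (n := (P.scaleRoots t).natDegree) ?_
    rw [← dvd_add_right (a := t) (Finset.dvd_sum fun i hi => ?_), h3]
    · exact dvd_zero _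
    · rw [coeff_scaleRoots]
      refine ((dvd_pow_self t ?_).mul_left _).mul_right _
      have := Finset.mem_range.1 hi
      omega

lemma exists_eq_pow_mul_unit (hι : Function.Injective ι) (ht : Prime t) (z : L) (hz : z ≠ 0)
    {n m : ℕ} {s s' : S} (h : ι t ^ n * z = ι s) (h' : ι t ^ m * z⁻¹ = ι s') :
    ∃ (i : ℕ) (u : Sˣ), ι t ^ n * z = ι (t ^ i * u) := by
  have : IsDomain S := hι.isDomain
  have h1 : s * s' = t ^ (n + m) := by
    apply hι
    rw [map_mul, ← h, ← h', map_pow, pow_add]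
    field_simp
  obtain ⟨i, -, u, hu⟩ := (dvd_prime_pow ht _).1 (Dvd.intro _ h1)
  refine ⟨i, u⁻¹, ?_⟩
  rw [h, ← hu, mul_assoc, Units.mul_inv, mul_one]

variable {O : Type u} [CommRing O] [IsLocalRing O] [Algebra O S] [Algebra O L] {p : ℕ}
  [Fact p.Prime]

/-- A local ring of a smooth curve over a discrete valuation ring along a divisor which is étale
over the base gives a chart. -/
theorem exists_chart_of_localRing (hO : maximalIdeal O = Ideal.span {(p : O)})
    [Finite (ResidueField O)] [IsLocalRing S] [IsNoetherianRing S] [Algebra.EssFiniteType O S]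
    (hιO : ∀ o, ι (algebraMap O S o) = algebraMap O L o)
    (hι : Function.Injective ι) (δ : Derivation O S S) (hδ : δ t = 1)
    (hspan : Submodule.span S {KaehlerDifferential.D O S t} = ⊤)
    (reg : ∀ s, t ∣ p * s → t ∣ s) (ht : t ∈ maximalIdeal S) (hpS : (p : S) ∈ maximalIdeal S)
    (D : Derivation O L L) (hD : ∀ s, ∃ n s', ι t ^ n * D (ι s) = ι s')
    (B : Subring L) (hOB : ∀ o, algebraMap O L o ∈ B) {r : L} (hr0 : r ≠ 0) (hrB : r ∈ B)
    (hB : ∀ b ∈ B, ∃ n s, ι t ^ n * b = ι s)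
    (hBr : ∀ b ∈ B, IsIntegral (Algebra.adjoin O {r}) b)
    (hBc : ∀ z : L, IsIntegral B z → z ∈ B) (hr : ∃ n s, ι t ^ n * r⁻¹ = ι s)
    (hru : ∀ n (u : Sˣ), ι t ^ n * r ≠ ι u) (hDr : D r ∈ B)
    (hcop : ∃ α ∈ B, ∃ γ ∈ B, D r * α + r * γ = 1) {x : L} (hx : x ∈ B) (hDx : D x = 1)
    (𝔫 : Ideal B) (h𝔫 : ∀ (b : B) s, ι s = b → (b ∈ 𝔫 ↔ s ∈ maximalIdeal S))
    (θ : Derivation ℤ L L) (hθ : ∀ z, θ z = r * D z) :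
    ∃ (e : ℕ) (ε : Sˣ), e ≠ 0 ∧ r = ι (t ^ e * ε) ∧ (∀ b ∈ B, ∃ s, ι s = b) ∧
      Nonempty (Chart B θ p r 𝔫 e) := by
  have : IsDomain S := hι.isDomain
  have ht0 : t ≠ 0 := by
    rintro rfl
    simp at hδ
  obtain ⟨hm, _⟩ := frobenius_surjective_mod hO ht hpS hspan
  have hprime : Prime t := prime_of_reg ht0 ht reg hm
  have htι : ι t ≠ 0 := fun h => ht0 (hι (h.trans (map_zero ι).symm))
  let ιO : S →ₐ[O] L := ⟨ι, hιO⟩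
  -- the shape of `r`
  obtain ⟨e, ε, hre⟩ : ∃ (e : ℕ) (ε : Sˣ), r = ι (t ^ e * ε) := by
    obtain ⟨n, s, h⟩ := hB r hrB
    obtain ⟨m, s', h'⟩ := hr
    obtain ⟨i, u, hu⟩ := exists_eq_pow_mul_unit ι hι hprime r hr0 h h'
    -- If r had a pole along t = 0, or (below, for e) were a unit, then some t^n r would be a unit,
    -- which `hru` excludes.
    have hni : n ≤ i := by
      by_contra! hlt
      apply hru (n - i) u
      refine mul_left_cancel₀ (pow_ne_zero i htι) ?_
      rw [← mul_assoc, ← pow_add, Nat.add_sub_cancel' hlt.le, hu, map_mul, map_pow]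
    refine ⟨i - n, u, mul_left_cancel₀ (pow_ne_zero n htι) ?_⟩
    rw [hu, ← map_pow, ← map_mul, ← mul_assoc, ← pow_add, Nat.add_sub_cancel' hni]
  have he : e ≠ 0 := by
    rintro rfl
    exact hru 0 ε (by rw [hre]; simp)
  have hrm : t ^ e * (ε : S) ∈ maximalIdeal S :=
    Ideal.mul_mem_right _ _ (Ideal.pow_mem_of_mem _ ht e (Nat.pos_of_ne_zero he))
  -- `B` is contained in `S`
  have hle (b : L) (hb : b ∈ B) : ∃ s, ι s = b := by
    obtain ⟨n, s, h⟩ := hB b hb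
    refine exists_eq_of_isIntegralElem ι hι hprime b ?_ n s h
    have hrange : Algebra.adjoin O {r} ≤ ιO.range :=
      Algebra.adjoin_le (Set.singleton_subset_iff.2 ⟨_, hre.symm⟩)
    let e₁ : Algebra.adjoin O {r} →+* S :=
      ((AlgEquiv.ofInjective ιO hι).symm : ιO.range →+* S).comp
        (Subalgebra.inclusion hrange).toRingHom
    have he₁ (a : Algebra.adjoin O {r}) : ι (e₁ a) = a :=
      congrArg Subtype.val ((AlgEquiv.ofInjective ιO hι).apply_symm_apply
        (Subalgebra.inclusion hrange a))
    let := ι.toAlgebra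
    exact IsIntegral.map_of_comp_eq (T := S) e₁ (RingHom.id L) (RingHom.ext fun a => he₁ a)
      (hBr b hb)
  -- As dt generates the differentials of S over O, a derivation into L is determined by its value
  -- at t.
  have hDι (s : S) : D (ι s) = ι (δ s) * D (ι t) := by
    let := ι.toAlgebra
    have : IsScalarTower O S L := .of_algebraMap_eq fun o => (hιO o).symm
    let D₁ : Derivation O S L := D.compAlgebraMap S
    obtain ⟨c, hc⟩ := Submodule.mem_span_singleton.1
      (hspan ▸ Submodule.mem_top : KaehlerDifferential.D O S s ∈ _)
    have h1 := congrArg δ.liftKaehlerDifferential hc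
    have h2 := congrArg D₁.liftKaehlerDifferential hc
    rw [map_smul, Derivation.liftKaehlerDifferential_comp_D,
      Derivation.liftKaehlerDifferential_comp_D, hδ, smul_eq_mul, mul_one] at h1
    rw [map_smul, Derivation.liftKaehlerDifferential_comp_D,
      Derivation.liftKaehlerDifferential_comp_D, h1] at h2
    exact h2.symm
  -- the shape of `D t`
  obtain ⟨ξ, hξ⟩ := hle x hx
  obtain ⟨c, u, hDt⟩ : ∃ (c : ℕ) (u : Sˣ), ι t ^ c * D (ι t) = ι u := by
    obtain ⟨n, w, hw⟩ := hD t
    -- D x = 1 for an element x of S, so t^n D t divides t^n and is a power of t times a unit.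
    have h1 : δ ξ * w = t ^ n := by
      apply hι
      rw [map_mul, ← hw, mul_left_comm, ← hDι, hξ, hDx, mul_one, map_pow]
    obtain ⟨i, hi, u, hu⟩ := (dvd_prime_pow hprime _).1 (Dvd.intro_left _ h1)
    refine ⟨n - i, u⁻¹, mul_left_cancel₀ (pow_ne_zero i htι) ?_⟩
    rw [← mul_assoc, ← pow_add, Nat.add_sub_cancel' hi, hw, ← map_pow, ← map_mul, ← hu, mul_assoc,
      Units.mul_inv, mul_one]
  obtain ⟨ρ, hρ⟩ := hle _ hDr
  -- D r and r generate the unit ideal, and r lies in the maximal ideal.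
  have hρu : IsUnit ρ := by
    obtain ⟨α, hα, γ, hγ, h⟩ := hcop
    obtain ⟨α, rfl⟩ := hle α hα
    obtain ⟨γ, rfl⟩ := hle γ hγ
    rw [← hρ, hre, ← map_mul, ← map_mul, ← map_add, ← map_one ι] at h
    have h1 := hι h
    by_contra hu
    exact (Ideal.ne_top_iff_one _).1 (maximalIdeal.isMaximal S).ne_top
      (h1 ▸ add_mem (Ideal.mul_mem_right _ _ hu) (Ideal.mul_mem_right _ _ hrm))
  -- Comparing orders along t in D r = δ(r) D t: the left side is a unit, and δ(t^e ε) has order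
  -- exactly e - 1 even if p divides e, because no nonzero integer is divisible by t.
  have hce : c = e - 1 := by
    have h1 : δ (t ^ e * ε) = t ^ (e - 1) * (e * ε + t * δ ε) := by
      obtain ⟨e, rfl⟩ := Nat.exists_eq_succ_of_ne_zero he
      rw [Derivation.leibniz, Derivation.leibniz_pow, hδ]
      simp only [smul_eq_mul, nsmul_eq_mul, Nat.succ_sub_one, Nat.succ_eq_add_one, mul_one]
      ring
    have h2 : t ^ c * ρ = t ^ (e - 1) * ((e * ε + t * δ ε) * u) := by
      apply hι
      have h3 := hDι (t ^ e * ε)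
      rw [← hre, ← hρ, h1] at h3
      rw [map_mul, map_mul, map_mul, h3, ← hDt, map_pow, map_mul, map_pow]
      ring
    have h3 : ¬ t ∣ (e * ε + t * δ ε) * u := by
      intro h
      have h' := (dvd_add_left (dvd_mul_right t _)).1 (u.isUnit.dvd_mul_right.1 h)
      exact ht (isUnit_of_dvd_unit (dvd_of_dvd_natCast_mul hO reg he _ h') ε.isUnit)
    have h4 : ¬ t ∣ ρ := fun h => ht (isUnit_of_dvd_unit h hρu)
    rcases lt_trichotomy c (e - 1) with hlt | heq | hlt
    · refine (h4 ?_).elim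
      rw [← Nat.add_sub_cancel' hlt.le, pow_add, mul_assoc] at h2
      rw [mul_left_cancel₀ (pow_ne_zero _ ht0) h2]
      exact (dvd_pow_self t (by omega)).mul_right _
    · exact heq
    · refine (h3 ?_).elim
      rw [← Nat.add_sub_cancel' hlt.le, pow_add, mul_assoc] at h2
      rw [← mul_left_cancel₀ (pow_ne_zero _ ht0) h2]
      exact (dvd_pow_self t (by omega)).mul_right _
  have hfrac (s : S) : ∃ b : B, b ∉ 𝔫 ∧ (b : L) * ι s ∈ B := by
    let e₁ : S ≃+* ι.range := RingEquiv.ofBijective ι.rangeRestrict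
      ⟨fun a b h => hι (congrArg Subtype.val h), ι.rangeRestrict_surjective⟩
    let κ : B →+* S := (e₁.symm : ι.range →+* S).comp (Subring.inclusion (fun b hb => hle b hb))
    have hκ (b : B) : ι (κ b) = b := congrArg Subtype.val (e₁.apply_symm_apply _)
    let := κ.toAlgebra
    let G := Algebra.EssFiniteType.finset O S
    have hsub : ∀ z ∈ Algebra.adjoin O (G : Set S), z ∈ Algebra.adjoin B (G : Set S) := by
      intro z hz
      induction hz using Algebra.adjoin_induction with
      | mem z hz => exact Algebra.subset_adjoin hz
      | algebraMap o =>
        have : algebraMap O S o = algebraMap B S ⟨_, hOB o⟩ :=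
          hι ((hιO o).trans (hκ ⟨_, hOB o⟩).symm)
        rw [this]
        exact Subalgebra.algebraMap_mem _ _
      | add _ _ _ _ h h' => exact add_mem h h'
      | mul _ _ _ _ h h' => exact mul_mem h h'
    have hn (b : B) : b ∈ (maximalIdeal S).comap (algebraMap B S) ↔ b ∈ 𝔫 :=
      (h𝔫 b (κ b) (hκ b)).symm
    have h₁ (z : S) (hz : IsIntegral B z) : z ∈ Set.range (algebraMap B S) := by
      have h1 : IsIntegral B (ι z) := IsIntegral.map_of_comp_eq (RingHom.id B) ι
        (RingHom.ext fun b => (hκ b).symm) hz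
      exact ⟨⟨_, hBc _ h1⟩, hι (hκ _)⟩
    have h₂ (z : S) : ∃ u ∈ Algebra.adjoin B (G : Set S), IsUnit u ∧ u * z ∈ Algebra.adjoin B (G : Set S) := by
      obtain ⟨⟨a, v⟩, hav⟩ := IsLocalization.surj (Algebra.EssFiniteType.submonoid O S) z
      exact ⟨v, hsub _ v.1.2, v.2, by
        rw [mul_comm]
        exact hav ▸ hsub _ a.2⟩
    have h₃ : Finite (S ⧸ ((maximalIdeal S).comap (algebraMap B S)).map (algebraMap B S)) := by
      have h1 : Finite (S ⧸ maximalIdeal S) := inferInstanceAs (Finite (ResidueField S))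
      have h2 : Finite (S ⧸ maximalIdeal S ^ (1 + e)) :=
        Ideal.finite_quotient_pow (IsNoetherian.noetherian _) _
      -- The power (p, t)^(1+e) is contained in (p, t^e), and both p and t^e = r ε⁻¹ lie in the
      -- ideal generated by 𝔫.
      suffices hle : maximalIdeal S ^ (1 + e) ≤
          ((maximalIdeal S).comap (algebraMap B S)).map (algebraMap B S) from
        Finite.of_surjective (Ideal.Quotient.factor hle) (Ideal.Quotient.factor_surjective hle)
      conv_lhs => rw [hm, Ideal.span_insert]
      refine (Ideal.sup_pow_add_le_pow_sup_pow).trans ?_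
      rw [pow_one, Ideal.span_singleton_pow, sup_le_iff, Ideal.span_singleton_le_iff_mem,
        Ideal.span_singleton_le_iff_mem]
      constructor
      · have : (p : S) = algebraMap B S p := (map_natCast _ p).symm
        rw [this]
        refine Ideal.mem_map_of_mem _ ?_
        rw [Ideal.mem_comap, ← this]
        exact hpS
      · have : t ^ e = algebraMap B S ⟨r, hrB⟩ * ↑ε⁻¹ := by
          have : t ^ e * ε = algebraMap B S ⟨r, hrB⟩ := hι (hre.symm.trans (hκ ⟨r, hrB⟩).symm)
          rw [← this, mul_assoc, Units.mul_inv, mul_one]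
        rw [this]
        refine Ideal.mul_mem_right _ _ (Ideal.mem_map_of_mem _ ((hn _).2 ?_))
        exact (h𝔫 _ _ hre.symm).2 hrm
    obtain ⟨b, b', hb, hb'⟩ := exists_isUnit_mul_mem_of_finite_fiber h₁ G G.finite_toSet h₂ h₃ s
    refine ⟨b, fun h => (hn b).2 h hb, ?_⟩
    have : (b : L) * ι s = b' := by
      rw [← hκ b, ← map_mul, ← hκ b']
      exact congrArg ι hb'
    rw [this]
    exact b'.2
  refine ⟨e, ε, he, hre, hle, ⟨?_⟩⟩
  exact
    { S := S
      ι := ι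
      inj := hι
      D := δ.restrictScalars ℤ
      t := t
      ε := ε
      η := ε * u
      le := fun b => hle b b.2
      frac := hfrac
      eq_pow := hre
      D_t := hδ
      -- θ = rD and D t = t^(1-e) u, so θ = (t^e ε)(t^(1-e) u) d/dt; this is the choice η = ε u.
      map_D := fun s => by
        have h1 : ι t ^ e * D (ι t) = ι (t * u) := by
          rw [map_mul, ← hDt, ← mul_assoc, ← pow_succ', hce, Nat.sub_add_cancel
            (Nat.one_le_iff_ne_zero.2 he)]
        rw [hθ, hDι, hre, map_mul, map_pow]
        calc _ = ι ε * ι (δ s) * (ι t ^ e * D (ι t)) := by ring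
          _ = _ := by
            rw [h1, ← map_mul, ← map_mul]
            congr 1
            change _ = (ε * u : S) * t * δ s
            ring
      reg := reg
      frob := fun s => by
        rw [← hm]
        exact exists_sub_pow_mem_maximalIdeal hpS s
      unit := fun n hn => isUnit_natCast_of_coprime hO n hn }

end ChartConstruction

/-! ### The centre of a valuation on 𝒳 and the divisor through it -/

section DivisorialChart

open IsLocalRing TensorProduct

/-- For C unramified over A, the differentials of C over O are generated by those coming from A. It
will show that d/dx preserves functions on open subsets of 𝒰. -/
lemma Derivation.mem_of_formallyUnramified {O A C M : Type*} [CommRing O] [CommRing A] [CommRing C]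
    [Algebra O A] [Algebra A C] [Algebra O C] [IsScalarTower O A C] [AddCommGroup M] [Module C M]
    [Module O M] [IsScalarTower O C M] [Algebra.FormallyUnramified A C] (Δ : Derivation O C M)
    (N : Submodule C M) (h : ∀ a, Δ (algebraMap A C a) ∈ N) (c : C) : Δ c ∈ N := by
  have hz (z : C ⊗[A] Ω[A⁄O]) :
      Δ.liftKaehlerDifferential (KaehlerDifferential.mapBaseChange O A C z) ∈ N := by
    induction z with
    | zero => simp
    | add x y hx hy => rw [map_add, map_add]; exact add_mem hx hy
    | tmul c ω =>
      rw [KaehlerDifferential.mapBaseChange_tmul, map_smul]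
      refine N.smul_mem _ ?_
      induction (KaehlerDifferential.span_range_derivation O A ▸ Submodule.mem_top :
        ω ∈ Submodule.span A (Set.range (KaehlerDifferential.D O A))) using
          Submodule.span_induction with
      | mem x hx =>
        obtain ⟨a, rfl⟩ := hx
        rw [KaehlerDifferential.map_D, Derivation.liftKaehlerDifferential_comp_D]
        exact h a
      | zero => simp
      | add x y _ _ hx hy => rw [map_add, map_add]; exact add_mem hx hy
      | smul a x _ hx =>
        rw [map_smul, ← algebraMap_smul C a, map_smul]
        exact N.smul_mem _ hx
  have : KaehlerDifferential.D O C c ∈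
      LinearMap.range (KaehlerDifferential.mapBaseChange O A C) := by
    rw [KaehlerDifferential.range_mapBaseChange]
    exact Subsingleton.elim _ _
  obtain ⟨z, hz'⟩ := this
  rw [← Derivation.liftKaehlerDifferential_comp_D Δ, ← hz']
  exact hz z

variable {O A L : Type u} [CommRing O] [CommRing A] [Field L] [Algebra O A] [Algebra O L]
  {X D : Scheme.{u}} (π : X ⟶ Spec (.of O))

/-- An affine chart of a curve `X` around a point `𝔪` of the divisor which is the complement of the
affine open subset `Spec A`, with an equation `t` of that divisor at `𝔪`. -/
structure DivisorialChart (j : AffineChart π A) (ψ : A →ₐ[O] L) (p : ℕ)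
    (𝒱 : ValuationSubring L) where
  C : Type u
  [ring : CommRing C]
  [algebra : Algebra O C]
  [noetherian : IsNoetherianRing C]
  [finiteType : Algebra.FiniteType O C]
  c : AffineChart π C
  𝔪 : Ideal C
  [prime : 𝔪.IsPrime]
  t : C
  mem : ∀ z : PrimeSpectrum C, z.asIdeal ≤ 𝔪 → t ∈ z.asIdeal → c.f z ∉ Set.range j.f
  δ : Derivation O (Localization.AtPrime 𝔪) (Localization.AtPrime 𝔪)
  δ_t : δ (algebraMap C _ t) = 1
  span_D : Submodule.span (Localization.AtPrime 𝔪)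
    {KaehlerDifferential.D O (Localization.AtPrime 𝔪) (algebraMap C _ t)} = ⊤
  reg : ∀ s : Localization.AtPrime 𝔪, algebraMap C _ t ∣ p * s → algebraMap C _ t ∣ s
  t_mem : t ∈ 𝔪
  p_mem : (p : C) ∈ 𝔪
  ι : Localization.AtPrime 𝔪 →ₐ[O] L
  inj : Function.Injective ι
  fac : Spec.map (CommRingCat.ofHom ((ι : _ →+* L).comp (algebraMap C (Localization.AtPrime 𝔪)))) ≫
    c.f = Spec.map (CommRingCat.ofHom ψ.toRingHom) ≫ j.f
  dom : ∀ s, ι s ∈ 𝒱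
  dom_lt : ∀ s, s ∈ maximalIdeal (Localization.AtPrime 𝔪) ↔ 𝒱.valuation (ι s) < 1
  pow_mul : ∀ a, ∃ n s, ι (algebraMap C _ t) ^ n * ψ a = ι s
  deriv : ∀ Δ : Derivation O L L, (∀ a, ∃ a', Δ (ψ a) = ψ a') →
    ∀ s, ∃ n s', ι (algebraMap C _ t) ^ n * Δ (ι s) = ι s'

attribute [instance] DivisorialChart.ring DivisorialChart.algebra DivisorialChart.noetherian
  DivisorialChart.finiteType DivisorialChart.prime

variable {π}

/-- The prime 𝔪 is the centre of the valuation. It lies on the divisor, since otherwise the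
valuation ring would contain the image of A. All regularity statements follow from O-flatness of 𝒳
and of the divisor together with the local equation t. -/
theorem exists_divisorialChart [IsDomain O] [IsDiscreteValuationRing O] {p : ℕ} [Fact p.Prime]
    (hO : maximalIdeal O = Ideal.span {(p : O)}) [IsDomain A] [IsProper π]
    [SmoothOfRelativeDimension 1 π] (j : AffineChart π A) (i : D ⟶ X) [IsClosedImmersion i]
    [Etale (i ≫ π)] (hi : Set.range j.f = (Set.range i)ᶜ) (ψ : A →ₐ[O] L)
    (hψ : Function.Injective ψ) (𝒱 : ValuationSubring L) (hO𝒱 : ∀ o, algebraMap O L o ∈ 𝒱)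
    (hp : 𝒱.valuation (p : L) < 1) (hA : ∃ a, ψ a ∉ 𝒱) :
    Nonempty (DivisorialChart π j ψ p 𝒱) := by
  let := ((algebraMap O L).codRestrict 𝒱.toSubring hO𝒱).toAlgebra
  have : IsScalarTower O 𝒱 L := .of_algebraMap_eq fun _ => rfl
  have hpO : (p : O) ≠ 0 := by
    intro h
    apply IsDiscreteValuationRing.not_a_field O
    rw [hO, h, Ideal.span_singleton_eq_bot]
  obtain ⟨C, _, _, c, β, hC, hβ⟩ := exists_smooth_chart_of_valuationRing π j ψ 𝒱
  obtain ⟨I, hI, hIz⟩ := exists_etale_quotient c i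
  have hz (z : Spec (.of C)) : c.f z ∈ Set.range j.f ↔ ¬ I ≤ z.asIdeal := by
    rw [← hIz, hi]
    rfl
  have : Algebra.IsStandardSmooth O C :=
    Algebra.IsStandardSmoothOfRelativeDimension.isStandardSmooth 1
  have : Algebra.Smooth O C := inferInstance
  have : Algebra.FiniteType O C := inferInstance
  have : IsNoetherianRing C := Algebra.FiniteType.isNoetherianRing O C
  have : Module.Flat O C := inferInstance
  let 𝔪 : Ideal C := (maximalIdeal 𝒱).comap β
  have h𝔪 : 𝔪.IsPrime := inferInstance
  have : Nontrivial C := ⟨0, 1, fun h => 𝔪.ne_top_iff_one.1 h𝔪.ne_top (h ▸ 𝔪.zero_mem)⟩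
  -- the divisor passes through `𝔪`
  have hI𝔪 : I ≤ 𝔪 := by
    by_contra hI𝔪
    have h1 : c.f ⟨𝔪, h𝔪⟩ ∈ Set.range j.f := (hz _).2 hI𝔪
    have hopen : IsOpen ((Spec.map (CommRingCat.ofHom β.toRingHom) ≫ c.f) ⁻¹' Set.range j.f) :=
      j.open_f.base_open.isOpen_range.preimage (Scheme.Hom.continuous _)
    obtain ⟨χ, hχ⟩ := j.exists_algHom (Spec.map (CommRingCat.ofHom β.toRingHom) ≫ c.f)
      (by rw [Category.assoc, c.fac, ← Spec.map_comp]
          exact congrArg (fun f => Spec.map (CommRingCat.ofHom f)) β.comp_algebraMap)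
      (fun z => (specializes_closedPoint z).mem_open hopen h1)
    have h2 : (algebraMap 𝒱 L).comp χ.toRingHom = ψ.toRingHom := by
      apply j.algHom_ext
      rw [← hβ, CommRingCat.ofHom_comp, Spec.map_comp, Category.assoc, hχ, ← Category.assoc,
        ← Spec.map_comp]
      rfl
    obtain ⟨a, ha⟩ := hA
    refine ha ?_
    have := RingHom.congr_fun h2 a
    exact this ▸ (χ a).2
  let E := C ⧸ I
  have hker : RingHom.ker (algebraMap C E) = I := Ideal.mk_ker
  obtain ⟨ω, t, τ, b, htI, hDt, hτI, hbI, hdvd⟩ := exists_local_equation (R := O) (C := C) (E := E)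
    Ideal.Quotient.mk_surjective
  rw [hker] at htI hτI hbI hdvd
  have hunit {a : C} (ha : a - 1 ∈ I) : a ∉ 𝔪 := fun h =>
    𝔪.ne_top_iff_one.1 h𝔪.ne_top (by simpa using sub_mem h (hI𝔪 ha))
  obtain ⟨⟨δ, hδ⟩, hspan⟩ := exists_derivation_of_local_equation 𝔪 (Localization.AtPrime 𝔪) ω
    (hunit hτI) hDt
  let γ : C →ₐ[O] L := (IsScalarTower.toAlgHom O 𝒱 L).comp β
  -- The point Spec L factors through 𝒰, so it avoids the divisor; hence t is nonzero in L.
  have hγI : ¬ I ≤ RingHom.ker γ := by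
    refine (hz ⟨RingHom.ker γ, RingHom.ker_isPrime _⟩).1 ?_
    let η : Spec (.of L) := (⊥ : PrimeSpectrum L)
    have h1 : (⟨RingHom.ker γ, RingHom.ker_isPrime _⟩ : Spec (.of C)) =
        Spec.map (CommRingCat.ofHom ((algebraMap 𝒱 L).comp β.toRingHom)) η :=
      PrimeSpectrum.ext rfl
    rw [h1, ← Scheme.Hom.comp_apply, hβ, Scheme.Hom.comp_apply]
    exact ⟨_, rfl⟩
  have hβu {a : C} (ha : a ∉ 𝔪) : IsUnit (β a) := by
    simpa [𝔪] using ha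
  have hγt : γ t ≠ 0 := by
    intro h0
    apply hγI
    intro x hx
    obtain ⟨y, hy⟩ := hdvd x hx
    have h1 : γ b * γ x = 0 := by rw [← map_mul, hy, map_mul, h0, zero_mul]
    have h2 : IsUnit (γ b) := (hβu (hunit hbI)).map (algebraMap 𝒱 L)
    exact (h2.mul_right_eq_zero).1 h1
  let Ct := Localization.Away t
  let γt : Ct →ₐ[O] L := IsLocalization.Away.liftAlgHom t (f := γ) (IsUnit.mk0 _ hγt)
  have hγtC (a : C) : γt (algebraMap C Ct a) = γ a :=
    IsLocalization.Away.lift_eq (S := Ct) (g := γ.toRingHom) t (IsUnit.mk0 _ hγt) a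
  have hcomp : γt.toRingHom.comp (algebraMap C Ct) = γ.toRingHom := RingHom.ext hγtC
  have havoid (z : Spec (.of C)) (hzt : t ∉ z.asIdeal) : c.f z ∈ Set.range j.f :=
    (hz z).2 fun h => hzt (h htI)
  -- The locus t ≠ 0 is an open part of 𝒰, so its functions embed in L. Since t is a nonzerodivisor
  -- in S, this embedding extends to S.
  obtain ⟨hγinj, χ, hχ, hχ'⟩ := j.injective_of_isDomain (c.localize t Ct) ψ hψ γt.toRingHom
    (by
      change _ ≫ Spec.map _ ≫ c.f = _
      rw [← hβ, ← Category.assoc, ← Spec.map_comp, ← CommRingCat.ofHom_comp, hcomp]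
      rfl)
    (fun z => havoid _ fun hzt => z.2.ne_top (Ideal.eq_top_of_isUnit_mem z.asIdeal
      (x := algebraMap C Ct t) hzt (IsLocalization.Away.algebraMap_isUnit t)))
  have hχ (a : A) : γt (χ a) = ψ a := RingHom.congr_fun hχ a
  let S := Localization.AtPrime 𝔪
  have hγu (y : 𝔪.primeCompl) : IsUnit (γ y) := (hβu y.2).map (algebraMap 𝒱 L)
  let ι : S →ₐ[O] L := IsLocalization.liftAlgHom (M := 𝔪.primeCompl) (f := γ) hγu
  have hι (a : C) : ι (algebraMap C S a) = γ a :=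
    IsLocalization.lift_eq (g := γ.toRingHom) hγu a
  have htorsC (a : C) (ha : p * a = 0) : a = 0 := by
    have h1 := Module.Flat.isSMulRegular_of_nonZeroDivisors (M := C)
      (mem_nonZeroDivisors_of_ne_zero hpO)
    refine h1 (?_ : (p : O) • a = (p : O) • 0)
    rw [smul_zero, Algebra.smul_def, map_natCast, ha]
  have htors (s : S) (hs : p * s = 0) : s = 0 := by
    obtain ⟨⟨a, y⟩, hay⟩ := IsLocalization.surj 𝔪.primeCompl s
    have h1 : algebraMap C S (p * a) = algebraMap C S 0 := by
      rw [map_zero, map_mul, map_natCast, ← hay, ← mul_assoc, hs, zero_mul]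
    obtain ⟨v, hv⟩ := (IsLocalization.eq_iff_exists 𝔪.primeCompl S).1 h1
    have h2 : (v * a : C) = 0 := htorsC _ (by rw [mul_left_comm, hv, mul_zero])
    have h3 : algebraMap C S a = 0 := by
      rw [← (IsLocalization.map_units S v).mul_right_eq_zero, ← map_mul, h2, map_zero]
    rw [h3] at hay
    exact ((IsLocalization.map_units S y).mul_left_eq_zero).1 hay
  have htS (s : S) (hs : algebraMap C S t * s = 0) : s = 0 := by
    have : IsNoetherianRing S := IsLocalization.isNoetherianRing 𝔪.primeCompl _ inferInstance
    exact mul_eq_zero_of_derivation_eq_one hO htors δ hδ s hs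
  have hγ0 (a : C) (ha : γ a = 0) : algebraMap C S a = 0 := by
    rw [← hγtC, ← map_zero γt] at ha
    obtain ⟨⟨_, n, rfl⟩, hn⟩ :=
      (IsLocalization.map_eq_zero_iff (Submonoid.powers t) Ct a).1 ((hγinj ha))
    have h1 : algebraMap C S t ^ n * algebraMap C S a = 0 := by
      rw [← map_pow, ← map_mul]
      exact (congrArg _ hn).trans (map_zero _)
    clear hn
    induction n with
    | zero => simpa using h1
    | succ n ih => exact ih (htS _ (by rw [← h1]; ring))
  have hιinj : Function.Injective ι := by
    rw [injective_iff_map_eq_zero]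
    intro s hs
    obtain ⟨⟨a, y⟩, hay⟩ := IsLocalization.surj 𝔪.primeCompl s
    have h1 : γ a = 0 := by rw [← hι, ← hay, map_mul, hs, zero_mul]
    rw [hγ0 a h1] at hay
    exact ((IsLocalization.map_units S y).mul_left_eq_zero).1 hay
  have hIS (x : C) (hx : x ∈ I) : algebraMap C S t ∣ algebraMap C S x := by
    have h1 := map_dvd (algebraMap C S) (hdvd x hx)
    rw [map_mul] at h1
    exact (IsLocalization.map_units S (⟨b, hunit hbI⟩ : 𝔪.primeCompl)).dvd_mul_left.1 h1
  have hreg (s : S) (hs : algebraMap C S t ∣ p * s) : algebraMap C S t ∣ s := by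
    obtain ⟨⟨a, y⟩, hay⟩ := IsLocalization.surj 𝔪.primeCompl s
    obtain ⟨s', hs'⟩ := hs
    obtain ⟨⟨a', y'⟩, hay'⟩ := IsLocalization.surj 𝔪.primeCompl s'
    have h1 : algebraMap C S (p * a * y') = algebraMap C S (t * a' * y) := by
      simp only [map_mul, map_natCast]
      dsimp only at hay hay'
      rw [← hay, ← hay']
      linear_combination (algebraMap C S y * algebraMap C S y') * hs'
    obtain ⟨v, hv⟩ := (IsLocalization.eq_iff_exists 𝔪.primeCompl S).1 h1
    -- The divisor is étale, hence flat, over O, so p is a nonzerodivisor on C/I.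
    have h2 : a * y' * v ∈ I := by
      rw [← Ideal.Quotient.eq_zero_iff_mem]
      have hreg := Module.Flat.isSMulRegular_of_nonZeroDivisors (M := E)
        (mem_nonZeroDivisors_of_ne_zero hpO)
      refine hreg (?_ : (p : O) • Ideal.Quotient.mk I (a * y' * v) = (p : O) • 0)
      rw [smul_zero, Algebra.smul_def, map_natCast, ← map_natCast (Ideal.Quotient.mk I),
        ← map_mul, Ideal.Quotient.eq_zero_iff_mem]
      have : (p : C) * (a * y' * v) = t * (a' * y * v) := by linear_combination hv
      rw [this]
      exact Ideal.mul_mem_right _ _ htI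
    have h3 := hIS _ h2
    rw [map_mul, map_mul, (IsLocalization.map_units S v).dvd_mul_right,
      (IsLocalization.map_units S y').dvd_mul_right] at h3
    dsimp only at hay
    rw [← hay, (IsLocalization.map_units S y).dvd_mul_right] at h3
    exact h3
  have hpow (a : Ct) : ∃ (n : ℕ) (s : C), γ t ^ n * γt a = γ s := by
    obtain ⟨⟨s, ⟨_, n, rfl⟩⟩, hs⟩ := IsLocalization.surj (Submonoid.powers t) a
    refine ⟨n, s, ?_⟩
    rw [← hγtC s, ← hs, map_mul, hγtC, map_pow, mul_comm]
  refine ⟨{ C := C, c := c, 𝔪 := 𝔪, t := t, mem := ?_, δ := δ, δ_t := hδ,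
            span_D := hspan, reg := hreg, t_mem := hI𝔪 htI, p_mem := ?_, ι := ι, inj := hιinj,
            fac := ?_, dom := ?_, dom_lt := ?_, pow_mul := ?_, deriv := ?_ }⟩
  · intro z hz𝔪 htz
    refine fun h => (hz z).1 h fun x hx => ?_
    exact (z.2.mem_or_mem (Ideal.mem_of_dvd _ (hdvd x hx) htz)).resolve_left
      fun h => hunit hbI (hz𝔪 h)
  · change β p ∈ maximalIdeal 𝒱
    rw [map_natCast]
    exact (𝒱.valuation_lt_one_iff _).2 hp
  · rw [← hβ]
    congr 3
    exact RingHom.ext hι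
  · intro s
    obtain ⟨⟨a, y⟩, hay⟩ := IsLocalization.surj 𝔪.primeCompl s
    obtain ⟨w, hw⟩ := (hβu y.2).exists_right_inv
    have h1 : ι s = (β a * w : 𝒱) := by
      have h2 : γ y * (w : L) = 1 := congrArg Subtype.val hw
      have h3 : ι s * γ y = γ a := by rw [← hι, ← hι, ← map_mul, hay]
      change ι s = γ a * w
      rw [← h3, mul_assoc, h2, mul_one]
    rw [h1]
    exact Subtype.prop _
  · intro s
    obtain ⟨⟨a, y⟩, hay⟩ := IsLocalization.surj 𝔪.primeCompl s
    have h3 : ι s * γ y = γ a := by rw [← hι, ← hι, ← map_mul, hay]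
    have h4 : 𝒱.valuation (γ y) = 1 := (𝒱.valuation_eq_one_iff _).1 (hβu y.2)
    have h6 : 𝒱.valuation (ι s) = 𝒱.valuation (γ a) := by rw [← h3, map_mul, h4, mul_one]
    rw [h6]
    have h5 : 𝒱.valuation (γ a) < 1 ↔ a ∈ 𝔪 := (𝒱.valuation_lt_one_iff (β a)).symm
    rw [h5, ← IsLocalization.AtPrime.to_map_mem_maximal_iff S 𝔪]
    dsimp only at hay
    rw [← hay]
    refine ⟨fun h => Ideal.mul_mem_right _ _ h, fun h => ?_⟩
    exact ((Ideal.IsPrime.mem_or_mem inferInstance h).resolve_right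
      fun h => h (IsLocalization.map_units S y))
  · intro a
    obtain ⟨n, s, h⟩ := hpow (χ a)
    exact ⟨n, algebraMap C S s, by rw [hι, hι, ← hχ, h]⟩
  · intro Δ hΔ s
    let := χ.toAlgebra
    let := γt.toAlgebra
    have : IsScalarTower O Ct L := .of_algebraMap_eq fun o => (γt.commutes o).symm
    have : IsScalarTower O A Ct := .of_algebraMap_eq fun o => (χ.commutes o).symm
    -- Spec C[1/t] is open in Spec A, so a derivation of L that preserves A preserves C[1/t]; only
    -- powers of t then appear as denominators.
    have hunr : Algebra.FormallyUnramified A Ct := by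
      have h0 : IsOpenImmersion (Spec.map (CommRingCat.ofHom χ.toRingHom) ≫ j.f) := by
        rw [hχ']; infer_instance
      have h1 : IsOpenImmersion (Spec.map (CommRingCat.ofHom χ.toRingHom)) :=
        IsOpenImmersion.of_comp _ j.f
      have h2 : Etale (Spec.map (CommRingCat.ofHom χ.toRingHom)) := inferInstance
      rw [HasRingHomProperty.Spec_iff (P := @Etale)] at h2
      have h3 : Algebra.Etale A Ct := h2.toAlgebra
      infer_instance
    have key (a : Ct) : ∃ a', Δ (γt a) = γt a' := by
      have := Derivation.mem_of_formallyUnramified (A := A) (Δ.compAlgebraMap Ct)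
        (LinearMap.range (Algebra.linearMap Ct L)) (fun a => ?_) a
      · obtain ⟨a', h⟩ := this
        exact ⟨a', h.symm⟩
      · obtain ⟨a', h⟩ := hΔ a
        refine ⟨χ a', ?_⟩
        change γt (χ a') = Δ (γt (χ a))
        rw [hχ, hχ, h]
    have key' (a : C) : ∃ n s, γ t ^ n * Δ (γ a) = γ s := by
      obtain ⟨a', h⟩ := key (algebraMap C Ct a)
      rw [← hγtC a, h]
      exact hpow a'
    obtain ⟨⟨a, y⟩, hay⟩ := IsLocalization.surj 𝔪.primeCompl s
    obtain ⟨n, a', ha'⟩ := key' a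
    obtain ⟨m, y', hy'⟩ := key' y
    have hy0 : γ y ≠ 0 := (hγu y).ne_zero
    obtain ⟨v, hv⟩ : ∃ v, v * algebraMap C S y = 1 :=
      (IsLocalization.map_units S y).exists_left_inv
    have hv' : ι v * γ y = 1 := by rw [← hι, ← map_mul, hv, map_one]
    have hs : ι s * γ y = γ a := by rw [← hι, ← hι, ← map_mul, hay]
    have hΔs : Δ (ι s) * γ y = Δ (γ a) - ι s * Δ (γ y) := by
      rw [← hs, Derivation.leibniz]
      simp only [smul_eq_mul]
      ring
    refine ⟨n + m, v * (algebraMap C S (t ^ m * a') - s * algebraMap C S (t ^ n * y')), ?_⟩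
    rw [map_mul, map_sub, map_mul ι s, hι, hι, hι, map_mul, map_mul, map_pow, map_pow, ← ha', ← hy']
    linear_combination (-(γ t ^ (n + m) * Δ (ι s))) * hv' + γ t ^ (n + m) * ι v * hΔs

end DivisorialChart

/-! ### The exponent of t in r is a ramification index -/

section RamificationIndex

open IsLocalRing

/-- R is an algebra over the fraction field of O, and d = gcd(f, r) lies in the maximal ideal. As r
is separable, d is prime to the cofactor r/d, which is therefore a unit in R. So r generates the
ideal of the image point of the affine line. -/
lemma aeval_dvd_aeval_of_isCoprime {O R : Type*} [CommRing O] [IsDomain O] [CommRing R]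
    [IsLocalRing R] [Algebra O R] (hu : ∀ o : O, o ≠ 0 → IsUnit (algebraMap O R o)) (ξ : R)
    (r : O[X]) (hr : IsCoprime r (derivative r)) (hrm : aeval ξ r ∈ maximalIdeal R) (f : O[X])
    (hf : aeval ξ f ∈ maximalIdeal R) : aeval ξ r ∣ aeval ξ f := by
  classical
  let K := FractionRing O
  let κ : K →+* R := IsLocalization.lift (M := nonZeroDivisors O) (g := algebraMap O R)
    fun y => hu y (nonZeroDivisors.ne_zero y.2)
  let m := mapRingHom (algebraMap O K)
  let Φ : K[X] →+* R := eval₂RingHom κ ξ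
  have hΦ (g : O[X]) : Φ (m g) = aeval ξ g := by
    have : κ.comp (algebraMap O K) = algebraMap O R := IsLocalization.lift_comp _
    simp [Φ, m, eval₂_map, this, aeval_def]
  rw [← hΦ] at hrm hf
  rw [← hΦ, ← hΦ]
  have hd := EuclideanDomain.gcd_eq_gcd_ab (m f) (m r)
  set d := EuclideanDomain.gcd (m f) (m r)
  obtain ⟨f₁, hf₁⟩ := EuclideanDomain.gcd_dvd_left (m f) (m r)
  obtain ⟨r₁, hr₁⟩ := EuclideanDomain.gcd_dvd_right (m f) (m r)
  change m f = d * f₁ at hf₁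
  change m r = d * r₁ at hr₁
  have hdm : Φ d ∈ maximalIdeal R := by
    rw [hd, map_add, map_mul, map_mul]
    exact add_mem (Ideal.mul_mem_right _ _ hf) (Ideal.mul_mem_right _ _ hrm)
  have hcop : IsCoprime d r₁ := by
    have h1 : IsCoprime (m r) (derivative (m r)) := by
      have : derivative (m r) = m (derivative r) := derivative_map r _
      rw [this]
      exact hr.map m
    rw [hr₁, derivative_mul] at h1
    obtain ⟨a, b, h⟩ := h1
    exact ⟨a * r₁ + b * derivative r₁, b * derivative d, by linear_combination h⟩
  have hr₁u : IsUnit (Φ r₁) := by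
    by_contra h
    obtain ⟨a, b, hab⟩ := hcop
    have h1 : (1 : R) = Φ a * Φ d + Φ b * Φ r₁ := by rw [← map_mul, ← map_mul, ← map_add, hab, map_one]
    exact (Ideal.ne_top_iff_one _).1 (maximalIdeal.isMaximal R).ne_top
      (h1 ▸ add_mem (Ideal.mul_mem_left _ _ hdm) (Ideal.mul_mem_left _ _ h))
  rw [hf₁, hr₁, map_mul, map_mul, hr₁u.mul_right_dvd]
  exact dvd_mul_right _ _

/-- A local homomorphism is ramified of index `n` if the maximal ideal generates the `n`-th power of
the maximal ideal. -/
lemma map_maximalIdeal_eq_of_arrow_iso {A B A' B' : CommRingCat.{u}} [IsLocalRing A] [IsLocalRing B]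
    [IsLocalRing A'] [IsLocalRing B'] {f : A ⟶ B} {f' : A' ⟶ B'} (e : Arrow.mk f ≅ Arrow.mk f')
    (n : ℕ) (h : (maximalIdeal A').map f'.hom = maximalIdeal B' ^ n) :
    (maximalIdeal A).map f.hom = maximalIdeal B ^ n := by
  have hm {R S : CommRingCat.{u}} [IsLocalRing R] [IsLocalRing S] (e : R ≅ S) :
      (maximalIdeal R).map e.hom.hom = maximalIdeal S := by
    have : Function.Surjective e.hom.hom := e.commRingCatIsoToRingEquiv.surjective
    have h1 : ((maximalIdeal R).map e.hom.hom).IsMaximal := by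
      exact Ideal.map_isMaximal_of_equiv e.commRingCatIsoToRingEquiv
    exact eq_maximalIdeal h1
  have h1 := hm (R := A') (S := A) ((Arrow.leftFunc).mapIso e.symm)
  have h2 := hm (R := B') (S := B) ((Arrow.rightFunc).mapIso e.symm)
  rw [← h1, Ideal.map_map, ← h2, ← Ideal.map_pow, ← h, Ideal.map_map]
  congr 1
  rw [← CommRingCat.hom_comp, ← CommRingCat.hom_comp]
  congr 1
  exact e.symm.hom.w

/-- It provides the generization map from the local ring at a closed point of the divisor to the
local ring at its generic point. -/
lemma exists_ringHom_of_isLocalization {C₀ C S R : Type*} [CommRing C₀] [CommRing C] [CommRing S]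
    [CommRing R] [Algebra C₀ C] (y : C₀) [IsLocalization.Away y C] (M : Submonoid C₀) [Algebra C₀ S]
    [IsLocalization M S] (σ : C →+* S) (hσ : ∀ b, σ (algebraMap C₀ C b) = algebraMap C₀ S b)
    [Algebra C R] [Algebra C₀ R] [IsScalarTower C₀ C R] (hM : ∀ b : M, IsUnit (algebraMap C₀ R b)) :
    ∃ τ : S →+* R, ∀ b, τ (σ b) = algebraMap C R b := by
  let τ : S →+* R := IsLocalization.lift hM
  refine ⟨τ, fun b => ?_⟩
  have : τ.comp σ = algebraMap C R := by
    refine IsLocalization.ringHom_ext (Submonoid.powers y) (RingHom.ext fun b => ?_)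
    rw [RingHom.comp_apply, RingHom.comp_apply, RingHom.comp_apply, hσ,
      ← IsScalarTower.algebraMap_apply]
    exact IsLocalization.lift_eq hM b
  exact RingHom.congr_fun this b

/-- At 𝔭 the maximal ideal is generated by t, whereas that of the image point generates the ideal of
r = t^e ε. -/
lemma map_localRingHom_maximalIdeal {O C S : Type u} [CommRing O] [IsDomain O] [CommRing C]
    [Algebra O C] [CommRing S] {t : S} (σ : C →+* S) (𝔭 : PrimeSpectrum C)
    (h𝔭 : ∀ b, b ∈ 𝔭.asIdeal ↔ t ∣ σ b) (h𝔭O : ∀ o, o ≠ 0 → algebraMap O C o ∉ 𝔭.asIdeal)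
    {τ : S →+* Localization.AtPrime 𝔭.asIdeal}
    (hτ : ∀ b, τ (σ b) = algebraMap C (Localization.AtPrime 𝔭.asIdeal) b) {t₀ : C} (ht₀ : σ t₀ = t)
    (ξ : C) {r : O[X]} (hr : IsCoprime r (derivative r)) {e : ℕ} (he : e ≠ 0) {ε : Sˣ}
    (hre : σ (aeval ξ r) = t ^ e * ε) :
    (maximalIdeal (Localization.AtPrime (𝔭.comap (aeval ξ : O[X] →ₐ[O] C).toRingHom).asIdeal)).map
      (Localization.localRingHom (𝔭.comap (aeval ξ : O[X] →ₐ[O] C).toRingHom).asIdeal 𝔭.asIdeal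
        (aeval ξ : O[X] →ₐ[O] C).toRingHom rfl) =
        maximalIdeal (Localization.AtPrime 𝔭.asIdeal) ^ e := by
  let R₁ := Localization.AtPrime 𝔭.asIdeal
  let φ : O[X] →ₐ[O] C := aeval ξ
  have hmem (b : C) : algebraMap C R₁ b ∈ maximalIdeal R₁ ↔ b ∈ 𝔭.asIdeal :=
    IsLocalization.AtPrime.to_map_mem_maximal_iff R₁ 𝔭.asIdeal b
  have hmax : maximalIdeal R₁ = Ideal.span {τ t} := by
    apply le_antisymm
    · rw [← Localization.AtPrime.map_eq_maximalIdeal, Ideal.map_le_iff_le_comap]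
      intro b hb
      rw [Ideal.mem_comap, Ideal.mem_span_singleton, ← hτ]
      exact map_dvd τ ((h𝔭 b).1 hb)
    · rw [Ideal.span_singleton_le_iff_mem, ← ht₀, hτ, hmem, h𝔭, ht₀]
  have hφR (g : O[X]) : algebraMap C R₁ (φ g) = aeval (algebraMap C R₁ ξ) g := by
    rw [Polynomial.aeval_algebraMap_apply]
  have hrR : algebraMap C R₁ (φ r) = τ t ^ e * τ ε := by
    rw [← hτ, hre, map_mul, map_pow]
  have hrm : algebraMap C R₁ (φ r) ∈ maximalIdeal R₁ := by
    rw [hrR, hmax]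
    exact Ideal.mul_mem_right _ _ (Ideal.pow_mem_of_mem _ (Ideal.mem_span_singleton_self _) e
      (Nat.pos_of_ne_zero he))
  rw [← Localization.AtPrime.map_eq_maximalIdeal, Ideal.map_map]
  change Ideal.map _ _ = maximalIdeal R₁ ^ e
  have hcomp : (Localization.localRingHom (𝔭.comap φ.toRingHom).asIdeal 𝔭.asIdeal
      φ.toRingHom rfl).comp (algebraMap O[X] _) = (algebraMap C R₁).comp φ.toRingHom :=
    RingHom.ext fun g => Localization.localRingHom_to_map _ _ _ rfl g
  rw [hcomp, hmax, Ideal.span_singleton_pow]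
  apply le_antisymm
  · rw [Ideal.map_le_iff_le_comap]
    intro g hg
    rw [Ideal.mem_comap, Ideal.mem_span_singleton]
    have h1 : algebraMap C R₁ (φ r) ∣ algebraMap C R₁ (φ g) := by
      rw [hφR, hφR]
      refine aeval_dvd_aeval_of_isCoprime (fun o ho => ?_) _ r hr ?_ g ?_
      · rw [IsScalarTower.algebraMap_apply O C R₁]
        exact IsLocalization.map_units R₁ (⟨_, h𝔭O o ho⟩ : 𝔭.asIdeal.primeCompl)
      · rw [← hφR]; exact hrm
      · rw [← hφR, hmem]; exact hg
    rw [hrR] at h1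
    exact (dvd_mul_right _ _).trans h1
  · rw [Ideal.span_singleton_le_iff_mem]
    have h1 : τ t ^ e = algebraMap C R₁ (φ r) * τ ↑ε⁻¹ := by
      rw [hrR, mul_assoc, ← map_mul, Units.mul_inv, map_one, mul_one]
    rw [h1]
    exact Ideal.mul_mem_right _ _ (Ideal.mem_map_of_mem
      ((algebraMap C R₁).comp φ.toRingHom) (x := r) ((hmem _).1 hrm))

variable {O L : Type u} [CommRing O] [Field L] [Algebra O L] {X : Scheme.{u}}
  {π : X ⟶ Spec (.of O)} {Q : O[X][X]} {r : O[X]}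

lemma hasRamificationIndex_of_affineChart [IsDomain (OpenRing Q r)]
    (j : AffineChart π (OpenRing Q r)) (ψ : OpenRing Q r →ₐ[O] L) (hψ : Function.Injective ψ)
    {C : Type u} [CommRing C] [Algebra O C] (c : AffineChart π C) (γ : C →+* L)
    (fac : Spec.map (CommRingCat.ofHom γ) ≫ c.f =
      Spec.map (CommRingCat.ofHom ψ.toRingHom) ≫ j.f) (φ : O[X] →+* C)
    (hφ : ∀ g, γ (φ g) = ψ (algebraMap _ _ g)) (𝔭 : PrimeSpectrum C) (n : ℕ)
    (h : (maximalIdeal (Localization.AtPrime (𝔭.comap φ).asIdeal)).map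
      (Localization.localRingHom (𝔭.comap φ).asIdeal 𝔭.asIdeal φ rfl) =
        maximalIdeal (Localization.AtPrime 𝔭.asIdeal) ^ n) :
    HasRamificationIndex j.f (c.f 𝔭) n := by
  let P : Spec (.of C) := 𝔭
  change HasRamificationIndex j.f (c.f P) n
  let V := c.f.opensRange
  let e : Spec (.of C) ≅ V.toScheme := c.f.isoOpensRange
  have he : e.hom ≫ V.ι = c.f := c.f.isoOpensRange_hom_ι
  let g : V.toScheme ⟶ Spec (.of O[X]) := e.inv ≫ Spec.map (CommRingCat.ofHom φ)
  refine ⟨V, e.hom P, g, ?_, ?_, ?_⟩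
  · rw [← Scheme.Hom.comp_apply, he]
  · let lψ := Spec.map (CommRingCat.ofHom ψ.toRingHom)
    have hdom : IsDominant lψ := by
      refine ⟨?_⟩
      refine (PrimeSpectrum.denseRange_comap_iff_ker_le_nilRadical ψ.toRingHom).2 ?_
      intro a ha
      rw [(injective_iff_map_eq_zero ψ).1 hψ a ha]
      exact zero_mem _
    have hrange : Set.range lψ ⊆ Set.range (j.f ⁻¹ᵁ V).ι := by
      rw [Scheme.Opens.range_ι]
      rintro _ ⟨z, rfl⟩
      change j.f (lψ z) ∈ Set.range c.f
      rw [← Scheme.Hom.comp_apply, ← fac, Scheme.Hom.comp_apply]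
      exact ⟨_, rfl⟩
    let k := IsOpenImmersion.lift (j.f ⁻¹ᵁ V).ι lψ hrange
    have hk : k ≫ (j.f ⁻¹ᵁ V).ι = lψ := IsOpenImmersion.lift_fac _ _ _
    have hkd : IsDominant (k ≫ (j.f ⁻¹ᵁ V).ι) := by rw [hk]; exact hdom
    have : IsDominant k := IsDominant.of_comp_of_isOpenImmersion k (j.f ⁻¹ᵁ V).ι
    have : IsReduced (j.f ⁻¹ᵁ V).toScheme := inferInstance
    -- The two maps to the affine line agree on Spec L, which is dominant in the reduced scheme
    -- j⁻¹(V) because ψ is injective.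
    refine ext_of_isDominant k ?_
    have h1 : k ≫ (j.f ∣_ V) = Spec.map (CommRingCat.ofHom γ) ≫ e.hom := by
      rw [← cancel_mono V.ι, Category.assoc, morphismRestrict_ι, ← Category.assoc, hk,
        Category.assoc, he, fac]
    rw [← Category.assoc, h1, ← Category.assoc k, hk]
    simp only [g, Category.assoc, e.hom_inv_id_assoc]
    rw [xMor, ← Spec.map_comp, ← Spec.map_comp]
    congr 1
    ext1
    exact RingHom.ext hφ
  · have h1 : ∀ f : Spec (.of C) ⟶ Spec (.of O[X]), f = Spec.map (CommRingCat.ofHom φ) →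
        (maximalIdeal ((Spec (.of O[X])).presheaf.stalk (f P))).map (f.stalkMap P).hom =
          maximalIdeal ((Spec (.of C)).presheaf.stalk P) ^ n := by
      rintro f rfl
      let f := Spec.map (CommRingCat.ofHom φ)
      have i : Arrow.mk (f.stalkMap P) ≅ Arrow.mk (CommRingCat.ofHom
          (Localization.localRingHom (𝔭.comap φ).asIdeal 𝔭.asIdeal φ rfl)) :=
        Scheme.arrowStalkMapSpecIso (CommRingCat.ofHom φ) 𝔭
      have l₁ : IsLocalRing (CommRingCat.of (Localization.AtPrime (𝔭.comap φ).asIdeal)) :=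
        inferInstanceAs (IsLocalRing (Localization.AtPrime (𝔭.comap φ).asIdeal))
      have l₂ : IsLocalRing (CommRingCat.of (Localization.AtPrime 𝔭.asIdeal)) :=
        inferInstanceAs (IsLocalRing (Localization.AtPrime 𝔭.asIdeal))
      exact map_maximalIdeal_eq_of_arrow_iso i n h
    have h2 := h1 (e.hom ≫ g) (by simp [g])
    have i : Arrow.mk (g.stalkMap (e.hom P)) ≅ Arrow.mk ((e.hom ≫ g).stalkMap P) :=
      Arrow.isoMk (Iso.refl _) (asIso (e.hom.stalkMap P)) (by
        simp only [Arrow.mk_left, Arrow.mk_right, Iso.refl_hom, asIso_hom,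
          Arrow.mk_hom]
        exact Scheme.Hom.stalkMap_comp e.hom g P)
    exact map_maximalIdeal_eq_of_arrow_iso i n h2

theorem DivisorialChart.exists_hasRamificationIndex [IsDomain O] [IsDiscreteValuationRing O]
    [IsDomain (OpenRing Q r)] {j : AffineChart π (OpenRing Q r)} {ψ : OpenRing Q r →ₐ[O] L}
    (hψ : Function.Injective ψ) {p : ℕ} (hO : maximalIdeal O = Ideal.span {(p : O)})
    {𝒱 : ValuationSubring L} (dc : DivisorialChart π j ψ p 𝒱)
    (hprime : Prime (algebraMap dc.C (Localization.AtPrime dc.𝔪) dc.t))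
    (hr : IsCoprime r (derivative r)) {ξ : Localization.AtPrime dc.𝔪}
    (hξ : dc.ι ξ = ψ (OpenRing.x Q r)) {e : ℕ} (he : e ≠ 0) (ε : (Localization.AtPrime dc.𝔪)ˣ)
    (hre : aeval ξ r = algebraMap dc.C (Localization.AtPrime dc.𝔪) dc.t ^ e * ε) :
    ∃ P, P ∉ Set.range j.f ∧ (π P : PrimeSpectrum O).asIdeal = ⊥ ∧
      HasRamificationIndex j.f P e := by
  let S := Localization.AtPrime dc.𝔪
  set t : S := algebraMap dc.C S dc.t
  obtain ⟨⟨a, y⟩, hay⟩ := IsLocalization.surj dc.𝔪.primeCompl ξ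
  dsimp only at hay
  -- The function x is regular only at 𝔪; inverting its denominator y makes it regular on the whole
  -- chart.
  let C := Localization.Away (y : dc.C)
  have hyu := IsLocalization.map_units S y
  let σ : C →ₐ[O] S := IsLocalization.Away.liftAlgHom (y : dc.C)
    (f := IsScalarTower.toAlgHom O dc.C S) hyu
  have hσ (b : dc.C) : σ (algebraMap dc.C C b) = algebraMap dc.C S b :=
    IsLocalization.Away.lift_eq (S := C) (g := algebraMap dc.C S) (y : dc.C) hyu b
  let c : AffineChart π C := dc.c.localize (y : dc.C) C
  obtain ⟨v, hv⟩ : ∃ v : C, algebraMap dc.C C y * v = 1 :=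
    (IsLocalization.Away.algebraMap_isUnit (y : dc.C)).exists_right_inv
  have hx : σ (algebraMap dc.C C a * v) = ξ := by
    have h1 : algebraMap dc.C S y * σ v = 1 := by rw [← hσ, ← map_mul, hv, map_one]
    rw [map_mul, hσ, ← hay, mul_assoc, h1, mul_one]
  let φ : O[X] →ₐ[O] C := aeval (algebraMap dc.C C a * v)
  have hφ (g : O[X]) : σ (φ g) = aeval ξ g := by
    rw [← hx, ← Polynomial.aeval_algHom_apply]
  have hIt : (Ideal.span {t}).IsPrime := (Ideal.span_singleton_prime hprime.ne_zero).2 hprime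
  -- This is the generic point of the branch of the divisor through 𝔪. It lies in the generic fibre
  -- because p is regular modulo t.
  let 𝔭 : PrimeSpectrum C := ⟨(Ideal.span {t}).comap σ, inferInstance⟩
  have h𝔭 (b : C) : b ∈ 𝔭.asIdeal ↔ t ∣ σ b := Ideal.mem_span_singleton
  have htm : t ∈ maximalIdeal S :=
    (IsLocalization.AtPrime.to_map_mem_maximal_iff S dc.𝔪 dc.t).2 dc.t_mem
  have h𝔭t : algebraMap dc.C C dc.t ∈ 𝔭.asIdeal := (h𝔭 _).2 (by rw [hσ])
  have h𝔭O (o : O) (ho : o ≠ 0) : algebraMap O C o ∉ 𝔭.asIdeal := by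
    rw [h𝔭, AlgHom.commutes]
    intro h
    have hirr : Irreducible (p : O) := by
      rw [IsDiscreteValuationRing.irreducible_iff_uniformizer]
      exact hO
    obtain ⟨n, u, rfl⟩ := IsDiscreteValuationRing.eq_unit_mul_pow_irreducible ho hirr
    rw [map_mul, (u.isUnit.map (algebraMap O S)).dvd_mul_left, map_pow, map_natCast,
      ← mul_one (_ ^ n)] at h
    exact htm (isUnit_of_dvd_one (dvd_of_dvd_pow_mul dc.reg n 1 h))
  refine ⟨c.f 𝔭, ?_, ?_, ?_⟩
  · refine dc.mem _ ?_ h𝔭t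
    intro b hb
    rw [← IsLocalization.AtPrime.to_map_mem_maximal_iff S dc.𝔪]
    have h1 : t ∣ algebraMap dc.C S b := by
      rw [← hσ]
      exact (h𝔭 _).1 hb
    exact Ideal.mem_of_dvd _ h1 htm
  · have h1 : π (c.f 𝔭) = Spec.map (CommRingCat.ofHom (algebraMap O C)) 𝔭 := by
      rw [← c.fac]
      rfl
    rw [h1, eq_bot_iff]
    intro o ho
    by_contra h0
    exact h𝔭O o h0 ho
  · refine hasRamificationIndex_of_affineChart j ψ hψ c ((dc.ι : S →+* L).comp (σ : C →+* S)) ?_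
      φ.toRingHom ?_ 𝔭 e ?_
    · rw [← dc.fac]
      change _ ≫ Spec.map _ ≫ dc.c.f = _
      rw [← Category.assoc, ← Spec.map_comp, ← CommRingCat.ofHom_comp]
      congr 3
      exact RingHom.ext fun b => congrArg dc.ι (hσ b)
    · intro g
      change dc.ι (σ (φ g)) = _
      have h1 : ψ (algebraMap O[X] (OpenRing Q r) g) = aeval (dc.ι ξ) g := by
        rw [hξ, Polynomial.aeval_algHom_apply]
        rw [OpenRing.x, Polynomial.aeval_algebraMap_apply, aeval_X_left_apply]
      rw [hφ, h1, Polynomial.aeval_algHom_apply]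
    · have hτu (b : dc.𝔪.primeCompl) : IsUnit (algebraMap dc.C (Localization.AtPrime 𝔭.asIdeal) b) := by
        rw [IsScalarTower.algebraMap_apply dc.C C]
        refine IsLocalization.map_units (Localization.AtPrime 𝔭.asIdeal)
          (⟨_, fun hb => ?_⟩ : 𝔭.asIdeal.primeCompl)
        have h1 := (h𝔭 _).1 hb
        rw [hσ] at h1
        exact htm (isUnit_of_dvd_unit h1 (IsLocalization.map_units S b))
      have h2 := exists_ringHom_of_isLocalization (C₀ := dc.C) (C := C) (S := S)
        (R := Localization.AtPrime 𝔭.asIdeal) (y : dc.C) dc.𝔪.primeCompl (σ : C →+* S) hσ hτu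
      obtain ⟨τ, hτ⟩ := h2
      exact map_localRingHom_maximalIdeal (σ : C →+* S) 𝔭 h𝔭 h𝔭O hτ (t₀ := algebraMap dc.C C dc.t)
        (hσ _) (algebraMap dc.C C a * v) hr he ((hφ r).trans hre)

end RamificationIndex

/-! ### Boundedness of the ramification indices -/

section BoundedRamification

open IsLocalRing

variable {O : Type u} [CommRing O] {X : Scheme.{u}} {Q : O[X][X]} {r : O[X]}

lemma maximalIdeal_map_of_surjective {R S : Type*} [CommRing R] [CommRing S] [IsLocalRing R]
    [IsLocalRing S] (f : R →+* S) (hf : Function.Surjective f) [IsLocalHom f] :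
    (maximalIdeal R).map f = maximalIdeal S := by
  apply le_antisymm
  · rw [Ideal.map_le_iff_le_comap]
    exact ((local_hom_TFAE f).out 0 3 :
      IsLocalHom f ↔ maximalIdeal R ≤ (maximalIdeal S).comap f).1 inferInstance
  · intro s hs
    obtain ⟨a, rfl⟩ := hf s
    exact Ideal.mem_map_of_mem f fun h => hs (h.map f)

/-- By Nakayama, equality of two different powers makes the smaller one vanish, so t would be a
nilpotent nonzerodivisor. -/
lemma eq_of_maximalIdeal_pow_eq {T : Type*} [CommRing T] [IsLocalRing T] [IsNoetherianRing T]
    {t : T} (ht : t ∈ maximalIdeal T) (htr : ∀ s, t * s = 0 → s = 0) {m n : ℕ}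
    (h : maximalIdeal T ^ m = maximalIdeal T ^ n) : m = n := by
  have key {m n : ℕ} (h : maximalIdeal T ^ m = maximalIdeal T ^ n) (hmn : m < n) : False := by
    have h1 : maximalIdeal T ^ m ≤ maximalIdeal T • maximalIdeal T ^ m := by
      rw [smul_eq_mul, ← pow_succ']
      exact h.le.trans (Ideal.pow_le_pow_right hmn)
    have h2 := Submodule.eq_bot_of_le_smul_of_le_jacobson_bot _ _ (IsNoetherian.noetherian _) h1
      (maximalIdeal_le_jacobson _)
    have h3 : t ^ m = 0 := by
      have := Ideal.pow_mem_pow ht m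
      rwa [h2] at this
    have h4 (m : ℕ) (h3 : t ^ m = 0) : (1 : T) = 0 := by
      induction m with
      | zero => rwa [pow_zero] at h3
      | succ m ih => exact ih (htr _ (by rw [← pow_succ', h3]))
    exact one_ne_zero (h4 m h3)
  rcases lt_trichotomy m n with h1 | h1 | h1
  · exact (key h h1).elim
  · exact h1
  · exact (key h.symm h1).elim

/-- Two extensions of x to Spec T agree where t ≠ 0, hence everywhere, because t is a
nonzerodivisor. The index is then read off from powers of one maximal ideal. -/
lemma eq_of_hasRamificationIndex {j : Spec (.of (OpenRing Q r)) ⟶ X} [IsOpenImmersion j]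
    {T : Type u} [CommRing T] [IsLocalRing T] [IsNoetherianRing T] (a : Spec (.of T) ⟶ X)
    [IsPreimmersion a] {t : T} (ht : t ∈ maximalIdeal T) (htr : ∀ s, t * s = 0 → s = 0)
    (hj : ∀ z : Spec (.of T), t ∉ z.asIdeal → a z ∈ Set.range j) {m n : ℕ}
    (hm : HasRamificationIndex j (a (closedPoint T)) m)
    (hn : HasRamificationIndex j (a (closedPoint T)) n) : m = n := by
  let z₀ : Spec (.of T) := closedPoint T
  let Tt := Localization.Away t
  let s : Spec (.of Tt) ⟶ Spec (.of T) := Spec.map (CommRingCat.ofHom (algebraMap T Tt))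
  have hinj : Function.Injective (algebraMap T Tt) := by
    refine IsLocalization.injective Tt (M := Submonoid.powers t) ?_
    refine Submonoid.powers_le.2 ?_
    rw [mem_nonZeroDivisors_iff_right]
    exact fun x hx => htr x (by rwa [mul_comm])
  have hrange : Set.range (s ≫ a) ⊆ Set.range j := by
    rintro _ ⟨z, rfl⟩
    rw [Scheme.Hom.comp_apply]
    exact hj _ fun hzt => z.2.ne_top (Ideal.eq_top_of_isUnit_mem z.asIdeal
      (x := algebraMap T Tt t) hzt (IsLocalization.Away.algebraMap_isUnit t))
  let χ := IsOpenImmersion.lift j (s ≫ a) hrange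
  have hχ : χ ≫ j = s ≫ a := IsOpenImmersion.lift_fac _ _ _
  have key {n : ℕ} (hn : HasRamificationIndex j (a z₀) n) :
      ∃ h : Spec (.of T) ⟶ Spec (.of O[X]), s ≫ h = χ ≫ xMor Q r ∧
        (maximalIdeal ((Spec (.of O[X])).presheaf.stalk (h z₀))).map (h.stalkMap z₀).hom =
          maximalIdeal ((Spec (.of T)).presheaf.stalk z₀) ^ n := by
    obtain ⟨V, P', g, hP', hg, hmap⟩ := hn
    have hV : Set.range a ⊆ Set.range V.ι := by
      rw [Scheme.Opens.range_ι]
      rintro _ ⟨z, rfl⟩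
      refine (specializes_closedPoint z).mem_open (V.2.preimage a.continuous) ?_
      change a z₀ ∈ V
      rw [← hP']
      exact P'.2
    let l := IsOpenImmersion.lift V.ι a hV
    have hl : l ≫ V.ι = a := IsOpenImmersion.lift_fac _ _ _
    have hlP : l z₀ = P' := by
      apply V.ι.injective
      rw [hP', ← Scheme.Hom.comp_apply, hl]
    subst hlP
    have : IsPreimmersion (l ≫ V.ι) := by rw [hl]; infer_instance
    have hls : SurjectiveOnStalks l := SurjectiveOnStalks.of_comp l V.ι
    refine ⟨l ≫ g, ?_, ?_⟩
    · have hk' : Set.range χ ⊆ Set.range (j ⁻¹ᵁ V).ι := by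
        rw [Scheme.Opens.range_ι]
        rintro _ ⟨z, rfl⟩
        change j (χ z) ∈ V
        rw [← Scheme.Hom.comp_apply, hχ, Scheme.Hom.comp_apply, ← hl, Scheme.Hom.comp_apply]
        exact (l (s z)).2
      let k := IsOpenImmersion.lift (j ⁻¹ᵁ V).ι χ hk'
      have hk : k ≫ (j ⁻¹ᵁ V).ι = χ := IsOpenImmersion.lift_fac _ _ _
      have h1 : k ≫ (j ∣_ V) = s ≫ l := by
        rw [← cancel_mono V.ι, Category.assoc, morphismRestrict_ι, ← Category.assoc, hk,
          Category.assoc, hl, hχ]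
      rw [← Category.assoc, ← h1, Category.assoc, hg, ← Category.assoc, hk]
    · have h1 : (maximalIdeal (V.toScheme.presheaf.stalk (l z₀))).map (l.stalkMap z₀).hom =
          maximalIdeal ((Spec (.of T)).presheaf.stalk z₀) :=
        maximalIdeal_map_of_surjective _ (l.stalkMap_surjective z₀)
      have h2 : ((l ≫ g).stalkMap z₀).hom = (l.stalkMap z₀).hom.comp (g.stalkMap (l z₀)).hom :=
        congrArg CommRingCat.Hom.hom (Scheme.Hom.stalkMap_comp l g z₀)
      refine (congrArg (fun f => Ideal.map f _) h2).trans ?_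
      refine (Ideal.map_map _ _).symm.trans ?_
      refine (congrArg (Ideal.map (l.stalkMap z₀).hom) hmap).trans ?_
      rw [Ideal.map_pow, h1]
  obtain ⟨h₁, hs₁, hm₁⟩ := key hm
  obtain ⟨h₂, hs₂, hm₂⟩ := key hn
  have heq : h₁ = h₂ := by
    obtain ⟨f₁, rfl⟩ := Spec.map_surjective h₁
    obtain ⟨f₂, rfl⟩ := Spec.map_surjective h₂
    have h := hs₁.trans hs₂.symm
    rw [← Spec.map_comp, ← Spec.map_comp] at h
    have h' := Spec.map_injective h
    congr 1
    ext1
    refine RingHom.ext fun x => hinj ?_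
    exact RingHom.congr_fun (congrArg CommRingCat.Hom.hom h') x
  subst heq
  have hpow := hm₁.symm.trans hm₂
  let e : (Spec (.of T)).presheaf.stalk z₀ ≃+* T :=
    ((Spec.stalkIso (.of T) z₀).commRingCatIsoToRingEquiv).trans
      (IsLocalization.atUnits T (maximalIdeal T).primeCompl
        (S := Localization.AtPrime (maximalIdeal T)) fun x hx => by
          simpa [IsUnit.mem_submonoid_iff] using hx).symm.toRingEquiv
  have he : (maximalIdeal ((Spec (.of T)).presheaf.stalk z₀)).map (e : _ →+* T) =
      maximalIdeal T := by
    have : IsLocalHom (e : (Spec (.of T)).presheaf.stalk z₀ →+* T) :=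
      ⟨fun x hx => (MulEquiv.isUnit_map e).1 hx⟩
    exact maximalIdeal_map_of_surjective _ e.surjective
  refine eq_of_maximalIdeal_pow_eq ht htr ?_
  rw [← he, ← Ideal.map_pow, ← Ideal.map_pow, hpow]

variable {D : Scheme.{u}} {π : X ⟶ Spec (.of O)}

/-- Needed because `sSup` of an unbounded set of natural numbers is 0. The points concerned lie in
the generic fibre of the étale, hence quasi-finite, divisor, so they are finite in number, and each
has at most one index. -/
theorem bddAbove_hasRamificationIndex [IsDomain O] [IsDiscreteValuationRing O] {p : ℕ}
    [Fact p.Prime] (hO : maximalIdeal O = Ideal.span {(p : O)}) [IsProper π]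
    [SmoothOfRelativeDimension 1 π] (j : AffineChart π (OpenRing Q r)) (i : D ⟶ X)
    [IsClosedImmersion i] [Etale (i ≫ π)] (hi : Set.range j.f = (Set.range i)ᶜ) :
    BddAbove {n : ℕ | ∃ P, P ∉ Set.range j.f ∧ (π P : PrimeSpectrum O).asIdeal = ⊥ ∧
      HasRamificationIndex j.f P n} := by
  have hpO : (p : O) ≠ 0 := by
    intro h
    apply IsDiscreteValuationRing.not_a_field O
    rw [hO, h, Ideal.span_singleton_eq_bot]
  have hfin : {P : X | P ∉ Set.range j.f ∧ (π P : PrimeSpectrum O).asIdeal = ⊥}.Finite := by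
    have hqf : LocallyQuasiFinite (i ≫ π) := by
      refine ⟨fun {U} hU {V} hV e => ?_⟩
      algebraize [((i ≫ π).appLE U V e).hom]
      have h1 := (i ≫ π).formallyUnramified_appLE hU hV e
      have h2 := (i ≫ π).finiteType_appLE hU hV e
      have h3 : Algebra.FormallyUnramified Γ(Spec (.of O), U) Γ(D, V) := h1
      have h4 : Algebra.FiniteType Γ(Spec (.of O), U) Γ(D, V) := h2
      exact (inferInstance : Algebra.QuasiFinite Γ(Spec (.of O), U) Γ(D, V))
    let η : Spec (.of O) := (⊥ : PrimeSpectrum O)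
    refine (((i ≫ π).finite_preimage_singleton η).image i).subset ?_
    rintro P ⟨hP, hP'⟩
    rw [hi, Set.mem_compl_iff, not_not] at hP
    obtain ⟨z, rfl⟩ := hP
    refine ⟨z, ?_, rfl⟩
    rw [Set.mem_preimage, Scheme.Hom.comp_apply, Set.mem_singleton_iff]
    exact PrimeSpectrum.ext hP'
  have huniq : ∀ P, P ∉ Set.range j.f → {n | HasRamificationIndex j.f P n}.Subsingleton := by
    intro P hP
    obtain ⟨C, _, _, c, ⟨z, rfl⟩, hC⟩ := exists_smooth_chart π P
    obtain ⟨I, hI, hIz⟩ := exists_etale_quotient c i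
    have hz (z : Spec (.of C)) : c.f z ∈ Set.range j.f ↔ ¬ I ≤ z.asIdeal := by
      rw [← hIz, hi]
      rfl
    have : Algebra.IsStandardSmooth O C :=
      Algebra.IsStandardSmoothOfRelativeDimension.isStandardSmooth 1
    have : Algebra.Smooth O C := inferInstance
    have : Algebra.FiniteType O C := inferInstance
    have : IsNoetherianRing C := Algebra.FiniteType.isNoetherianRing O C
    have : Module.Flat O C := inferInstance
    let 𝔪 : Ideal C := z.asIdeal
    have h𝔪 : 𝔪.IsPrime := z.2
    have : Nontrivial C := ⟨0, 1, fun h => 𝔪.ne_top_iff_one.1 h𝔪.ne_top (h ▸ 𝔪.zero_mem)⟩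
    have hI𝔪 : I ≤ 𝔪 := by
      by_contra h
      exact hP ((hz z).2 h)
    let E := C ⧸ I
    have hker : RingHom.ker (algebraMap C E) = I := Ideal.mk_ker
    obtain ⟨ω, t, τ, b, htI, hDt, hτI, hbI, hdvd⟩ := exists_local_equation (R := O) (C := C)
      (E := E) Ideal.Quotient.mk_surjective
    rw [hker] at htI hτI hbI hdvd
    have hunit {a : C} (ha : a - 1 ∈ I) : a ∉ 𝔪 := fun h =>
      𝔪.ne_top_iff_one.1 h𝔪.ne_top (by simpa using sub_mem h (hI𝔪 ha))
    let T := Localization.AtPrime 𝔪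
    obtain ⟨⟨δ, hδ⟩, -⟩ := exists_derivation_of_local_equation 𝔪 T ω (hunit hτI) hDt
    have : IsNoetherianRing T := IsLocalization.isNoetherianRing 𝔪.primeCompl _ inferInstance
    have hTC : Module.Flat C T := IsLocalization.flat T 𝔪.primeCompl
    have : Module.Flat O T := Module.Flat.trans O C T
    have htors (s : T) (hs : p * s = 0) : s = 0 := by
      have h1 := Module.Flat.isSMulRegular_of_nonZeroDivisors (M := T)
        (mem_nonZeroDivisors_of_ne_zero hpO)
      refine h1 (?_ : (p : O) • s = (p : O) • 0)
      rw [smul_zero, Algebra.smul_def, map_natCast, hs]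
    let sT : Spec (.of T) ⟶ Spec (.of C) := Spec.map (CommRingCat.ofHom (algebraMap C T))
    have : IsPreimmersion sT := IsPreimmersion.of_isLocalization 𝔪.primeCompl
    have hs0 : sT (closedPoint T) = z := PrimeSpectrum.ext Localization.AtPrime.under_maximalIdeal
    intro m hm n hn
    have hsz : (sT ≫ c.f) (closedPoint T) = c.f z := congrArg c.f hs0
    refine eq_of_hasRamificationIndex (j := j.f) (sT ≫ c.f) (t := algebraMap C T t)
      ((IsLocalization.AtPrime.to_map_mem_maximal_iff T 𝔪 t).2 (hI𝔪 htI))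
      (mul_eq_zero_of_derivation_eq_one hO htors δ hδ) (fun y hy => ?_)
      (hsz ▸ hm) (hsz ▸ hn)
    rw [Scheme.Hom.comp_apply, hz]
    exact fun h => hy (h htI)
  refine (Set.Finite.subset (hfin.biUnion fun P hP => (huniq P hP.1).finite) ?_).bddAbove
  rintro n ⟨P, h1, h2, h3⟩
  simp only [Set.mem_iUnion]
  exact ⟨P, ⟨h1, h2⟩, h3⟩

end BoundedRamification

/-! ### Étale and smooth algebras: separability, reducedness, normality -/

section EtaleAlgebras

open TensorProduct nonZeroDivisors

/-- Over E' = R[X]/(f, f'), both a and a + ε are roots of f in the dual numbers and agree modulo ε.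
Unramifiedness forces ε = 0, hence E' = 0. -/
lemma isCoprime_derivative_of_formallyUnramified {R : Type*} [CommRing R] (f : R[X])
    [Algebra.FormallyUnramified R (R[X] ⧸ Ideal.span {f})] : IsCoprime f (derivative f) := by
  let E := R[X] ⧸ Ideal.span {f}
  let J : Ideal R[X] := Ideal.span {f, derivative f}
  let E' := R[X] ⧸ J
  let π : R[X] →ₐ[R] E' := Ideal.Quotient.mkₐ R J
  let a : E' := π X
  have haev (g : R[X]) : aeval a g = π g := by
    rw [Polynomial.aeval_algHom_apply, aeval_X_left_apply]
  have hf : π f = 0 := Ideal.Quotient.eq_zero_iff_mem.2 (Ideal.subset_span (by simp))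
  have hf' : π (derivative f) = 0 := Ideal.Quotient.eq_zero_iff_mem.2 (Ideal.subset_span (by simp))
  let T := AdjoinRoot (X ^ 2 : E'[X])
  let ε : T := AdjoinRoot.root _
  have hε : ε ^ 2 = 0 := by
    change AdjoinRoot.mk _ X ^ 2 = 0
    rw [← map_pow, AdjoinRoot.mk_self]
  let a₀ : T := algebraMap E' (T) a
  have ha₀ (g : R[X]) : aeval a₀ g = algebraMap E' (T) (π g) := by
    rw [Polynomial.aeval_algebraMap_apply, haev]
  have hz (g : R[X]) (hg : g ∈ Ideal.span {f}) (y : T) (hy : y ^ 2 = 0) :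
      aeval (a₀ + y) g = 0 := by
    obtain ⟨h, rfl⟩ := Ideal.mem_span_singleton.1 hg
    rw [map_mul, Polynomial.aeval_add_of_sq_eq_zero _ _ _ hy, ha₀, ha₀, hf, hf', map_zero,
      zero_mul, zero_add, zero_mul]
  let φ₁ : E →ₐ[R] T := Ideal.Quotient.liftₐ _ (aeval (a₀ + ε)) fun g hg =>
    hz g hg ε hε
  let φ₂ : E →ₐ[R] T := Ideal.Quotient.liftₐ _ (aeval (a₀ + 0)) fun g hg =>
    hz g hg 0 (by simp)
  have h12 : φ₁ = φ₂ := by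
    refine Algebra.FormallyUnramified.ext (Ideal.span {ε})
      ⟨2, by rw [Ideal.span_singleton_pow, hε]; simp⟩ fun x => ?_
    obtain ⟨g, rfl⟩ := Ideal.Quotient.mk_surjective x
    rw [Ideal.Quotient.mk_eq_mk_iff_sub_mem, Ideal.mem_span_singleton]
    change ε ∣ aeval (a₀ + ε) g - aeval (a₀ + 0) g
    rw [Polynomial.aeval_add_of_sq_eq_zero _ _ _ hε, add_zero, add_sub_cancel_left]
    exact dvd_mul_left _ _
  have h3 : a₀ + ε = a₀ + 0 := by
    have := AlgHom.congr_fun h12 (Ideal.Quotient.mk _ X)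
    change aeval (a₀ + ε) X = aeval (a₀ + 0) X at this
    rwa [aeval_X, aeval_X] at this
  have h4 : (1 : E') = 0 := by
    have h4 : AdjoinRoot.mk (X ^ 2 : E'[X]) X = 0 := add_left_cancel h3
    have h5 := X_pow_dvd_iff.1 (AdjoinRoot.mk_eq_zero.1 h4) 1 one_lt_two
    rwa [coeff_X_one] at h5
  have h5 : (1 : R[X]) ∈ J := Ideal.Quotient.eq_zero_iff_mem.1 h4
  obtain ⟨u, v, huv⟩ := Ideal.mem_span_pair.1 h5
  exact ⟨u, v, huv⟩

lemma isReduced_of_etale {R E : Type u} [CommRing R] [IsDomain R] [CommRing E] [Algebra R E]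
    [Algebra.Etale R E] : IsReduced E := by
  let K := FractionRing R
  have : IsReduced (K ⊗[R] E) := Algebra.FormallyUnramified.isReduced_of_field K (K ⊗[R] E)
  have : Module.Flat R E := inferInstance
  refine isReduced_of_injective (Algebra.TensorProduct.includeRight : E →ₐ[R] K ⊗[R] E) ?_
  exact Algebra.TensorProduct.includeRight_injective (IsFractionRing.injective R K)

/-- Integral closure commutes with smooth base change, so the integral closure of S in S ⊗ Frac R
comes from that of R in Frac R. Moreover S ⊗ Frac R is a domain finite over Frac R, so it is the
fraction field of S. -/
lemma isIntegrallyClosed_of_etale {R S : Type u} [CommRing R] [IsDomain R] [IsIntegrallyClosed R]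
    [CommRing S] [IsDomain S] [Algebra R S] [Algebra.Etale R S] : IsIntegrallyClosed S := by
  let F := FractionRing R
  let T := S ⊗[R] F
  have hflat : Module.Flat R S := inferInstance
  have hinj : Function.Injective (algebraMap R S) := by
    rw [injective_iff_map_eq_zero]
    intro a ha
    by_contra h0
    have h1 := Module.Flat.isSMulRegular_of_nonZeroDivisors (M := S)
      (mem_nonZeroDivisors_of_ne_zero h0)
    refine one_ne_zero (α := S) (h1 ?_)
    change a • (1 : S) = a • (0 : S)
    rw [smul_zero, Algebra.smul_def, ha, zero_mul]
  have hloc : IsLocalization (Algebra.algebraMapSubmonoid S R⁰) T := inferInstance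
  have hM : Algebra.algebraMapSubmonoid S R⁰ ≤ S⁰ := by
    rintro _ ⟨a, ha, rfl⟩
    exact mem_nonZeroDivisors_of_ne_zero
      ((map_ne_zero_iff _ hinj).2 (nonZeroDivisors.ne_zero ha))
  have : IsDomain T := IsLocalization.isDomain_of_le_nonZeroDivisors _ hM
  have hint : IsIntegralClosure R R F := inferInstance
  have hbij := TensorProduct.toIntegralClosure_bijective_of_smooth (R := R) (S := S) (B := F)
  have hfield : IsField T := by
    let e : F ⊗[R] S ≃ₐ[R] T := Algebra.TensorProduct.comm R F S
    have : Algebra.Etale F (F ⊗[R] S) := inferInstance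
    have : Module.Finite F (F ⊗[R] S) := Algebra.FormallyUnramified.finite_of_free F (F ⊗[R] S)
    have : IsDomain (F ⊗[R] S) := e.toMulEquiv.isDomain
    exact e.symm.toMulEquiv.isField
      (isField_of_isIntegral_of_isField' (Field.toIsField F))
  let := hfield.toField
  have : IsFractionRing S T := by
    refine IsLocalization.of_le (Algebra.algebraMapSubmonoid S R⁰) _ hM fun s hs => ?_
    refine IsUnit.mk0 _ ?_
    rw [map_ne_zero_iff _ (IsLocalization.injective T hM)]
    exact nonZeroDivisors.ne_zero hs
  refine (isIntegrallyClosed_iff T).2 fun {z} hz => ?_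
  obtain ⟨w, hw⟩ := hbij.2 ⟨z, hz⟩
  have hw' : Algebra.TensorProduct.map (AlgHom.id S S) (integralClosure R F).val w = z :=
    congrArg Subtype.val hw
  rw [← hw']
  clear hw hw' hz
  induction w with
  | zero => exact ⟨0, by simp⟩
  | add x y hx hy =>
    obtain ⟨a, ha⟩ := hx
    obtain ⟨b, hb⟩ := hy
    exact ⟨a + b, by rw [map_add, map_add, ha, hb]⟩
  | tmul s b =>
    obtain ⟨c, hc⟩ := IsIntegrallyClosed.isIntegral_iff.1 b.2
    refine ⟨algebraMap R S c * s, ?_⟩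
    rw [Algebra.TensorProduct.map_tmul]
    change _ = s ⊗ₜ (b : F)
    rw [← hc, Algebra.TensorProduct.algebraMap_apply, ← Algebra.smul_def,
      Algebra.algebraMap_eq_smul_one (R := R) (A := F), TensorProduct.tmul_smul,
      TensorProduct.smul_tmul']
    rfl

/-- Locally B is étale over a polynomial ring, which is integrally closed. -/
lemma isIntegrallyClosed_of_smooth {K B : Type u} [Field K] [CommRing B] [IsDomain B]
    [Algebra K B] [Algebra.Smooth K B] : IsIntegrallyClosed B := by
  refine IsIntegrallyClosed.of_localization_maximal fun P hP hPm => ?_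
  obtain ⟨f, hf, n, _, _, h⟩ := Algebra.IsSmoothAt.exists_isStandardEtale_mvPolynomial (R := K) (p := P)
  have hf0 : f ≠ 0 := fun h => hf (h ▸ P.zero_mem)
  have hM : Submonoid.powers f ≤ B⁰ := powers_le_nonZeroDivisors_of_noZeroDivisors hf0
  have : IsDomain (Localization.Away f) := IsLocalization.isDomain_of_le_nonZeroDivisors _ hM
  have : Algebra.Etale (MvPolynomial (Fin n) K) (Localization.Away f) := inferInstance
  have h1 : IsIntegrallyClosed (Localization.Away f) :=
    isIntegrallyClosed_of_etale (R := MvPolynomial (Fin n) K)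
  have hle : Submonoid.powers f ≤ P.primeCompl := Submonoid.powers_le.2 hf
  let := IsLocalization.localizationAlgebraOfSubmonoidLe (Localization.Away f)
    (Localization.AtPrime P) _ _ hle
  have : IsScalarTower B (Localization.Away f) (Localization.AtPrime P) :=
    IsLocalization.localization_isScalarTower_of_submonoid_le (Localization.Away f)
      (Localization.AtPrime P) _ _ hle
  have := IsLocalization.isLocalization_of_submonoid_le (Localization.Away f)
    (Localization.AtPrime P) _ _ hle
  refine isIntegrallyClosed_of_isLocalization (R := Localization.Away f) _
    (P.primeCompl.map (algebraMap B (Localization.Away f))) ?_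
  rintro _ ⟨a, ha, rfl⟩
  refine mem_nonZeroDivisors_of_ne_zero
    ((map_ne_zero_iff _ (IsLocalization.injective _ hM)).2 ?_)
  exact fun h => ha (h ▸ P.zero_mem)

lemma etale_adjoinRoot {R : Type u} [CommRing R] {f : R[X]} (hf : f.Monic)
    (h : IsCoprime f (derivative f)) : Algebra.Etale R (AdjoinRoot f) := by
  obtain ⟨a, b, hab⟩ := h
  let P : StandardEtalePair R := ⟨f, hf, 1, b, a, 1, by rw [pow_one, ← hab]; ring⟩
  have hu : IsUnit (AdjoinRoot.mk f (1 : R[X])) := by rw [map_one]; exact isUnit_one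
  let e := P.equivAwayAdjoinRoot
  let e' := IsLocalization.atUnit (AdjoinRoot f) (Localization.Away (AdjoinRoot.mk f 1)) _ hu
  exact Algebra.Etale.of_equiv (e.trans (e'.symm.restrictScalars R))

end EtaleAlgebras

/-! ### The discriminant -/

section Discriminant

variable {R S : Type*} [CommRing R] [CommRing S]

lemma exists_mul_add_mul_eq_discr {Q : R[X]} (hQ : Q.Monic) (hd : Q.natDegree ≠ 0) :
    ∃ a b, Q * a + derivative Q * b = C Q.discr := by
  obtain ⟨a, b, -, -, h⟩ := exists_mul_add_mul_eq_C_resultant Q (derivative Q)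
    (m := Q.natDegree) (n := Q.natDegree - 1) le_rfl (natDegree_derivative_le Q) (Or.inl hd)
  rw [resultant_deriv (natDegree_pos_iff_degree_pos.1 (Nat.pos_of_ne_zero hd)), hQ.leadingCoeff,
    mul_one, map_mul] at h
  set s : R := (-1) ^ (Q.natDegree * (Q.natDegree - 1) / 2) with hs
  have hss : s * s = 1 := by rw [hs, ← mul_pow, neg_one_mul, neg_neg, one_pow]
  refine ⟨C s * a, C s * b, ?_⟩
  have : (C s * C s : R[X]) = 1 := by rw [← C_mul, hss, C_1]
  linear_combination C s * h + C Q.discr * this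

/-- The degree of the derivative may drop below d - 1 in characteristic p; padding the resultant
only introduces powers of the leading coefficient 1 of Q. -/
lemma map_discr_ne_zero {F : Type*} [Field F] (φ : R →+* F) {Q : R[X]} (hQ : Q.Monic)
    (hd : Q.natDegree ≠ 0) (h : (Q.map φ).Separable) : φ Q.discr ≠ 0 := by
  intro h0
  have h1 := congrArg φ (resultant_deriv (natDegree_pos_iff_degree_pos.1 (Nat.pos_of_ne_zero hd)))
  rw [map_mul, h0, mul_zero, ← resultant_map_map, ← derivative_map] at h1
  have h2 := resultant_ne_zero _ _ h
  have hle : (derivative (Q.map φ)).natDegree ≤ Q.natDegree - 1 := by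
    have := natDegree_derivative_le (Q.map φ)
    rwa [hQ.natDegree_map] at this
  have h3 := resultant_add_right_deg (f := Q.map φ) (g := derivative (Q.map φ)) (m := Q.natDegree)
    (n := (derivative (Q.map φ)).natDegree) (Q.natDegree - 1 - (derivative (Q.map φ)).natDegree) le_rfl
  rw [Nat.add_sub_of_le hle, h1] at h3
  have h4 : (Q.map φ).coeff Q.natDegree = 1 := by rw [coeff_map, hQ.coeff_natDegree, map_one]
  rw [hQ.natDegree_map φ] at h2
  rw [h4, one_pow, one_mul] at h3
  exact h2 h3.symm

end Discriminant

/-! ### The squarefree part and étale closed subschemes of the line -/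

section SquarefreePart

variable {R : Type u} [CommRing R] [IsDomain R] [UniqueFactorizationMonoid R] {Δ r : R[X]}

/-- If q² divides r and q^m exactly divides g, then q^(m+2) divides Δ, so q^(m+1) divides both Δ and
Δ', hence g. -/
lemma IsSquarefreePart.squarefree (h : IsSquarefreePart Δ r) (hΔ : Δ ≠ 0) : Squarefree r := by
  obtain ⟨g, ⟨-, -, hg⟩, rfl⟩ := h
  have hg0 : g ≠ 0 := left_ne_zero_of_mul hΔ
  refine (squarefree_iff_irreducible_sq_not_dvd_of_ne_zero (right_ne_zero_of_mul hΔ)).2 ?_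
  rintro q hq ⟨s, hs⟩
  have hfin := FiniteMultiplicity.of_not_isUnit hq.not_isUnit hg0
  obtain ⟨c, hc⟩ := pow_multiplicity_dvd q g
  refine hfin.not_pow_dvd_of_multiplicity_lt (Nat.lt_succ_self _) (hg _ ?_ ?_)
  · rw [hs]
    exact ⟨q * c * s, by rw [Nat.succ_eq_add_one, pow_succ]; linear_combination (q * q * s) * hc⟩
  · have h1 : g * r = q ^ (multiplicity q g + 2) * (c * s) := by
      rw [hs]; linear_combination (q * q * s) * hc
    rw [h1, derivative_mul, derivative_pow, Nat.add_sub_cancel_right (m := 1) (n := multiplicity q g + 1)]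
    refine dvd_add ?_ ?_
    · exact ((dvd_mul_left _ _).mul_right _).mul_right _
    · exact (pow_dvd_pow q (by omega)).mul_right _

/-- If q did not divide r, the full power q^(m+1) in Δ would divide g, hence Δ', so q would divide
(m+1) q' c. Characteristic zero and degrees exclude this for nonconstant q; primitivity excludes
constant q. -/
lemma IsSquarefreePart.dvd_of_prime [CharZero R] (h : IsSquarefreePart Δ r) (hΔ : Δ.IsPrimitive)
    {q : R[X]} (hq : Prime q) (hqΔ : q ∣ Δ) : q ∣ r := by
  have hΔ0 : Δ ≠ 0 := hΔ.ne_zero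
  obtain ⟨g, ⟨-, hg', -⟩, hgr⟩ := h
  have hconst (c : R) (hc : C c ∣ Δ) : ¬ q ∣ C c := fun hqc =>
    hq.not_isUnit (isUnit_of_dvd_unit hqc (isUnit_C.2 (hΔ c hc)))
  have hdeg (c : R) (hc : c ≠ 0) : ¬ q ∣ C c := by
    intro hqc
    have h1 : q.natDegree = 0 := by
      have := natDegree_le_of_dvd hqc (C_ne_zero.2 hc)
      rwa [natDegree_C, Nat.le_zero] at this
    obtain ⟨d, rfl⟩ := natDegree_eq_zero.1 h1
    exact hconst d hqΔ dvd_rfl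
  by_contra hqr
  have hfin := FiniteMultiplicity.of_not_isUnit hq.not_isUnit hΔ0
  obtain ⟨c, hc⟩ := pow_multiplicity_dvd q Δ
  obtain ⟨m, hm⟩ : ∃ m, multiplicity q Δ = m + 1 :=
    Nat.exists_eq_succ_of_ne_zero fun h0 => by
      have := hfin.not_pow_dvd_of_multiplicity_lt (m := 1) (by omega)
      exact this (by rwa [pow_one])
  rw [hm] at hc
  have hqc : ¬ q ∣ c := by
    rintro ⟨d, rfl⟩
    refine hfin.not_pow_dvd_of_multiplicity_lt (m := m + 2) (by omega) ⟨d, ?_⟩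
    rw [hc]; ring
  have h1 : q ^ (m + 1) ∣ g := by
    refine hq.pow_dvd_of_dvd_mul_right _ hqr ?_
    rw [← hgr, hc]
    exact dvd_mul_right _ _
  have h2 := h1.trans hg'
  rw [hc, derivative_mul, derivative_pow, Nat.add_sub_cancel] at h2
  have h3 := (dvd_add_left (dvd_mul_right (q ^ (m + 1)) (derivative c))).1 h2
  have h4 : q ^ m * q ∣ q ^ m * (C ((m + 1 : ℕ) : R) * derivative q * c) := by
    rw [← pow_succ]
    convert! h3 using 1
    ring
  have h5 := (mul_dvd_mul_iff_left (pow_ne_zero m hq.ne_zero)).1 h4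
  rcases hq.dvd_or_dvd h5 with h6 | h6
  · rcases hq.dvd_or_dvd h6 with h7 | h7
    · exact hdeg _ (Nat.cast_ne_zero.2 m.succ_ne_zero) h7
    · have h8 : derivative q = 0 := by
        by_contra h8
        exact (natDegree_le_of_dvd h7 h8).not_gt (natDegree_derivative_lt
          fun h => h8 (derivative_of_natDegree_zero h))
      obtain ⟨d, rfl⟩ := natDegree_eq_zero.1 (derivative_eq_zero.1 h8)
      exact hconst d hqΔ dvd_rfl
  · exact hqc h6

lemma IsSquarefreePart.exists_dvd_pow [CharZero R] (h : IsSquarefreePart Δ r)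
    (hΔ : Δ.IsPrimitive) : ∃ n, Δ ∣ r ^ n := by
  classical
  let := UniqueFactorizationMonoid.strongNormalizationMonoid (α := R[X])
  rw [UniqueFactorizationMonoid.exists_dvd_pow_iff_radical_dvd hΔ.ne_zero]
  have hr : r ≠ 0 := by
    rintro rfl
    obtain ⟨g, -, hg⟩ := h
    exact hΔ.ne_zero (by rw [hg, mul_zero])
  rw [UniqueFactorizationMonoid.radical_dvd_iff_primeFactors_subset hr]
  intro q hq
  rw [UniqueFactorizationMonoid.mem_primeFactors] at hq ⊢
  have hqp := UniqueFactorizationMonoid.prime_of_normalized_factor q hq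
  have hqr := h.dvd_of_prime hΔ hqp (UniqueFactorizationMonoid.dvd_of_mem_normalizedFactors hq)
  rw [UniqueFactorizationMonoid.mem_normalizedFactors_iff' hr]
  exact ⟨hqp.irreducible, UniqueFactorizationMonoid.normalize_normalized_factor q hq, hqr⟩

variable {O : Type u} [CommRing O] [IsDomain O] [UniqueFactorizationMonoid O]

/-- An étale closed subscheme is reduced, so its ideal is determined by its support and is generated
by the radical of f. -/
lemma exists_squarefree_isCoprime_derivative (I : Ideal O[X]) [Algebra.Etale O (O[X] ⧸ I)]
    {f : O[X]} (hf : f ≠ 0) (hI : ∀ z : PrimeSpectrum O[X], I ≤ z.asIdeal ↔ f ∈ z.asIdeal) :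
    ∃ f₀, Squarefree f₀ ∧ f₀ ∣ f ∧ (∃ n, f ∣ f₀ ^ n) ∧ IsCoprime f₀ (derivative f₀) := by
  classical
  let := UniqueFactorizationMonoid.strongNormalizationMonoid (α := O[X])
  let f₀ := UniqueFactorizationMonoid.radical f
  have hf₀ : f₀ ∣ f := UniqueFactorizationMonoid.radical_dvd_self
  obtain ⟨n, hn⟩ := UniqueFactorizationMonoid.exists_dvd_radical_self_pow hf
  have hred : IsReduced (O[X] ⧸ I) := isReduced_of_etale (R := O)
  have hrad : I.IsRadical := (Ideal.isRadical_iff_quotient_reduced I).2 hred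
  have hspan : I = Ideal.span {f₀} := by
    have h1 : (Ideal.span {f₀}).IsRadical :=
      isRadical_iff_span_singleton.1 UniqueFactorizationMonoid.isRadical_radical
    rw [← hrad.radical, ← h1.radical, Ideal.radical_eq_sInf, Ideal.radical_eq_sInf]
    congr 1
    ext J
    refine and_congr_left fun hJ => ?_
    have hIJ := hI ⟨J, hJ⟩
    dsimp only at hIJ
    rw [hIJ, Ideal.span_singleton_le_iff_mem]
    exact ⟨fun h => hJ.mem_of_pow_mem n (J.mem_of_dvd hn h), fun h => J.mem_of_dvd hf₀ h⟩
  subst hspan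
  exact ⟨f₀, UniqueFactorizationMonoid.squarefree_radical, hf₀, ⟨n, hn⟩,
    isCoprime_derivative_of_formallyUnramified f₀⟩

lemma isCoprime_derivative_of_squarefree (I : Ideal O[X]) [Algebra.Etale O (O[X] ⧸ I)]
    {r : O[X]} (hr : Squarefree r)
    (hI : ∀ z : PrimeSpectrum O[X], I ≤ z.asIdeal ↔ r ∈ z.asIdeal) :
    IsCoprime r (derivative r) := by
  obtain ⟨f₀, -, ⟨c, rfl⟩, ⟨n, hn⟩, hc⟩ := exists_squarefree_isCoprime_derivative I hr.ne_zero hI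
  have h1 : IsUnit c := by
    have h2 : IsRelPrime c (f₀ ^ n) := (squarefree_mul_iff.1 hr).1.symm.pow_right
    exact h2 dvd_rfl ((dvd_mul_left _ _).trans hn)
  obtain ⟨u, rfl⟩ := h1
  rw [derivative_mul, mul_comm f₀ (u : O[X]), isCoprime_mul_unit_left_left u.isUnit,
    mul_comm f₀ (derivative _)]
  refine IsCoprime.add_mul_right_right ?_ _
  rwa [isCoprime_mul_unit_right_right u.isUnit]

/-- Étaleness keeps the component X = 0 disjoint from the others: with radical X h, the Bézout
relation at X = 0 makes h(0) a unit, and s divides a power of h. -/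
lemma isUnit_coeff_zero_of_etale (I : Ideal O[X]) [Algebra.Etale O (O[X] ⧸ I)]
    {s : O[X]} (hs : s.coeff 0 ≠ 0)
    (hI : ∀ z : PrimeSpectrum O[X], I ≤ z.asIdeal ↔ X * s ∈ z.asIdeal) :
    IsUnit (s.coeff 0) := by
  have hs0 : s ≠ 0 := by
    rintro rfl
    exact hs (coeff_zero 0)
  have hXs : ¬ X ∣ s := fun h => hs (X_dvd_iff.1 h)
  obtain ⟨f₀, -, -, ⟨n, hn⟩, ⟨a, b, hab⟩⟩ :=
    exists_squarefree_isCoprime_derivative I (mul_ne_zero X_ne_zero hs0) hI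
  obtain ⟨h, rfl⟩ : X ∣ f₀ := prime_X.dvd_of_dvd_pow ((dvd_mul_right X s).trans hn)
  have h0 : IsUnit (h.coeff 0) := by
    have := congrArg (coeff · 0) hab
    simp only [coeff_add, mul_coeff_zero, derivative_mul, derivative_X, one_mul, coeff_X_zero,
      zero_mul, mul_zero, zero_add, add_zero, coeff_one_zero] at this
    exact IsUnit.of_mul_eq_one_right _ this
  have h1 : s ∣ h ^ n := by
    have h2 : s ∣ X ^ n * h ^ n := by rw [← mul_pow]; exact (dvd_mul_left _ _).trans hn
    refine IsRelPrime.dvd_of_dvd_mul_left ?_ h2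
    refine IsRelPrime.pow_right ?_
    exact ((irreducible_X.isRelPrime_iff_not_dvd).2 hXs).symm
  obtain ⟨c, hc⟩ := h1
  refine isUnit_of_dvd_unit ⟨c.coeff 0, ?_⟩ (h0.pow n)
  have := congrArg (coeff · 0) hc
  simpa [mul_coeff_zero, coeff_zero_eq_eval_zero] using this

end SquarefreePart

/-! ### The projective line: what the hypothesis on 𝒱 says about r -/

noncomputable section ProjectiveLine

attribute [local instance] MvPolynomial.gradedAlgebra

variable (R : Type u) [CommRing R]

/-- Dehomogenization with respect to the coordinate `X i`. -/
def dehomogenize (i : Fin 2) : MvPolynomial (Fin 2) R →ₐ[R] R[X] :=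
  MvPolynomial.aeval fun k => if k = i then 1 else X

lemma dehomogenize_X_self (i : Fin 2) : dehomogenize R i (MvPolynomial.X i) = 1 := by
  simp [dehomogenize]

lemma dehomogenize_X_of_ne {i k : Fin 2} (h : k ≠ i) :
    dehomogenize R i (MvPolynomial.X k) = X := by
  simp [dehomogenize, h]

lemma dehomogenize_one_homogenize (r : R[X]) :
    dehomogenize R 1 (r.homogenize r.natDegree) = r := by
  conv_rhs => rw [← aeval_homogenize_X_one r le_rfl]
  rw [dehomogenize]
  congr 2
  ext k
  fin_cases k <;> simp

lemma coeff_zero_dehomogenize_zero_homogenize (r : R[X]) :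
    (dehomogenize R 0 (r.homogenize r.natDegree)).coeff 0 = r.leadingCoeff := by
  rw [homogenize, map_sum, finsetSum_coeff, Finset.sum_eq_single (r.natDegree, 0)]
  · simp [dehomogenize, MvPolynomial.aeval_monomial, Finsupp.prod_fintype, Finsupp.update]
  · rintro ⟨a, b⟩ hab hne
    have hb : b ≠ 0 := by
      rintro rfl
      simp at hab
      exact hne (by rw [hab])
    simp [dehomogenize, MvPolynomial.aeval_monomial, Finsupp.prod_fintype, Finsupp.update, hb, hb.symm]
  · simp

lemma eq_zero_of_dehomogenize_eq_zero (i : Fin 2) {n : ℕ} {a : MvPolynomial (Fin 2) R}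
    (ha : a.IsHomogeneous n) (h : dehomogenize R i a = 0) : a = 0 := by
  let σ := Equiv.swap i 1
  have h1 : (MvPolynomial.rename σ a).IsHomogeneous n := ha.rename_isHomogeneous
  have h2 : MvPolynomial.aeval ![(X : R[X]), 1] (MvPolynomial.rename σ a) = 0 := by
    rw [MvPolynomial.aeval_rename, ← h, dehomogenize]
    congr 2
    ext k
    fin_cases i <;> fin_cases k <;> simp [σ]
  have h3 := homogenize_eq_of_isHomogeneous h1 h2
  rw [homogenize_zero] at h3
  exact (MvPolynomial.rename_injective σ σ.injective) (by rw [← h3, map_zero])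

/-- The homogeneous coordinate ring of the projective line. -/
abbrev projGrading : ℕ → Submodule R (MvPolynomial (Fin 2) R) :=
  MvPolynomial.homogeneousSubmodule (Fin 2) R

lemma X_mem_projGrading (i : Fin 2) : (MvPolynomial.X i : MvPolynomial (Fin 2) R) ∈ projGrading R 1 :=
  MvPolynomial.isHomogeneous_X R i

/-- The identification of the coordinate ring of a standard chart with a polynomial ring. -/
def awayToPolynomial (i : Fin 2) :
    HomogeneousLocalization.Away (projGrading R) (MvPolynomial.X i) →+* R[X] :=
  (IsLocalization.Away.lift (S := Localization.Away (MvPolynomial.X i : MvPolynomial (Fin 2) R))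
    (g := (dehomogenize R i).toRingHom) (MvPolynomial.X i)
    (by
      have := dehomogenize_X_self R i
      exact this ▸ isUnit_one)).comp
    (algebraMap (HomogeneousLocalization.Away (projGrading R) (MvPolynomial.X i)) _)

lemma awayToPolynomial_mk (i : Fin 2) (n : ℕ) (a : MvPolynomial (Fin 2) R)
    (ha : a ∈ projGrading R (n • 1)) :
    awayToPolynomial R i (.mk (projGrading R) (X_mem_projGrading R i) n a ha) =
      dehomogenize R i a := by
  rw [awayToPolynomial, RingHom.comp_apply, HomogeneousLocalization.algebraMap_apply,
    HomogeneousLocalization.Away.val_mk, Localization.mk_eq_mk']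
  refine (IsLocalization.lift_mk'_spec _ _ _ _).2 ?_
  change dehomogenize R i a = dehomogenize R i (MvPolynomial.X i ^ n) * dehomogenize R i a
  rw [map_pow, dehomogenize_X_self, one_pow, one_mul]

lemma awayToPolynomial_algebraMap (i : Fin 2) (c : R) :
    awayToPolynomial R i (HomogeneousLocalization.fromZeroRingHom (projGrading R) _
      (algebraMap R (projGrading R 0) c)) = C c := by
  have hc : (MvPolynomial.C c : MvPolynomial (Fin 2) R) ∈ projGrading R (0 • 1) :=
    MvPolynomial.isHomogeneous_C _ c
  have h : HomogeneousLocalization.fromZeroRingHom (projGrading R) _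
      (algebraMap R (projGrading R 0) c) = HomogeneousLocalization.Away.mk (projGrading R)
        (X_mem_projGrading R i) 0 (MvPolynomial.C c) hc := by
    ext
    refine Localization.mk_eq_mk_iff.2 (Localization.r_of_eq ?_)
    change MvPolynomial.X i ^ 0 * MvPolynomial.C c = 1 * MvPolynomial.C c
    rw [pow_zero]
  rw [h, awayToPolynomial_mk]
  exact (dehomogenize R i).commutes c

lemma awayToPolynomial_bijective (i : Fin 2) : Function.Bijective (awayToPolynomial R i) := by
  constructor
  · rw [injective_iff_map_eq_zero]
    intro z hz
    obtain ⟨n, a, ha, rfl⟩ := HomogeneousLocalization.Away.mk_surjective (projGrading R)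
      (X_mem_projGrading R i) z
    rw [awayToPolynomial_mk] at hz
    obtain rfl := eq_zero_of_dehomogenize_eq_zero R i ha hz
    ext
    rw [HomogeneousLocalization.Away.val_mk, Localization.mk_zero, HomogeneousLocalization.val_zero]
  · intro q
    let k : Fin 2 := i + 1
    have hk : k ≠ i := by fin_cases i <;> simp [k]
    let κ : R →+* HomogeneousLocalization.Away (projGrading R) (MvPolynomial.X i) :=
      (HomogeneousLocalization.fromZeroRingHom (projGrading R) _).comp
        (algebraMap R (projGrading R 0))
    let x := HomogeneousLocalization.Away.mk (projGrading R) (X_mem_projGrading R i) 1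
      (MvPolynomial.X k) (X_mem_projGrading R k)
    have hx : awayToPolynomial R i x = X := by
      rw [awayToPolynomial_mk, dehomogenize_X_of_ne R hk]
    refine ⟨eval₂ κ x q, ?_⟩
    rw [hom_eval₂, hx]
    have h1 : (awayToPolynomial R i).comp κ = C := RingHom.ext (awayToPolynomial_algebraMap R i)
    rw [h1, eval₂_C_X]

/-- The standard affine charts of the projective line. -/
def ProjLine.chart (i : Fin 2) : AffineChart (ProjLine.toSpec R) R[X] where
  f := Spec.map (CommRingCat.ofHom (awayToPolynomial R i)) ≫
    Proj.awayι (projGrading R) (MvPolynomial.X i) (X_mem_projGrading R i) one_pos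
  open_f := by
    have : IsIso (CommRingCat.ofHom (awayToPolynomial R i)) :=
      (RingEquiv.ofBijective _ (awayToPolynomial_bijective R i)).toCommRingCatIso.isIso_hom
    infer_instance
  fac := by
    rw [ProjLine.toSpec, Category.assoc, Proj.awayι_toSpecZero_assoc, ← Spec.map_comp, ← Spec.map_comp]
    congr 1
    ext1
    exact RingHom.ext (awayToPolynomial_algebraMap R i)

lemma ProjLine.chart_mem_openOf (i : Fin 2) (r : R[X]) (z : Spec (.of R[X])) :
    (ProjLine.chart R i).f z ∈ ProjLine.openOf r ↔
      dehomogenize R i (MvPolynomial.X 1 * r.homogenize r.natDegree) ∉ z.asIdeal := by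
  have hg : MvPolynomial.X 1 * r.homogenize r.natDegree ∈ projGrading R (1 + r.natDegree) :=
    (MvPolynomial.isHomogeneous_X R 1).mul (isHomogeneous_homogenize r)
  have h1 : (ProjLine.chart R i).f z ∈ ProjLine.openOf r ↔
      Spec.map (CommRingCat.ofHom (awayToPolynomial R i)) z ∈
      Proj.awayι (projGrading R) (MvPolynomial.X i) (X_mem_projGrading R i) one_pos ⁻¹ᵁ
        ProjLine.openOf r := Iff.rfl
  rw [h1, ProjLine.openOf, Proj.awayι_preimage_basicOpen _ _ _ hg (by omega)]
  change awayToPolynomial R i (HomogeneousLocalization.Away.mk _ _ _ _ _) ∉ z.asIdeal ↔ _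
  rw [awayToPolynomial_mk, pow_one]

variable {R}

variable [IsDomain R] [UniqueFactorizationMonoid R]

/-- The divisor always contains ∞. In the coordinate 1/x it is X times the reversed polynomial of r,
whose constant term is the leading coefficient; roots of r cannot run into ∞ modulo p. -/
theorem isUnit_leadingCoeff_of_isSmoothDivisorComplement {r : R[X]} (hr : r ≠ 0)
    (hV : IsSmoothDivisorComplement (ProjLine.toSpec R) (ProjLine.openOf r)) :
    IsUnit r.leadingCoeff := by
  obtain ⟨D, i, hi, he, hU⟩ := hV
  obtain ⟨I, hI, hIz⟩ := exists_etale_quotient (ProjLine.chart R 0) i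
  rw [← coeff_zero_dehomogenize_zero_homogenize]
  refine isUnit_coeff_zero_of_etale I ?_ fun z => ?_
  · rwa [coeff_zero_dehomogenize_zero_homogenize, leadingCoeff_ne_zero]
  · refine (hIz z).symm.trans ?_
    rw [← not_iff_not, ← Set.mem_compl_iff, ← hU]
    refine (ProjLine.chart_mem_openOf R 0 r z).trans ?_
    rw [map_mul, dehomogenize_X_of_ne R one_ne_zero]

theorem isCoprime_derivative_of_isSmoothDivisorComplement {r : R[X]} (hr : Squarefree r)
    (hV : IsSmoothDivisorComplement (ProjLine.toSpec R) (ProjLine.openOf r)) :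
    IsCoprime r (derivative r) := by
  obtain ⟨D, i, hi, he, hU⟩ := hV
  obtain ⟨I, hI, hIz⟩ := exists_etale_quotient (ProjLine.chart R 1) i
  refine isCoprime_derivative_of_squarefree I hr fun z => ?_
  refine (hIz z).symm.trans ?_
  rw [← not_iff_not, ← Set.mem_compl_iff, ← hU]
  refine (ProjLine.chart_mem_openOf R 1 r z).trans ?_
  rw [map_mul, dehomogenize_X_self, one_mul, dehomogenize_one_homogenize]

end ProjectiveLine

/-! ### Coordinate rings: normal forms, injectivity, étaleness over the line -/

noncomputable section OpenRingStructure

variable {R : Type u} [CommRing R] (Q : R[X][X]) (r : R[X])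

namespace OpenRing

lemma algebraMap_mul_invr : algebraMap R[X] (OpenRing Q r) r * invr Q r = 1 := by
  rw [invr, IsScalarTower.algebraMap_apply R[X] (Localization.Away r) (OpenRing Q r), ← map_mul,
    IsLocalization.Away.mul_invSelf, map_one]

/-- The inclusion of the coordinate ring of the plane curve `Q = 0`. -/
def fromPlane : AdjoinRoot Q →ₐ[R[X]] OpenRing Q r :=
  AdjoinRoot.liftAlgHom Q (Algebra.ofId R[X] (OpenRing Q r)) (AdjoinRoot.root _) (by
    have h := AdjoinRoot.eval₂_root (Q.map (algebraMap R[X] (Localization.Away r)))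
    rw [eval₂_map] at h
    exact h)

lemma fromPlane_mk (f : R[X][X]) : fromPlane Q r (AdjoinRoot.mk Q f) =
    AdjoinRoot.mk _ (f.map (algebraMap R[X] (Localization.Away r))) := by
  rw [← AdjoinRoot.aeval_eq (f.map _), aeval_def, eval₂_map]
  rfl

/-- The polynomial `∑ i, w_i y^i` as an element of the coordinate ring of the plane curve. -/
def planeVec {d : ℕ} (w : Fin d → R[X]) : AdjoinRoot Q :=
  AdjoinRoot.mk Q (∑ i, C (w i) * X ^ (i : ℕ))

lemma fromPlane_planeVec {d : ℕ} (w : Fin d → R[X]) :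
    fromPlane Q r (planeVec Q w) = ofVec Q r w := by
  rw [planeVec, fromPlane_mk, ofVec, Polynomial.map_sum, map_sum]
  refine Finset.sum_congr rfl fun i _ => ?_
  rw [Polynomial.map_mul, map_C, Polynomial.map_pow, map_X, map_mul, map_pow]
  rfl

variable {Q} {d : ℕ}

lemma exists_planeVec [Nontrivial R] (hQ : Q.Monic) (hd : Q.natDegree = d) (b : AdjoinRoot Q) :
    ∃ w : Fin d → R[X], b = planeVec Q w := by
  obtain ⟨f, rfl⟩ := AdjoinRoot.mk_surjective b
  refine ⟨fun i => (f %ₘ Q).coeff i, ?_⟩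
  have h1 : AdjoinRoot.mk Q f = AdjoinRoot.mk Q (f %ₘ Q) := by
    conv_lhs => rw [← modByMonic_add_div f Q]
    rw [map_add, map_mul, AdjoinRoot.mk_self, zero_mul, add_zero]
  rw [h1, planeVec]
  congr 1
  by_cases h0 : Q = 1
  · subst h0
    rw [natDegree_one] at hd
    subst hd
    simp
  have h2 : (f %ₘ Q).natDegree < d := hd ▸ natDegree_modByMonic_lt f hQ h0
  conv_lhs => rw [as_sum_range_C_mul_X_pow' (f %ₘ Q) h2]
  exact Finset.sum_range fun i => C ((f %ₘ Q).coeff i) * X ^ i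

lemma eq_zero_of_mk_eq_zero {S : Type*} [CommRing S] {Q : S[X]} (hQ : Q.Monic)
    (hd : Q.natDegree = d) (w : Fin d → S)
    (h : AdjoinRoot.mk Q (∑ i, C (w i) * X ^ (i : ℕ)) = 0) : w = 0 := by
  nontriviality S
  have h1 := (modByMonic_eq_zero_iff_dvd hQ).2 (AdjoinRoot.mk_eq_zero.1 h)
  have hdeg : (∑ i, C (w i) * X ^ (i : ℕ)).degree < Q.degree := by
    rw [degree_eq_natDegree hQ.ne_zero, hd]
    exact degree_sum_fin_lt w
  rw [(modByMonic_eq_self_iff hQ).2 hdeg] at h1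
  funext i
  have h2 := congrArg (coeff · (i : ℕ)) h1
  simpa [finsetSum_coeff, coeff_X_pow, Fin.val_inj] using h2

lemma planeVec_injective (hQ : Q.Monic) (hd : Q.natDegree = d) :
    Function.Injective (planeVec Q : (Fin d → R[X]) → AdjoinRoot Q) := by
  intro w w' h
  refine sub_eq_zero.1 (eq_zero_of_mk_eq_zero hQ hd _ ?_)
  rw [← sub_eq_zero] at h
  rw [← h, planeVec, planeVec, ← map_sub, ← Finset.sum_sub_distrib]
  simp [sub_mul]

lemma fromPlane_injective (hQ : Q.Monic) (hr : r ∈ nonZeroDivisors R[X]) :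
    Function.Injective (fromPlane Q r) := by
  rw [injective_iff_map_eq_zero]
  intro b hb
  obtain ⟨f, rfl⟩ := AdjoinRoot.mk_surjective b
  rw [fromPlane_mk, AdjoinRoot.mk_eq_zero] at hb
  rw [AdjoinRoot.mk_eq_zero]
  exact (map_dvd_map _ (IsLocalization.injective (Localization.Away r)
    (Submonoid.powers_le.2 hr)) hQ).1 hb

lemma ofVec_injective (hQ : Q.Monic) (hd : Q.natDegree = d) (hr : r ∈ nonZeroDivisors R[X]) :
    Function.Injective (ofVec Q r : (Fin d → R[X]) → OpenRing Q r) := by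
  intro w w' h
  rw [← fromPlane_planeVec, ← fromPlane_planeVec] at h
  exact planeVec_injective hQ hd (fromPlane_injective r hQ hr h)

variable (Q) in
lemma exists_pow_mul_eq_fromPlane (a : OpenRing Q r) :
    ∃ n b, algebraMap R[X] (OpenRing Q r) r ^ n * a = fromPlane Q r b := by
  obtain ⟨f, rfl⟩ := AdjoinRoot.mk_surjective a
  induction f using Polynomial.induction_on' with
  | add f g hf hg =>
    obtain ⟨n, b, hb⟩ := hf
    obtain ⟨m, c, hc⟩ := hg
    refine ⟨n + m, algebraMap R[X] _ (r ^ m) * b + algebraMap R[X] _ (r ^ n) * c, ?_⟩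
    rw [map_add, map_add, map_mul, map_mul, AlgHom.commutes, AlgHom.commutes, ← hb, ← hc,
      map_pow, map_pow]
    ring
  | monomial k c =>
    obtain ⟨⟨g, ⟨_, n, rfl⟩⟩, hg⟩ := IsLocalization.surj (Submonoid.powers r) c
    refine ⟨n, AdjoinRoot.mk Q (monomial k g), ?_⟩
    have h1 : algebraMap R[X] (OpenRing Q r) r =
        AdjoinRoot.mk _ (C (algebraMap R[X] (Localization.Away r) r)) := rfl
    rw [fromPlane_mk, map_monomial, ← hg, h1, ← map_pow, ← map_mul, ← C_pow, C_mul_monomial,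
      map_pow, mul_comm]

lemma exists_eq_ofVec_mul_pow [Nontrivial R] (hQ : Q.Monic) (hd : Q.natDegree = d) (a : OpenRing Q r) :
    ∃ (w : Fin d → R[X]) (n : ℕ), a = ofVec Q r w * invr Q r ^ n := by
  obtain ⟨n, b, hb⟩ := exists_pow_mul_eq_fromPlane Q r a
  obtain ⟨w, rfl⟩ := exists_planeVec hQ hd b
  refine ⟨w, n, ?_⟩
  rw [← fromPlane_planeVec, ← hb, mul_right_comm, ← mul_pow, algebraMap_mul_invr, one_pow, one_mul]

variable {r}

lemma isDomain_of_irreducible_map {F : Type*} [Field F] (φ : R[X] →+* F)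
    (hφ : Function.Injective φ) (hr : r ≠ 0) (hQ : Q.Monic) (h : Irreducible (Q.map φ)) :
    IsDomain (OpenRing Q r) := by
  have hφr : IsUnit (φ r) := IsUnit.mk0 _ ((map_ne_zero_iff φ hφ).2 hr)
  let φ' : Localization.Away r →+* F := IsLocalization.Away.lift r hφr
  have hφ' : φ'.comp (algebraMap R[X] (Localization.Away r)) = φ :=
    IsLocalization.Away.lift_comp r hφr
  have hinj : Function.Injective φ' := by
    rw [injective_iff_map_eq_zero]
    intro a ha
    obtain ⟨⟨g, s⟩, hg⟩ := IsLocalization.surj (Submonoid.powers r) a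
    have h1 : φ g = 0 := by
      rw [← hφ', RingHom.comp_apply, ← hg, map_mul, ha, zero_mul]
    have h2 : g = 0 := hφ (h1.trans (map_zero φ).symm)
    dsimp only at hg
    rw [h2, map_zero] at hg
    exact (IsLocalization.map_units (Localization.Away r) s).mul_left_eq_zero.1 hg
  have hmap : (Q.map (algebraMap R[X] (Localization.Away r))).map φ' = Q.map φ := by
    rw [Polynomial.map_map, hφ']
  have : Fact (Irreducible (Q.map φ)) := ⟨h⟩
  have hdom : IsDomain (AdjoinRoot (Q.map φ)) := inferInstance
  let f : OpenRing Q r →+* AdjoinRoot (Q.map φ) := AdjoinRoot.map φ' _ _ (by rw [hmap])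
  refine Function.Injective.isDomain f ?_
  rw [injective_iff_map_eq_zero]
  intro a ha
  obtain ⟨g, rfl⟩ := AdjoinRoot.mk_surjective a
  have h1 : f (AdjoinRoot.mk _ g) = AdjoinRoot.mk _ (g.map φ') := by
    rw [← AdjoinRoot.aeval_eq (g.map φ'), aeval_def, eval₂_map]
    exact AdjoinRoot.lift_mk _ _
  rw [h1, AdjoinRoot.mk_eq_zero, ← hmap] at ha
  rw [AdjoinRoot.mk_eq_zero]
  exact (map_dvd_map φ' hinj (hQ.map _)).1 ha

lemma etale (hQ : Q.Monic) (h : ∃ n a b, Q * a + derivative Q * b = C (r ^ n)) :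
    Algebra.Etale R[X] (OpenRing Q r) := by
  have h1 : Algebra.Etale R[X] (Localization.Away r) := Algebra.Etale.of_isLocalizationAway r
  have h2 : Algebra.Etale (Localization.Away r) (OpenRing Q r) := by
    refine etale_adjoinRoot (hQ.map _) ?_
    obtain ⟨n, a, b, hab⟩ := h
    let ρ := algebraMap R[X] (Localization.Away r)
    have hu : IsUnit (C (ρ (r ^ n))) := by
      rw [isUnit_C, map_pow]
      exact (IsLocalization.Away.algebraMap_isUnit r).pow n
    obtain ⟨u, hu⟩ := hu
    refine ⟨↑u⁻¹ * a.map ρ, ↑u⁻¹ * b.map ρ, ?_⟩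
    have h3 := congrArg (Polynomial.map ρ) hab
    rw [Polynomial.map_add, Polynomial.map_mul, Polynomial.map_mul, map_C, ← hu, ← derivative_map] at h3
    calc _ = ↑u⁻¹ * (Q.map ρ * a.map ρ + derivative (Q.map ρ) * b.map ρ) := by ring
      _ = 1 := by rw [h3, Units.inv_mul]
  exact Algebra.Etale.comp R[X] (Localization.Away r) (OpenRing Q r)

end OpenRing

end OpenRingStructure

/-! ### The derivation d/dx -/

section Derivations

variable {R A : Type u} [CommRing R] [CommRing A] [Algebra R A]

lemma derivation_eq_of_kaehler {M : Type u} [AddCommGroup M] [Module R M] [Module A M]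
    [IsScalarTower R A M] {x : A} {D : Derivation R A A}
    (h : ∀ f, KaehlerDifferential.D R A f = D f • KaehlerDifferential.D R A x)
    (D' : Derivation R A M) (f : A) : D' f = D f • D' x := by
  have := congrArg D'.liftKaehlerDifferential (h f)
  simpa using this

variable [Algebra R[X] A] [IsScalarTower R R[X] A]

variable (R A) in
-- The differentials of A are the base change of those of R[X], hence free on dx.
lemma exists_derivation_of_formallyEtale [Algebra.FormallyEtale R[X] A] :
    ∃ D : Derivation R A A, D (algebraMap R[X] A X) = 1 ∧ ∀ f, KaehlerDifferential.D R A f =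
      D f • KaehlerDifferential.D R A (algebraMap R[X] A X) := by
  let e := KaehlerDifferential.tensorKaehlerEquivOfFormallyEtale R R[X] A
  let b : Module.Basis Unit R[X] Ω[R[X]⁄R] :=
    (Module.Basis.singleton Unit R[X]).map (KaehlerDifferential.polynomialEquiv R).symm
  let ω : Module.Basis Unit A Ω[A⁄R] := (b.baseChange A).map e
  have hω : ω () = KaehlerDifferential.D R A (algebraMap R[X] A X) := by
    simp [ω, b, e]
  refine ⟨(ω.coord ()).compDer (KaehlerDifferential.D R A), ?_, fun f => ?_⟩
  · change ω.coord () (KaehlerDifferential.D R A (algebraMap R[X] A X)) = 1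
    rw [← hω]
    simp
  · rw [← hω]
    have := ω.sum_repr (KaehlerDifferential.D R A f)
    simpa using this.symm

end Derivations

/-! ### Base change from O to K -/

noncomputable section BaseChange

variable {R S : Type u} [CommRing R] [CommRing S] (Q : R[X][X]) (r : R[X]) (f : R →+* S)

namespace OpenRing

lemma ofVec_zero {d : ℕ} : ofVec Q r (0 : Fin d → R[X]) = 0 :=
  Finset.sum_eq_zero fun i _ => by rw [Pi.zero_apply, map_zero, zero_mul]

lemma ofVec_add {d : ℕ} (v w : Fin d → R[X]) :
    ofVec Q r (v + w) = ofVec Q r v + ofVec Q r w := by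
  rw [ofVec, ofVec, ofVec, ← Finset.sum_add_distrib]
  exact Finset.sum_congr rfl fun i _ => by rw [Pi.add_apply, map_add, add_mul]

lemma ofVec_smul {d : ℕ} (g : R[X]) (w : Fin d → R[X]) :
    ofVec Q r (g • w) = algebraMap R[X] _ g * ofVec Q r w := by
  rw [ofVec, ofVec, Finset.mul_sum]
  exact Finset.sum_congr rfl fun i _ => by rw [Pi.smul_apply, smul_eq_mul, map_mul, mul_assoc]

/-- The map of coordinate rings induced by a homomorphism of the rings of coefficients. -/
def map : OpenRing Q r →+* OpenRing (Q.map (mapRingHom f)) (mapRingHom f r) :=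
  AdjoinRoot.lift (IsLocalization.Away.lift r
    (g := (algebraMap S[X] (OpenRing (Q.map (mapRingHom f)) (mapRingHom f r))).comp (mapRingHom f))
    (IsUnit.of_mul_eq_one _ (algebraMap_mul_invr (Q.map (mapRingHom f)) (mapRingHom f r))))
    (AdjoinRoot.root _) (by
      rw [eval₂_map, IsLocalization.Away.lift_comp, ← eval₂_map]
      have h := AdjoinRoot.eval₂_root ((Q.map (mapRingHom f)).map
        (algebraMap S[X] (Localization.Away (mapRingHom f r))))
      rw [eval₂_map] at h
      exact h)

@[simp]
lemma map_algebraMap (g : R[X]) :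
    map Q r f (algebraMap R[X] (OpenRing Q r) g) = algebraMap S[X] _ (mapRingHom f g) := by
  rw [map, IsScalarTower.algebraMap_apply R[X] (Localization.Away r) (OpenRing Q r)]
  exact (AdjoinRoot.lift_of _).trans (IsLocalization.Away.lift_eq _ _ _)

@[simp]
lemma map_root : map Q r f (AdjoinRoot.root _) = AdjoinRoot.root _ := AdjoinRoot.lift_root _

lemma map_x : map Q r f (x Q r) = x _ _ := by
  rw [x, map_algebraMap, coe_mapRingHom, map_X]
  rfl

lemma map_invr : map Q r f (invr Q r) = invr _ _ := by
  have h := algebraMap_mul_invr (Q.map (mapRingHom f)) (mapRingHom f r)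
  have hu := IsUnit.of_mul_eq_one _ h
  refine hu.mul_left_cancel ?_
  rw [h, ← map_algebraMap Q r f r, ← map_mul, algebraMap_mul_invr, map_one]

lemma map_ofVec {d : ℕ} (w : Fin d → R[X]) :
    map Q r f (ofVec Q r w) = ofVec _ _ fun i => mapRingHom f (w i) := by
  rw [ofVec, ofVec, map_sum]
  exact Finset.sum_congr rfl fun i _ => by rw [map_mul, map_pow, map_algebraMap, map_root]

variable {Q r}

lemma map_injective [Nontrivial R] [Nontrivial S] (hf : Function.Injective f) (hQ : Q.Monic)
    (hr : mapRingHom f r ∈ nonZeroDivisors S[X]) : Function.Injective (map Q r f) := by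
  rw [injective_iff_map_eq_zero]
  intro a ha
  obtain ⟨w, n, rfl⟩ := exists_eq_ofVec_mul_pow r hQ rfl a
  have hu := IsUnit.of_mul_eq_one _ ((mul_comm _ _).trans
    (algebraMap_mul_invr (Q.map (mapRingHom f)) (mapRingHom f r)))
  rw [map_mul, map_pow, map_invr, (hu.pow n).mul_left_eq_zero, map_ofVec] at ha
  have h1 := ofVec_injective (d := Q.natDegree) (mapRingHom f r) (hQ.map (mapRingHom f))
    (hQ.natDegree_map _) hr (a₁ := fun i => mapRingHom f (w i)) (a₂ := 0)
    (ha.trans (ofVec_zero _ _).symm)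
  have h2 : w = 0 := by
    funext i
    exact Polynomial.map_injective f hf ((congrFun h1 i).trans (Polynomial.map_zero f).symm)
  rw [h2, ofVec_zero, zero_mul]

end OpenRing

end BaseChange

/-! ### The plane curve over O is integrally closed -/

section Normality

lemma exists_eq_of_isIntegralElem_of_pow_mul {B A : Type*} [CommRing B] [IsDomain B]
    [IsIntegrallyClosed B] [CommRing A] (f : B →+* A) (hf : Function.Injective f) {ρ : B}
    (hρ : ρ ≠ 0) (hu : IsUnit (f ρ)) (hs : ∀ a, ∃ n b, f ρ ^ n * a = f b) {a : A}
    (ha : f.IsIntegralElem a) : ∃ b, f b = a := by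
  algebraize [f]
  have hloc : IsLocalization.Away ρ A := by
    refine ⟨⟨?_, ?_, ?_⟩⟩
    · rintro ⟨_, n, rfl⟩
      exact (map_pow f ρ n).symm ▸ hu.pow n
    · intro z
      obtain ⟨n, b, h⟩ := hs z
      exact ⟨⟨b, ⟨ρ ^ n, n, rfl⟩⟩,
        (mul_comm _ _).trans ((congrArg (· * z) (map_pow f ρ n)).trans h)⟩
    · intro x y h
      exact ⟨1, congrArg _ (hf h)⟩
  let M := FractionRing B
  have hρM : IsUnit (algebraMap B M ρ) :=
    IsUnit.mk0 _ ((map_ne_zero_iff _ (IsFractionRing.injective B M)).2 hρ)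
  let g : A →ₐ[B] M := IsLocalization.Away.liftAlgHom ρ (f := Algebra.ofId B M) hρM
  have hg : IsIntegral B (g a) := IsIntegral.map g ha
  obtain ⟨b, hb⟩ := IsIntegrallyClosed.isIntegral_iff.1 hg
  refine ⟨b, ?_⟩
  obtain ⟨n, c, h⟩ := hs a
  have h1 : algebraMap B M (ρ ^ n * b) = algebraMap B M c := by
    have h2 : g (algebraMap B A c) = algebraMap B M c := g.commutes c
    have h3 : algebraMap B A c = algebraMap B A ρ ^ n * a := h.symm
    rw [← h2, h3, map_mul, map_mul, map_pow, map_pow, AlgHom.commutes, hb]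
  have h4 := IsFractionRing.injective B M h1
  refine (hu.pow n).mul_left_cancel ?_
  rw [h, ← h4, map_mul, map_pow]

lemma isIntegralElem_of_isIntegral_range {B L : Type*} [CommRing B] [CommRing L] (f : B →+* L)
    {z : L} (h : IsIntegral f.range z) : f.IsIntegralElem z := by
  obtain ⟨P, hP, hz⟩ := h
  obtain ⟨P', h1, -, h2⟩ := lifts_and_natDegree_eq_and_monic (f := f.rangeRestrict)
    (p := P) ((Polynomial.mem_lifts _).2 (Polynomial.map_surjective _ f.rangeRestrict_surjective P)) hP
  refine ⟨P', h2, ?_⟩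
  rw [← h1, eval₂_map] at hz
  exact hz

/-- Up to a unit r is monic, and divisibility by a monic polynomial descends along injections. -/
lemma dvd_of_map_dvd_map_of_isUnit {R S : Type*} [CommRing R] [CommRing S] (f : R →+* S)
    (hf : Function.Injective f) {r w : R[X]} (hr : IsUnit r.leadingCoeff) (n : ℕ)
    (h : r.map f ^ n ∣ w.map f) : r ^ n ∣ w := by
  obtain ⟨u, hu⟩ := hr
  let r₁ := C (↑u⁻¹ : R) * r
  have h1 : r₁.Monic := by
    rw [Monic, leadingCoeff, natDegree_C_mul_of_isUnit (Units.isUnit _), coeff_C_mul,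
      coeff_natDegree, ← hu, Units.inv_mul]
  have h2 : r = C (u : R) * r₁ := by
    rw [← mul_assoc, ← C_mul, Units.mul_inv, C_1, one_mul]
  have hu1 : IsUnit (C (u : R)) := isUnit_C.2 u.isUnit
  have hu2 : IsUnit (C (f u)) := isUnit_C.2 (u.isUnit.map f)
  rw [h2, Polynomial.map_mul, map_C, mul_pow, (hu2.pow n).mul_left_dvd, ← Polynomial.map_pow] at h
  rw [h2, mul_pow, (hu1.pow n).mul_left_dvd]
  exact (map_dvd_map f hf (h1.pow n)).1 h

variable {O K : Type u} [CommRing O] [IsDomain O] [UniqueFactorizationMonoid O] [Field K]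
  (f : O →+* K) {Q : O[X][X]} {r : O[X]}

/-- The coordinate ring of the plane curve `Q = 0`, as a subring of the function field. -/
noncomputable def planeSubring (Q : O[X][X]) (r : O[X]) (L : Type*) [CommRing L]
    [Algebra (OpenRing Q r) L] : Subring L :=
  ((algebraMap (OpenRing Q r) L).comp
    (OpenRing.fromPlane Q r : AdjoinRoot Q →+* OpenRing Q r)).range

/-- An integral element lies in O[x,1/r,y]/(Q), which is étale over O[x] and so integrally closed,
and also in K[x,y]/(Q), which is integrally closed by smoothness. These two rings meet in
O[x,y]/(Q), because division by r^n stays integral when r has unit leading coefficient. -/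
theorem mem_planeSubring_of_isIntegral [IsDomain (OpenRing Q r)] (hf : Function.Injective f) (hQ : Q.Monic)
    (hr : IsUnit r.leadingCoeff) (hdiscr : ∃ n a b, Q * a + derivative Q * b = C (r ^ n))
    [IsDomain (AdjoinRoot (Q.map (mapRingHom f)))]
    [Algebra.Smooth K (AdjoinRoot (Q.map (mapRingHom f)))]
    {L : Type u} [Field L] [Algebra (OpenRing Q r) L] [IsFractionRing (OpenRing Q r) L]
    (z : L) (hz : IsIntegral (planeSubring Q r L) z) : z ∈ planeSubring Q r L := by
  have hr0 : r ≠ 0 := fun h => not_isUnit_zero (by rwa [h, leadingCoeff_zero] at hr)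
  have hA : IsIntegrallyClosed (OpenRing Q r) := by
    have := OpenRing.etale hQ hdiscr
    exact isIntegrallyClosed_of_etale (R := O[X])
  have hB : IsIntegrallyClosed (AdjoinRoot (Q.map (mapRingHom f))) :=
    isIntegrallyClosed_of_smooth (K := K)
  obtain ⟨P, hP, hPz⟩ := isIntegralElem_of_isIntegral_range _ hz
  obtain ⟨a, rfl⟩ := IsIntegrallyClosed.isIntegral_iff.1
    (⟨P.map (OpenRing.fromPlane Q r : AdjoinRoot Q →+* OpenRing Q r), hP.map _, by
      rw [eval₂_map]; exact hPz⟩ : IsIntegral (OpenRing Q r) z)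
  have hPa : eval₂ (OpenRing.fromPlane Q r : AdjoinRoot Q →+* OpenRing Q r) a P = 0 := by
    refine IsFractionRing.injective (OpenRing Q r) L ?_
    rw [hom_eval₂, map_zero]
    exact hPz
  let QK := Q.map (mapRingHom f)
  let rK := mapRingHom f r
  have hrK : rK ≠ 0 := (Polynomial.map_ne_zero_iff hf).2 hr0
  let κ : AdjoinRoot Q →+* AdjoinRoot QK := AdjoinRoot.map (mapRingHom f) Q QK dvd_rfl
  have hκ' {d : ℕ} (w : Fin d → O[X]) : κ (OpenRing.planeVec Q w) =
      OpenRing.planeVec QK fun i => mapRingHom f (w i) := by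
    have h1 (g : O[X][X]) : κ (AdjoinRoot.mk Q g) = AdjoinRoot.mk QK (g.map (mapRingHom f)) := by
      rw [← AdjoinRoot.aeval_eq (g.map _), aeval_def, eval₂_map]
      rfl
    rw [OpenRing.planeVec, h1, Polynomial.map_sum, OpenRing.planeVec]
    congr 1
    exact Finset.sum_congr rfl fun i _ => by
      rw [Polynomial.map_mul, map_C, Polynomial.map_pow, map_X]
  have hκ (b : AdjoinRoot Q) : OpenRing.map Q r f (OpenRing.fromPlane Q r b) =
      OpenRing.fromPlane QK rK (κ b) := by
    obtain ⟨w, rfl⟩ := OpenRing.exists_planeVec hQ rfl b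
    rw [hκ', OpenRing.fromPlane_planeVec, OpenRing.fromPlane_planeVec, OpenRing.map_ofVec]
  have hu : IsUnit (algebraMap K[X] (OpenRing QK rK) rK) :=
    IsUnit.of_mul_eq_one _ (OpenRing.algebraMap_mul_invr QK rK)
  have hC : (OpenRing.fromPlane QK rK : AdjoinRoot QK →+* OpenRing QK rK)
      (algebraMap K[X] (AdjoinRoot QK) rK) = algebraMap K[X] (OpenRing QK rK) rK :=
    (OpenRing.fromPlane QK rK).commutes rK
  have hinj := OpenRing.fromPlane_injective rK (hQ.map (mapRingHom f))
    (mem_nonZeroDivisors_of_ne_zero hrK)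
  have : Nontrivial (OpenRing QK rK) := hinj.nontrivial
  obtain ⟨β, hβ⟩ := exists_eq_of_isIntegralElem_of_pow_mul
    (OpenRing.fromPlane QK rK : AdjoinRoot QK →+* OpenRing QK rK)
    hinj
    (ρ := algebraMap K[X] (AdjoinRoot QK) rK)
    (fun h => hu.ne_zero (by rw [← hC, h, map_zero])) (hC.symm ▸ hu)
    (fun a => by
      obtain ⟨n, b, h⟩ := OpenRing.exists_pow_mul_eq_fromPlane QK rK a
      exact ⟨n, b, (congrArg (· ^ n * a) hC).trans h⟩)
    (a := OpenRing.map Q r f a) ⟨P.map κ, hP.map κ, by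
      rw [eval₂_map]
      have h1 := congrArg (OpenRing.map Q r f) hPa
      rw [hom_eval₂, map_zero] at h1
      convert! h1 using 2
      exact RingHom.ext fun b => (hκ b).symm⟩
  obtain ⟨v, rfl⟩ := OpenRing.exists_planeVec (d := Q.natDegree) (hQ.map _) (hQ.natDegree_map _) β
  obtain ⟨n, b, hb⟩ := OpenRing.exists_pow_mul_eq_fromPlane Q r a
  obtain ⟨w, rfl⟩ := OpenRing.exists_planeVec (d := Q.natDegree) hQ rfl b
  have hβ' : OpenRing.map Q r f a = OpenRing.ofVec QK rK v := by
    rw [← OpenRing.fromPlane_planeVec]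
    exact hβ.symm
  rw [OpenRing.fromPlane_planeVec] at hb
  have h0 : rK ^ n • v = fun i => mapRingHom f (w i) := by
    refine OpenRing.ofVec_injective rK (hQ.map (mapRingHom f)) (hQ.natDegree_map _)
      (mem_nonZeroDivisors_of_ne_zero hrK) ?_
    rw [OpenRing.ofVec_smul, ← hβ', ← OpenRing.map_ofVec, ← hb, map_mul, map_pow,
      map_pow, OpenRing.map_algebraMap]
  have h1 (i) : r.map f ^ n * v i = (w i).map f := congrFun h0 i
  choose c hc using fun i => dvd_of_map_dvd_map_of_isUnit f hf hr n ⟨_, (h1 i).symm⟩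
  have h2 : a = OpenRing.ofVec Q r c := by
    have h3 : w = r ^ n • c := funext hc
    refine ((IsUnit.of_mul_eq_one _ (OpenRing.algebraMap_mul_invr Q r)).pow n).mul_left_cancel ?_
    rw [hb, h3, OpenRing.ofVec_smul, map_pow]
  rw [h2, ← OpenRing.fromPlane_planeVec]
  exact ⟨_, rfl⟩

end Normality

/-! ### Integrality over O[r] and dominating valuation rings -/

section Integrality

lemma isIntegral_eval₂RingHom {O : Type*} [CommRing O] {r : O[X]} (hr : IsUnit r.leadingCoeff)
    (hd : r.natDegree ≠ 0) : (eval₂RingHom (C : O →+* O[X]) r).IsIntegral := by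
  set φ := eval₂RingHom (C : O →+* O[X]) r
  have hC (a : O) : φ.IsIntegralElem (C a) := by
    have : φ (C a) = C a := by simp [φ]
    exact this ▸ φ.isIntegralElem_map
  have hX : φ.IsIntegralElem X := by
    obtain ⟨u, hu⟩ := hr
    have hlc : (r.map C - C X : O[X][X]).leadingCoeff = C (u : O) := by
      rw [leadingCoeff_sub_of_degree_lt, leadingCoeff_map_of_injective C_injective, hu]
      refine degree_C_le.trans_lt ?_
      rw [degree_map_eq_of_injective C_injective]
      exact natDegree_pos_iff_degree_pos.1 (Nat.pos_of_ne_zero hd)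
    -- x is a root of r(T) - r(x), which is monic up to a unit.
    refine ⟨C (C (↑u⁻¹ : O)) * (r.map C - C X), ?_, ?_⟩
    · refine monic_C_mul_of_mul_leadingCoeff_eq_one ?_
      rw [hlc, ← C_mul, Units.inv_mul, C_1]
    · have h1 : φ.comp C = C := RingHom.ext fun a => by simp [φ]
      have h2 : φ X = r := by simp [φ]
      rw [eval₂_mul, eval₂_sub, eval₂_map, h1, eval₂_C_X, eval₂_C φ, eval₂_C φ, h2, sub_self, mul_zero]
  intro f
  induction f using Polynomial.induction_on with
  | C a => exact hC a
  | add f g hf hg => exact hf.add φ hg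
  | monomial n a h =>
    rw [pow_succ, ← mul_assoc]
    exact h.mul φ hX

/-- The field B/𝔫 is integral over O because r vanishes in it, so 𝔫 contracts to the maximal ideal
of O. Thus maximal ideals of B containing r also contain p. -/
lemma mem_of_isIntegral_of_mem {O B : Type*} [CommRing O] [IsLocalRing O] [CommRing B]
    {φ : O[X] →+* B} (hφ : φ.IsIntegral) (𝔫 : Ideal B) [𝔫.IsMaximal] (hX : φ X ∈ 𝔫) {o : O}
    (ho : o ∈ IsLocalRing.maximalIdeal O) : φ (C o) ∈ 𝔫 := by
  let q := Ideal.Quotient.mk 𝔫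
  let g : O →+* B ⧸ 𝔫 := q.comp (φ.comp C)
  have h1 : q.comp φ = g.comp (evalRingHom 0) := by
    refine Polynomial.ringHom_ext (fun a => ?_) ?_
    · simp [g]
    · simpa [g] using Ideal.Quotient.eq_zero_iff_mem.2 hX
  have h2 : (q.comp φ).IsIntegral :=
    hφ.trans _ _ (RingHom.isIntegral_of_surjective _ Ideal.Quotient.mk_surjective)
  rw [h1] at h2
  have hg : g.IsIntegral := h2.tower_top _ _
  have hmax : ((⊥ : Ideal (B ⧸ 𝔫)).comap g).IsMaximal := by
    have : (⊥ : Ideal (B ⧸ 𝔫)).IsMaximal := Ideal.bot_quotient_isMaximal_iff 𝔫 |>.2 inferInstance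
    exact Ideal.isMaximal_comap_of_isIntegral_of_isMaximal' g hg ⊥
  have h3 : o ∈ (⊥ : Ideal (B ⧸ 𝔫)).comap g := by
    rwa [IsLocalRing.eq_maximalIdeal hmax]
  exact Ideal.Quotient.eq_zero_iff_mem.1 h3

lemma isIntegral_adjoin_of_isIntegral {O L : Type*} [CommRing O] [CommRing L] [Algebra O L]
    (B : Subring L) (φ : O[X] →+* B) (hC : ∀ o, (φ (C o) : L) = algebraMap O L o)
    (hφ : φ.IsIntegral) {ρ : L} (hρ : (φ X : L) = ρ) (b : B) :
    IsIntegral (Algebra.adjoin O {ρ}) (b : L) := by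
  obtain ⟨P, hP, hPb⟩ := hφ b
  let σ : O[X] →+* Algebra.adjoin O {ρ} :=
    (aeval (⟨ρ, Algebra.subset_adjoin rfl⟩ : Algebra.adjoin O {ρ})).toRingHom
  have hσ : (algebraMap (Algebra.adjoin O {ρ}) L).comp σ = B.subtype.comp φ := by
    refine Polynomial.ringHom_ext (fun a => ?_) ?_
    · simp [σ, hC]
    · simp [σ, hρ]
  refine ⟨P.map σ, hP.map σ, ?_⟩
  rw [eval₂_map, hσ]
  have h := congrArg B.subtype hPb
  rwa [hom_eval₂, map_zero] at h

lemma exists_valuationSubring_of_isPrime {L : Type*} [Field L] (B : Subring L) (𝔫 : Ideal B)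
    [𝔫.IsPrime] : ∃ 𝒱 : ValuationSubring L, (∀ b : B, (b : L) ∈ 𝒱) ∧
      ∀ b : B, b ∈ 𝔫 ↔ 𝒱.valuation b < 1 := by
  let f : Localization.AtPrime 𝔫 →+* L := IsLocalization.lift (M := 𝔫.primeCompl)
    (g := B.subtype) fun y => isUnit_iff_ne_zero.2 fun h => y.2 (by
      have : (y : B) = 0 := Subtype.ext h
      rw [this]
      exact zero_mem _)
  have hf (b : B) : f (algebraMap B _ b) = b := IsLocalization.lift_eq _ b
  obtain ⟨𝒱, h, hloc⟩ := IsLocalRing.exists_factor_valuationRing f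
  refine ⟨𝒱, fun b => hf b ▸ h _, fun b => ?_⟩
  have : IsLocalRing 𝒱.toSubring := inferInstanceAs (IsLocalRing 𝒱)
  have h1 := ((IsLocalRing.local_hom_TFAE (f.codRestrict 𝒱.toSubring h)).out 0 4).1 hloc
  rw [← IsLocalization.AtPrime.to_map_mem_maximal_iff (Localization.AtPrime 𝔫) 𝔫 b, ← h1,
    Ideal.mem_comap]
  refine (𝒱.valuation_lt_one_iff _).trans ?_
  change 𝒱.valuation (f _) < 1 ↔ _
  rw [hf]

end Integrality

/-! ### Existence of charts at all maximal ideals containing r -/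

section Charts

open IsLocalRing

variable {O : Type u} [CommRing O] {Q : O[X][X]} {r : O[X]} {L : Type u}

section

variable [CommRing L] [Algebra (OpenRing Q r) L] [Algebra O[X] L]
  [IsScalarTower O[X] (OpenRing Q r) L]

variable (Q r L) in
lemma OpenRing.algebraMap_mem_planeSubring (f : O[X]) : algebraMap O[X] L f ∈ planeSubring Q r L := by
  refine ⟨algebraMap O[X] _ f, ?_⟩
  change algebraMap (OpenRing Q r) L (OpenRing.fromPlane Q r (algebraMap O[X] _ f)) = _
  rw [AlgHom.commutes, ← IsScalarTower.algebraMap_apply]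

variable [Algebra O L] [IsScalarTower O O[X] L]

variable (L) in
lemma OpenRing.isIntegral_planeSubring (hQ : Q.Monic)
    (hr : IsUnit r.leadingCoeff) (hd : r.natDegree ≠ 0) :
    ∃ φ : O[X] →+* planeSubring Q r L, φ.IsIntegral ∧
      (φ X : L) = algebraMap O[X] _ r ∧
      ∀ o, (φ (C o) : L) = algebraMap O _ o := by
  let e : AdjoinRoot Q →+* planeSubring Q r L :=
    ((algebraMap (OpenRing Q r) L).comp
      (OpenRing.fromPlane Q r : AdjoinRoot Q →+* OpenRing Q r)).rangeRestrict
  have he (f : O[X]) : (e (algebraMap O[X] _ f) : L) = algebraMap O[X] L f := by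
    change algebraMap (OpenRing Q r) L (OpenRing.fromPlane Q r (algebraMap O[X] _ f)) = _
    rw [AlgHom.commutes, ← IsScalarTower.algebraMap_apply]
  have := hQ.finite_adjoinRoot
  have h1 : (algebraMap O[X] (AdjoinRoot Q)).IsIntegral :=
    algebraMap_isIntegral_iff.2 inferInstance
  refine ⟨e.comp ((algebraMap O[X] (AdjoinRoot Q)).comp (eval₂RingHom C r)),
    RingHom.IsIntegral.trans _ _ (RingHom.IsIntegral.trans _ _ (isIntegral_eval₂RingHom hr hd) h1)
      (RingHom.isIntegral_of_surjective _ (RingHom.rangeRestrict_surjective _)), ?_, fun o => ?_⟩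
  · refine (he _).trans ?_
    rw [coe_eval₂RingHom, eval₂_X]
  · refine (he _).trans ?_
    rw [coe_eval₂RingHom, eval₂_C, ← algebraMap_eq, ← IsScalarTower.algebraMap_apply]

lemma derivation_algebraMap_polynomial (D : Derivation O L L) (hD : D (algebraMap O[X] L X) = 1) (f : O[X]) :
    D (algebraMap O[X] L f) = algebraMap O[X] L (derivative f) := by
  have h (g : O[X]) : algebraMap O[X] L g = aeval (algebraMap O[X] L X) g := by
    rw [aeval_algebraMap_apply, aeval_X_left_apply]
  rw [h, Derivation.map_aeval, hD, smul_eq_mul, mul_one, ← h]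

end

variable {X D : Scheme.{u}} {π : X ⟶ Spec (.of O)}

/-- A valuation ring dominating B at 𝔫 singles out a point of the divisor, and the local ring of 𝒳
there is the chart. Domination identifies its maximal ideal with 𝔫 on B. -/
theorem exists_chart_of_mem [IsDomain O] [IsDiscreteValuationRing O] [Finite (ResidueField O)]
    {p : ℕ} [Fact p.Prime] (hO : maximalIdeal O = Ideal.span {(p : O)})
    [Field L] [Algebra (OpenRing Q r) L] [IsFractionRing (OpenRing Q r) L] [Algebra O L]
    [Algebra O[X] L] [IsScalarTower O[X] (OpenRing Q r) L] [IsScalarTower O O[X] L]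
    [IsScalarTower O (OpenRing Q r) L] [IsDomain (OpenRing Q r)] (hQ : Q.Monic) (hr : IsUnit r.leadingCoeff)
    (hcop : IsCoprime r (derivative r))
    (hBc : ∀ z : L, IsIntegral (planeSubring Q r L) z → z ∈ planeSubring Q r L)
    [IsProper π] [SmoothOfRelativeDimension 1 π] (j : AffineChart π (OpenRing Q r)) (i : D ⟶ X)
    [IsClosedImmersion i] [Etale (i ≫ π)] (hi : Set.range j.f = (Set.range i)ᶜ)
    (Δ : Derivation O (L) (L))
    (hΔ : Δ (algebraMap O[X] _ Polynomial.X) = 1)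
    (hΔA : ∀ a : OpenRing Q r, ∃ a' : OpenRing Q r, Δ (algebraMap _ _ a) = algebraMap _ _ a')
    (θ : Derivation ℤ (L) (L))
    (hθ : ∀ z, θ z = algebraMap O[X] _ r * Δ z) (𝔫 : Ideal (planeSubring Q r L)) [𝔫.IsMaximal]
    {ρ : planeSubring Q r L} (hρ : (ρ : L) = algebraMap O[X] _ r)
    (hρ𝔫 : ρ ∈ 𝔫) :
    ∃ e ≤ maxFiniteRamification π j.f,
      Nonempty (Chart (planeSubring Q r L) θ p (ρ : L) 𝔫 e) := by
  let B := planeSubring Q r L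
  let ψ : OpenRing Q r →ₐ[O] L := IsScalarTower.toAlgHom O _ L
  have hψ : Function.Injective ψ := IsFractionRing.injective _ L
  have hBψ (b : L) (hb : b ∈ B) : ∃ a, ψ a = b := by
    obtain ⟨a, rfl⟩ := hb
    exact ⟨_, rfl⟩
  have hXB := OpenRing.algebraMap_mem_planeSubring Q r L
  have hinv : (ρ : L) * ψ (OpenRing.invr Q r) = 1 := by
    have := congrArg ψ (OpenRing.algebraMap_mul_invr Q r)
    rw [map_mul, map_one] at this
    rw [hρ, ← this, IsScalarTower.algebraMap_apply O[X] (OpenRing Q r) L]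
    rfl
  have hρ0 : (ρ : L) ≠ 0 := left_ne_zero_of_mul_eq_one hinv
  have hρinv : (ρ : L)⁻¹ = ψ (OpenRing.invr Q r) := inv_eq_of_mul_eq_one_right hinv
  have hd : r.natDegree ≠ 0 := by
    intro h
    obtain ⟨c, rfl⟩ := natDegree_eq_zero.1 h
    rw [leadingCoeff_C] at hr
    obtain ⟨c', hc'⟩ := hr.exists_left_inv
    refine (Ideal.ne_top_iff_one 𝔫).1 (Ideal.IsMaximal.ne_top inferInstance) ?_
    have : (1 : B) = ⟨_, hXB (C c')⟩ * ρ := Subtype.ext <| by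
      change (1 : L) = algebraMap O[X] L (C c') * ρ
      rw [hρ, ← map_mul, ← C_mul, hc', C_1, map_one]
    rw [this]
    exact Ideal.mul_mem_left _ _ hρ𝔫
  obtain ⟨φ, hφ, hφX, hφC⟩ := OpenRing.isIntegral_planeSubring (Q := Q) L hQ hr hd
  have hφρ : φ Polynomial.X = ρ := Subtype.ext (hφX.trans hρ.symm)
  have hp𝔫 : (p : B) ∈ 𝔫 := by
    have h := mem_of_isIntegral_of_mem hφ 𝔫 (hφρ ▸ hρ𝔫) (o := (p : O))
      (hO ▸ Ideal.mem_span_singleton_self _)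
    simpa using h
  obtain ⟨𝒱, h𝒱, h𝒱𝔫⟩ := exists_valuationSubring_of_isPrime B 𝔫
  have hρv : 𝒱.valuation (ρ : L) < 1 := (h𝒱𝔫 ρ).1 hρ𝔫
  obtain ⟨dc⟩ := exists_divisorialChart hO j i hi ψ hψ 𝒱 (fun o => hφC o ▸ h𝒱 _)
    (by simpa using (h𝒱𝔫 p).1 hp𝔫) ⟨OpenRing.invr Q r, fun h => by
      have h1 := congrArg 𝒱.valuation hinv
      rw [map_mul, map_one] at h1
      exact (mul_lt_one_of_lt_of_le hρv ((𝒱.valuation_le_one_iff _).2 h)).ne h1⟩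
  let S := Localization.AtPrime dc.𝔪
  have : IsNoetherianRing S := IsLocalization.isNoetherianRing dc.𝔪.primeCompl _ inferInstance
  have : Algebra.EssFiniteType dc.C S := Algebra.EssFiniteType.of_isLocalization _ dc.𝔪.primeCompl
  have : Algebra.EssFiniteType O S := Algebra.EssFiniteType.comp O dc.C S
  have ht : algebraMap dc.C S dc.t ∈ maximalIdeal S :=
    (IsLocalization.AtPrime.to_map_mem_maximal_iff S dc.𝔪 _).2 dc.t_mem
  have hpS : (p : S) ∈ maximalIdeal S := by
    rw [← map_natCast (algebraMap dc.C S)]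
    exact (IsLocalization.AtPrime.to_map_mem_maximal_iff S dc.𝔪 _).2 dc.p_mem
  obtain ⟨a, b, hab⟩ := hcop
  have hΔf := derivation_algebraMap_polynomial Δ hΔ
  obtain ⟨e, ε, he, hre, hle, hch⟩ := exists_chart_of_localRing (dc.ι : S →+* L) hO
    (fun o => dc.ι.commutes o) dc.inj dc.δ dc.δ_t dc.span_D dc.reg ht hpS Δ (dc.deriv Δ hΔA) B
    (fun o => hφC o ▸ (φ (C o)).2) (r := ρ) hρ0 ρ.2
    (fun b hb => by
      obtain ⟨a, rfl⟩ := hBψ b hb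
      exact dc.pow_mul a)
    (fun b hb => isIntegral_adjoin_of_isIntegral B φ hφC hφ (congrArg Subtype.val hφρ) ⟨b, hb⟩)
    hBc (hρinv ▸ dc.pow_mul _)
    (fun n u h => by
      have h1 := congrArg 𝒱.valuation h
      have h2 : ¬ 𝒱.valuation (dc.ι u) < 1 := fun h =>
        (dc.dom_lt u).2 h u.isUnit
      rw [map_mul] at h1
      refine h2 (lt_of_eq_of_lt h1.symm ?_)
      refine mul_lt_one_of_nonneg_of_lt_one_right ?_ zero_le hρv
      rw [← map_pow]
      exact (𝒱.valuation_le_one_iff _).2 (dc.dom _))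
    (hρ ▸ hΔf r ▸ hXB _)
    ⟨_, hXB b, _, hXB a, by
      rw [hρ, hΔf, ← map_mul, ← map_mul, ← map_add, ← map_one (algebraMap O[X] L), ← hab]
      congr 1
      ring⟩
    (hXB Polynomial.X) hΔ 𝔫 (fun b s h => by
      rw [h𝒱𝔫, dc.dom_lt]
      exact h ▸ Iff.rfl) θ (fun z => hρ ▸ hθ z)
  -- The exponent of t in r is attained as a ramification index at the generic point of t = 0, so it
  -- is at most the supremum.
  refine ⟨e, ?_, hch⟩
  obtain ⟨hm, -⟩ := frobenius_surjective_mod hO ht hpS dc.span_D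
  have ht0 : algebraMap dc.C S dc.t ≠ 0 := by
    intro h
    have h1 := dc.δ_t
    rw [h, map_zero] at h1
    exact zero_ne_one h1
  obtain ⟨ξ, hξ⟩ := hle _ (hXB Polynomial.X)
  have hξ' : dc.ι ξ = ψ (OpenRing.x Q r) :=
    hξ.trans (IsScalarTower.algebraMap_apply O[X] (OpenRing Q r) L _)
  refine le_csSup (bddAbove_hasRamificationIndex hO j i hi)
    (dc.exists_hasRamificationIndex hψ hO (prime_of_reg ht0 ht dc.reg hm) ⟨a, b, hab⟩ hξ' he ε ?_)
  refine dc.inj ?_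
  rw [← aeval_algHom_apply]
  refine Eq.trans ?_ hre
  rw [hρ]
  refine (congrArg (fun z => aeval z r) hξ).trans ?_
  rw [aeval_algebraMap_apply, aeval_X_left_apply]

end Charts

/-! ### Clearing denominators; integral functions -/

section IntegralFunctions

open IsLocalRing

lemma exists_pow_mul_eq_algebraMap {O K : Type*} [CommRing O] [IsDomain O]
    [IsDiscreteValuationRing O] [Field K] [Algebra O K] [IsFractionRing O K] {p : ℕ}
    (hO : maximalIdeal O = Ideal.span {(p : O)}) (z : K) :
    ∃ (N : ℕ) (o : O), (p : K) ^ N * z = algebraMap O K o := by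
  have hp : Irreducible (p : O) := (IsDiscreteValuationRing.irreducible_iff_uniformizer _).2 hO
  obtain ⟨a, b, hb, rfl⟩ := IsFractionRing.div_surjective (A := O) z
  have hb0 : b ≠ 0 := nonZeroDivisors.ne_zero hb
  obtain ⟨n, u, hu⟩ := IsDiscreteValuationRing.associated_pow_irreducible hb0 hp
  refine ⟨n, a * u, ?_⟩
  have h0 : algebraMap O K b ≠ 0 := (map_ne_zero_iff _ (IsFractionRing.injective O K)).2 hb0
  rw [map_mul, ← map_natCast (algebraMap O K), ← map_pow, ← hu, map_mul]
  field_simp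

lemma exists_pow_mul_eq_map {O K : Type*} [CommRing O] [IsDomain O]
    [IsDiscreteValuationRing O] [Field K] [Algebra O K] [IsFractionRing O K] {p : ℕ}
    (hO : maximalIdeal O = Ideal.span {(p : O)}) {d : ℕ} (w : Fin d → K[X]) :
    ∃ (N : ℕ) (c : Fin d → O[X]),
      (p : K[X]) ^ N • w = fun i => mapRingHom (algebraMap O K) (c i) := by
  have h1 (g : K[X]) : ∃ (N : ℕ) (c : O[X]), (p : K[X]) ^ N * g = c.map (algebraMap O K) := by
    induction g using Polynomial.induction_on' with
    | add g h hg hh =>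
      obtain ⟨n, a, ha⟩ := hg
      obtain ⟨m, b, hb⟩ := hh
      refine ⟨n + m, (p : O[X]) ^ m * a + (p : O[X]) ^ n * b, ?_⟩
      rw [Polynomial.map_add, Polynomial.map_mul, Polynomial.map_mul, ← ha, ← hb,
        Polynomial.map_pow, Polynomial.map_pow, Polynomial.map_natCast]
      ring
    | monomial n a =>
      obtain ⟨N, o, h⟩ := exists_pow_mul_eq_algebraMap (O := O) hO a
      refine ⟨N, monomial n o, ?_⟩
      rw [map_monomial, ← h, ← C_eq_natCast, ← C_pow, C_mul_monomial]
  choose n c h using fun i => h1 (w i)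
  refine ⟨∑ i, n i, fun i => (p : O[X]) ^ (∑ i, n i - n i) * c i, funext fun i => ?_⟩
  have hle : n i ≤ ∑ i, n i := Finset.single_le_sum (fun _ _ => Nat.zero_le _) (Finset.mem_univ i)
  rw [map_mul, coe_mapRingHom, ← h, Polynomial.map_pow, Polynomial.map_natCast, ← mul_assoc,
    ← pow_add, Nat.sub_add_cancel hle]
  rfl

variable {O K : Type u} [CommRing O] [Field K] (f : O →+* K) (Q : O[X][X]) (r : O[X])

/-- The polynomial functions on the plane curve `Q = 0` with coefficients in `O`, inside the ring
of functions over `K`. -/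
noncomputable def OpenRing.integralFunctions :
    Subring (OpenRing (Q.map (mapRingHom f)) (mapRingHom f r)) :=
  ((OpenRing.map Q r f).comp (OpenRing.fromPlane Q r : AdjoinRoot Q →+* OpenRing Q r)).range

variable {Q}

lemma OpenRing.mem_integralFunctions_iff [Nontrivial O] (hQ : Q.Monic)
    {z : OpenRing (Q.map (mapRingHom f)) (mapRingHom f r)} :
    z ∈ integralFunctions f Q r ↔
      ∃ w : Fin Q.natDegree → O[X], z = ofVec _ _ fun i => mapRingHom f (w i) := by
  constructor
  · rintro ⟨b, rfl⟩
    obtain ⟨w, rfl⟩ := exists_planeVec hQ rfl b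
    refine ⟨w, ?_⟩
    rw [← map_ofVec, ← fromPlane_planeVec]
    rfl
  · rintro ⟨w, rfl⟩
    refine ⟨planeVec Q w, ?_⟩
    rw [← map_ofVec, ← fromPlane_planeVec]
    rfl

lemma OpenRing.algebraMap_mem_integralFunctions (g : O[X]) :
    algebraMap K[X] _ (mapRingHom f g) ∈ integralFunctions f Q r := by
  refine ⟨algebraMap O[X] _ g, ?_⟩
  rw [← map_algebraMap]
  exact congrArg _ ((fromPlane Q r).commutes g)

end IntegralFunctions

/-! ### Transfer from the function field to A -/

section FunctionField

open IsLocalRing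

variable {O K : Type u} [CommRing O] [IsDomain O] [IsDiscreteValuationRing O]
  [Field K] [Algebra O K] [IsFractionRing O K] {p : ℕ}
  {Q : O[X][X]} {r : O[X]} {X D : Scheme.{u}} {π : X ⟶ Spec (.of O)}

lemma isFractionRing_of_map (hO : maximalIdeal O = Ideal.span {(p : O)}) (hQ : Q.Monic)
    (hr : r ≠ 0) {L : Type u} [Field L]
    [Algebra (OpenRing (Q.map (mapRingHom (algebraMap O K))) (mapRingHom (algebraMap O K) r)) L]
    [IsFractionRing (OpenRing (Q.map (mapRingHom (algebraMap O K)))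
      (mapRingHom (algebraMap O K) r)) L]
    [Algebra (OpenRing Q r) L] (h : ∀ a, algebraMap (OpenRing Q r) L a =
      algebraMap _ L (OpenRing.map Q r (algebraMap O K) a)) : IsFractionRing (OpenRing Q r) L := by
  let f := algebraMap O K
  let A' := OpenRing (Q.map (mapRingHom f)) (mapRingHom f r)
  have hrK : mapRingHom f r ∈ nonZeroDivisors K[X] := mem_nonZeroDivisors_of_ne_zero
    ((Polynomial.map_ne_zero_iff (IsFractionRing.injective O K)).2 hr)
  have hinj : Function.Injective (algebraMap (OpenRing Q r) L) := by
    intro a b hab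
    rw [h, h] at hab
    exact OpenRing.map_injective f (IsFractionRing.injective O K) hQ hrK
      (IsFractionRing.injective A' L hab)
  have hclear (a : A') : ∃ (N : ℕ) (b : OpenRing Q r), (p : L) ^ N * algebraMap A' L a =
      algebraMap _ L b := by
    obtain ⟨w, n, rfl⟩ := OpenRing.exists_eq_ofVec_mul_pow (mapRingHom f r) (hQ.map (mapRingHom f))
      rfl a
    obtain ⟨N, c, hc⟩ := exists_pow_mul_eq_map (O := O) hO w
    refine ⟨N, OpenRing.ofVec Q r c * OpenRing.invr Q r ^ n, ?_⟩
    have h1 : OpenRing.map Q r f (OpenRing.ofVec Q r c * OpenRing.invr Q r ^ n) =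
        (p : A') ^ N * (OpenRing.ofVec _ _ w * OpenRing.invr _ _ ^ n) := by
      rw [map_mul, OpenRing.map_ofVec, ← hc, OpenRing.ofVec_smul, map_pow, map_pow,
        OpenRing.map_invr, map_natCast, mul_assoc]
    rw [h]
    refine Eq.trans ?_ (congrArg (algebraMap A' L) h1).symm
    rw [map_mul _ (_ ^ N), map_pow, map_natCast]
  have hpL : (p : L) ≠ 0 := by
    have h1 : (p : K) ≠ 0 := by
      rw [← map_natCast (algebraMap O K), map_ne_zero_iff _ (IsFractionRing.injective O K)]
      intro h
      apply IsDiscreteValuationRing.not_a_field O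
      rw [hO, h, Ideal.span_singleton_eq_bot]
    rw [← map_natCast ((algebraMap A' L).comp (algebraMap K A'))]
    exact (_root_.map_ne_zero _).2 h1
  have := (faithfulSMul_iff_algebraMap_injective (OpenRing Q r) L).2 hinj
  refine IsFractionRing.of_field _ _ fun z => ?_
  obtain ⟨a, b, hb, rfl⟩ := IsFractionRing.div_surjective (A := A') z
  obtain ⟨n, a', ha⟩ := hclear a
  obtain ⟨m, b', hb'⟩ := hclear b
  refine ⟨p ^ m * a', p ^ n * b', ?_⟩
  rw [map_mul, map_mul, ← ha, ← hb', map_pow, map_pow, map_natCast]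
  have : Nontrivial A' := (algebraMap A' L).domain_nontrivial
  have : algebraMap A' L b ≠ 0 := IsFractionRing.to_map_ne_zero_of_mem_nonZeroDivisors hb
  field_simp

variable [Finite (ResidueField O)] [Fact p.Prime]

variable (K) in
-- It collects all that the reduction algorithm needs from geometry: d/dx on A, stability of B under
-- r d/dx, injectivity of the step operator up to powers of p, and the approximation of polar parts
-- modulo p.
theorem exists_derivation_of_isSmoothDivisorComplement
    (hO : maximalIdeal O = Ideal.span {(p : O)}) (hQ : Q.Monic) (hr : IsUnit r.leadingCoeff)
    (hcop : IsCoprime r (derivative r))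
    (hdiscr : ∃ n a b, Q * a + derivative Q * b = C (r ^ n))
    [IsDomain (AdjoinRoot (Q.map (mapRingHom (algebraMap O K))))]
    [Algebra.Smooth K (AdjoinRoot (Q.map (mapRingHom (algebraMap O K))))]
    [IsProper π] [SmoothOfRelativeDimension 1 π] (j : AffineChart π (OpenRing Q r)) (i : D ⟶ X)
    [IsClosedImmersion i] [Etale (i ≫ π)] (hi : Set.range j.f = (Set.range i)ᶜ) {L : Type u}
    [Field L]
    [Algebra (OpenRing (Q.map (mapRingHom (algebraMap O K))) (mapRingHom (algebraMap O K) r)) L]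
    [IsFractionRing (OpenRing (Q.map (mapRingHom (algebraMap O K)))
      (mapRingHom (algebraMap O K) r)) L] :
    let A := OpenRing (Q.map (mapRingHom (algebraMap O K))) (mapRingHom (algebraMap O K) r)
    let B := OpenRing.integralFunctions (algebraMap O K) Q r
    let ρ := algebraMap K[X] A (mapRingHom (algebraMap O K) r)
    let σ := OpenRing.invr (Q.map (mapRingHom (algebraMap O K))) (mapRingHom (algebraMap O K) r)
    ∃ Δ : Derivation K A A, Δ (OpenRing.x _ _) = 1 ∧
      (∀ g, KaehlerDifferential.D K A g = Δ g • KaehlerDifferential.D K A (OpenRing.x _ _)) ∧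
      (∀ g ∈ B, ρ * Δ g ∈ B) ∧
      (∀ m, 1 ≤ m → ∀ g ∈ B, ∀ k, ∀ b ∈ B, (p : A) ^ k * (ρ * Δ (g * σ ^ m) * ρ ^ m) = ρ * b →
        ∃ N, ∃ b' ∈ B, (p : A) ^ N * g = ρ * b') ∧
      ∀ ℓ a, Nat.log p (ℓ * maxFiniteRamification π j.f) < a → ∀ g ∈ B, ∀ w ∈ B, ∀ z ∈ B, ∀ k,
        (p : A) ^ k * (ρ * Δ (g * σ ^ ℓ) - p ^ a * (w * σ ^ ℓ)) = z →
        ∃ b ∈ B, ∃ α ∈ B, ∃ n, g * σ ^ ℓ = b + p * (α * σ ^ n) := by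
  intro A B ρ σ
  have hr0 : r ≠ 0 := fun h => not_isUnit_zero (by rwa [h, leadingCoeff_zero] at hr)
  have hf : Function.Injective (algebraMap O K) := IsFractionRing.injective O K
  let A₀ := OpenRing Q r
  let μ : A₀ →+* A := OpenRing.map Q r (algebraMap O K)
  let s : A →+* L := algebraMap A L
  have hs : Function.Injective s := IsFractionRing.injective A L
  let : Algebra A₀ L := (s.comp μ).toAlgebra
  let : Algebra O[X] L := ((algebraMap A₀ L).comp (algebraMap O[X] A₀)).toAlgebra
  let : Algebra O L := ((algebraMap A₀ L).comp (algebraMap O A₀)).toAlgebra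
  let : Algebra K[X] L := (s.comp (algebraMap K[X] A)).toAlgebra
  let : Algebra K L := (s.comp (algebraMap K A)).toAlgebra
  have : IsScalarTower O[X] A₀ L := .of_algebraMap_eq fun _ => rfl
  have : IsScalarTower O A₀ L := .of_algebraMap_eq fun _ => rfl
  have : IsScalarTower K[X] A L := .of_algebraMap_eq fun _ => rfl
  have : IsScalarTower K A L := .of_algebraMap_eq fun _ => rfl
  have : IsScalarTower O O[X] L := .of_algebraMap_eq fun o =>
    congrArg (algebraMap A₀ L) (IsScalarTower.algebraMap_apply O O[X] A₀ o)
  have : IsScalarTower K K[X] L := .of_algebraMap_eq fun o =>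
    congrArg (algebraMap A L) (IsScalarTower.algebraMap_apply K K[X] A o)
  have : IsScalarTower O K L := .of_algebraMap_eq fun o => by
    change s (μ (algebraMap O A₀ o)) = s (algebraMap K A _)
    rw [IsScalarTower.algebraMap_apply O O[X] A₀, OpenRing.map_algebraMap,
      IsScalarTower.algebraMap_apply K K[X] A]
    exact congrArg (fun g => s (algebraMap K[X] A g)) (Polynomial.map_C _)
  have : IsFractionRing A₀ L := isFractionRing_of_map (K := K) hO hQ hr0 fun _ => rfl
  have hμ : Function.Injective μ := OpenRing.map_injective _ hf hQ
    (mem_nonZeroDivisors_of_ne_zero ((Polynomial.map_ne_zero_iff hf).2 hr0))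
  have : IsDomain A₀ := (IsFractionRing.injective A₀ L).isDomain (algebraMap A₀ L)
  have : Algebra.Etale O[X] A₀ := OpenRing.etale hQ hdiscr
  have : Algebra.Etale K[X] A := by
    refine OpenRing.etale (hQ.map _) ?_
    obtain ⟨n, a, b, h⟩ := hdiscr
    refine ⟨n, a.map (mapRingHom (algebraMap O K)), b.map (mapRingHom (algebraMap O K)), ?_⟩
    rw [derivative_map, ← Polynomial.map_mul, ← Polynomial.map_mul, ← Polynomial.map_add, h, map_C,
      map_pow]
  have : Algebra.FormallyEtale A L := .of_isLocalization (nonZeroDivisors A)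
  have : Algebra.FormallyEtale K[X] L := .comp K[X] A L
  -- Three versions of d/dx, on the O-model A₀, on A and on the function field; they agree because
  -- dx generates the differentials.
  obtain ⟨Δ₀, -, hΔ₀⟩ := exists_derivation_of_formallyEtale O A₀
  obtain ⟨Δ, hΔx, hΔ⟩ := exists_derivation_of_formallyEtale K A
  obtain ⟨δ, hδx, -⟩ := exists_derivation_of_formallyEtale K L
  have hδx' : δ (s (OpenRing.x _ _)) = 1 := hδx
  let δ' : Derivation O L L := δ.restrictScalars O
  have hδ'x : δ' (algebraMap O[X] L Polynomial.X) = 1 := by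
    refine Eq.trans ?_ hδx
    change δ (s (μ (OpenRing.x Q r))) = δ (s (OpenRing.x _ _))
    rw [OpenRing.map_x]
  have hδA (a : A) : δ (s a) = s (Δ a) := by
    have := derivation_eq_of_kaehler hΔ (δ.compAlgebraMap A) a
    refine this.trans ?_
    rw [Algebra.smul_def]
    exact (congrArg (s (Δ a) * ·) hδx).trans (mul_one _)
  have hδA₀ (a : A₀) : ∃ a', δ' (algebraMap A₀ L a) = algebraMap A₀ L a' := by
    refine ⟨Δ₀ a, ?_⟩
    have := derivation_eq_of_kaehler hΔ₀ (δ'.compAlgebraMap A₀) a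
    refine this.trans ?_
    rw [Algebra.smul_def]
    exact (congrArg (algebraMap A₀ L (Δ₀ a) * ·) hδ'x).trans (mul_one _)
  let θ : Derivation ℤ L L := (algebraMap O[X] L r • δ').restrictScalars ℤ
  have hθ (z : L) : θ z = algebraMap O[X] L r * δ' z := rfl
  have hρs : s ρ = algebraMap O[X] L r := by
    change s ρ = s (μ (algebraMap O[X] A₀ r))
    rw [OpenRing.map_algebraMap]
  have hθA (a : A) : θ (s a) = s (ρ * Δ a) := by
    rw [hθ, map_mul, hρs, ← hδA]
    rfl
  have hρσ : ρ * σ = 1 := OpenRing.algebraMap_mul_invr _ _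
  have hσs : s σ = (s ρ)⁻¹ := by
    refine eq_inv_of_mul_eq_one_right ?_
    rw [← map_mul, hρσ, map_one]
  have hdiv (a : A) (n : ℕ) : s (a * σ ^ n) = s a / s ρ ^ n := by
    rw [map_mul, map_pow, hσs, inv_pow, div_eq_mul_inv]
  have hB (z : L) : z ∈ planeSubring Q r L ↔ ∃ b ∈ B, s b = z := by
    constructor
    · rintro ⟨b, rfl⟩
      exact ⟨_, ⟨b, rfl⟩, rfl⟩
    · rintro ⟨_, ⟨b, rfl⟩, rfl⟩
      exact ⟨b, rfl⟩
  have hBs (a : A) : s a ∈ planeSubring Q r L ↔ a ∈ B := by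
    rw [hB]
    exact ⟨fun ⟨b, hb, h⟩ => hs h ▸ hb, fun h => ⟨a, h, rfl⟩⟩
  let ρB : planeSubring Q r L := ⟨algebraMap O[X] L r, OpenRing.algebraMap_mem_planeSubring Q r L r⟩
  have hρB : (ρB : L) = s ρ := hρs.symm
  have hρ0 : (ρB : L) ≠ 0 := by
    rw [hρB]
    exact left_ne_zero_of_mul_eq_one (b := s σ) (by rw [← map_mul, hρσ, map_one])
  have charts (𝔫 : Ideal (planeSubring Q r L)) (h𝔫 : 𝔫.IsMaximal) (h : ρB ∈ 𝔫) :=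
    exists_chart_of_mem hO hQ hr hcop (fun z hz =>
      mem_planeSubring_of_isIntegral (algebraMap O K) hf hQ hr hdiscr z hz) j i hi δ' hδ'x hδA₀ θ hθ
      𝔫 (ρ := ρB) rfl h
  refine ⟨Δ, hΔx, hΔ, fun g hg => ?_, fun m hm g hg k b hb h => ?_,
    fun ℓ a ha g hg w hw z hz k h => ?_⟩
  · rw [← hBs, ← hθA]
    refine map_mem_of_charts (p := p) (r := ρB) (fun 𝔫 h𝔫 h => ?_) ⟨s g, (hBs g).2 hg⟩ ?_
    · obtain ⟨e, -, h⟩ := charts 𝔫 h𝔫 h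
      exact ⟨e, h⟩
    · obtain ⟨b, rfl⟩ := hg
      obtain ⟨a', ha'⟩ := hδA₀ (OpenRing.fromPlane Q r b)
      obtain ⟨n, b', hb'⟩ := OpenRing.exists_pow_mul_eq_fromPlane Q r a'
      refine ⟨n, ?_⟩
      change (ρB : L) ^ n * θ (algebraMap A₀ L (OpenRing.fromPlane Q r b)) ∈ _
      rw [hθ, ha', mul_left_comm]
      refine mul_mem ρB.2 ⟨b', ?_⟩
      refine (congrArg (algebraMap A₀ L) hb').symm.trans ?_
      rw [map_mul, map_pow]
      rfl
  · obtain ⟨N, b', h'⟩ := exists_pow_mul_mem_of_charts (r := ρB) (p := p) (θ := θ)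
      (fun 𝔫 h𝔫 h => by
        obtain ⟨e, -, h⟩ := charts 𝔫 h𝔫 h
        exact ⟨e, h⟩) hm ⟨s g, (hBs g).2 hg⟩ k ⟨s b, (hBs b).2 hb⟩ (by
        change (p : L) ^ k * (θ (s g / (ρB : L) ^ m) * (ρB : L) ^ m) = ρB * s b
        rw [hρB, ← hdiv, hθA, ← map_pow, ← map_mul, ← map_natCast s, ← map_pow, ← map_mul, h,
          map_mul])
    obtain ⟨b'', hb'', h2⟩ := (hB b').1 b'.2
    refine ⟨N, b'', hb'', hs ?_⟩
    rw [map_mul, map_mul, h2, map_pow, map_natCast, ← hρB]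
    exact h'
  · obtain ⟨b, α, n, h'⟩ := exists_eq_add_of_charts (r := ρB) (p := p) (θ := θ) ha charts hρ0
      ⟨s g, (hBs g).2 hg⟩ ⟨s w, (hBs w).2 hw⟩ ⟨s z, (hBs z).2 hz⟩ k (by
        change (p : L) ^ k * (θ (s g / (ρB : L) ^ ℓ) - p ^ a * (s w / (ρB : L) ^ ℓ)) = s z
        rw [hρB, ← hdiv, ← hdiv, hθA, ← h, map_mul s (_ ^ k), map_sub, map_mul s (_ ^ a), map_pow,
          map_pow, map_natCast])
    obtain ⟨b₁, hb₁, h₁⟩ := (hB b).1 b.2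
    obtain ⟨α₁, hα₁, h₂⟩ := (hB α).1 α.2
    refine ⟨b₁, hb₁, α₁, hα₁, n, hs ?_⟩
    rw [hdiv, map_add, map_mul s (p : A), hdiv, h₁, h₂, map_natCast, ← hρB]
    exact h'

end FunctionField

/-! ### Reduction steps as equations for d/dx -/

section Reduction

namespace OpenRing

section

variable {R : Type u} [CommRing R] {Q : R[X][X]} {r : R[X]}
  (Δ : Derivation R (OpenRing Q r) (OpenRing Q r))

lemma mul_pow_mul_invr_pow (n : ℕ) : algebraMap R[X] (OpenRing Q r) r ^ n * invr Q r ^ n = 1 := by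
  rw [← mul_pow, algebraMap_mul_invr, one_pow]

lemma derivation_mul_invr_pow (g : OpenRing Q r) (m : ℕ) :
    algebraMap R[X] _ r * Δ (g * invr Q r ^ m) * algebraMap R[X] _ r ^ m =
      algebraMap R[X] _ r * Δ g - m * Δ (algebraMap R[X] _ r) * g := by
  set ρ := algebraMap R[X] (OpenRing Q r) r
  set σ := invr Q r
  have h1 : ρ ^ m * σ ^ m = 1 := mul_pow_mul_invr_pow m
  have h2 : g = g * σ ^ m * ρ ^ m := by rw [mul_assoc, mul_comm (σ ^ m), h1, mul_one]
  have h3 : ρ * Δ g = ρ * Δ (g * σ ^ m) * ρ ^ m + m * Δ ρ * g := by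
    conv_lhs => rw [h2, Derivation.leibniz, Derivation.leibniz_pow]
    simp only [smul_eq_mul, nsmul_eq_mul]
    rcases m with _ | m
    · simp
    · rw [Nat.add_sub_cancel]
      push_cast
      linear_combination (m + 1 : OpenRing Q r) * g * Δ ρ * h1
  rw [h3, add_sub_cancel_right]

variable {Δ}

lemma form_eq_add_iff (hx : Δ (x Q r) = 1)
    (hΔ : ∀ g, KaehlerDifferential.D R _ g = Δ g • KaehlerDifferential.D R _ (x Q r)) {d : ℕ}
    (w v w' : Fin d → R[X]) (m : ℕ) :
    form Q r (m + 1) w =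
        KaehlerDifferential.D R _ (ofVec Q r v * invr Q r ^ (m + 1)) + form Q r m w' ↔
      ofVec Q r w * invr Q r ^ (m + 1) =
        algebraMap R[X] _ r * Δ (ofVec Q r v * invr Q r ^ (m + 1)) + ofVec Q r w' * invr Q r ^ m := by
  have hu := algebraMap_mul_invr Q r
  constructor
  · intro h
    have h1 := congrArg Δ.liftKaehlerDifferential h
    rw [map_add, form, form, map_smul, map_smul, Derivation.liftKaehlerDifferential_comp_D,
      Derivation.liftKaehlerDifferential_comp_D, hx, smul_eq_mul, smul_eq_mul, mul_one, mul_one] at h1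
    linear_combination algebraMap R[X] _ r * h1 + (ofVec Q r w' * invr Q r ^ m -
      ofVec Q r w * invr Q r ^ (m + 1)) * hu
  · intro h
    rw [form, form, hΔ (ofVec Q r v * _), ← add_smul]
    congr 1
    linear_combination invr Q r * h + Δ (ofVec Q r v * invr Q r ^ (m + 1)) * hu

end

variable {K : Type u} [Field K] {Q : K[X][X]} {r : K[X]}
  {Δ : Derivation K (OpenRing Q r) (OpenRing Q r)}

/-- The exact terms add up: V = v + rV' raises the degree bound by deg r at each level. -/
lemma exists_degree_lt_of_finiteReduction (hr : r ≠ 0) (hx : Δ (x Q r) = 1)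
    (hΔ : ∀ g, KaehlerDifferential.D K _ g = Δ g • KaehlerDifferential.D K _ (x Q r)) {d ℓ : ℕ}
    {w u : Fin d → K[X]} (h : FiniteReduction Q r ℓ w u) :
    ∃ V : Fin d → K[X], (∀ i, (V i).degree < ((ℓ * r.natDegree : ℕ) : WithBot ℕ)) ∧
      ofVec Q r w * invr Q r ^ ℓ =
        algebraMap K[X] _ r * Δ (ofVec Q r V * invr Q r ^ ℓ) + ofVec Q r u := by
  induction h with
  | done u => exact ⟨0, fun i => by simp, by simp [ofVec_zero]⟩
  | step ℓ w v w' u hv h hu ih =>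
    obtain ⟨V, hV, hVu⟩ := ih
    refine ⟨v + r • V, fun i => ?_, ?_⟩
    · refine (degree_add_le _ _).trans_lt (max_lt ?_ ?_)
      · refine (hv i).trans_le ?_
        rw [degree_eq_natDegree hr, Nat.cast_le]
        exact Nat.le_mul_of_pos_left _ ℓ.succ_pos
      · change (r * V i).degree < _
        rw [degree_mul, degree_eq_natDegree hr, add_mul, one_mul,
          add_comm (ℓ * _), Nat.cast_add]
        exact WithBot.add_lt_add_left (WithBot.natCast_ne_bot _) (hV i)
    · rw [(form_eq_add_iff hx hΔ w v w' ℓ).1 h, hVu, ← add_assoc, ← mul_add, ← map_add]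
      congr 3
      rw [ofVec_add, ofVec_smul, pow_succ']
      linear_combination -(ofVec Q r V * invr Q r ^ ℓ) * algebraMap_mul_invr Q r

/-- Polynomial vectors modulo r are represented by those of degree < deg r. T maps this
finite-dimensional space injectively into that quotient, so by equality of dimensions it is onto. -/
lemma exists_eq_sub_mul (hr : r ≠ 0) {d : ℕ}
    (T : OpenRing Q r →ₗ[K] OpenRing Q r)
    (hT : ∀ v : Fin d → K[X], ∃ v' : Fin d → K[X], T (ofVec Q r v) = ofVec Q r v')
    (hTr : ∀ v b : Fin d → K[X], (∀ i, (v i).degree < r.degree) →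
      T (ofVec Q r v) = algebraMap K[X] _ r * ofVec Q r b → v = 0)
    (hinj : ∀ v b : Fin d → K[X], (∀ i, (v i).degree < r.degree) →
      ofVec Q r v = algebraMap K[X] _ r * ofVec Q r b → v = 0)
    (w : Fin d → K[X]) : ∃ v w' : Fin d → K[X], (∀ i, (v i).degree < r.degree) ∧
      T (ofVec Q r v) = ofVec Q r w - algebraMap K[X] _ r * ofVec Q r w' := by
  let n := r.natDegree
  have hn : r.degree = n := degree_eq_natDegree hr
  let φ₀ : (Fin d → K[X]) →ₗ[K] OpenRing Q r :=
    { toFun := ofVec Q r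
      map_add' := ofVec_add Q r
      map_smul' := fun c v => by
        have h1 : c • v = (C c : K[X]) • v := funext fun i => by
          rw [Pi.smul_apply, Pi.smul_apply, smul_eq_mul, smul_eq_C_mul]
        rw [h1, ofVec_smul, RingHom.id_apply, Algebra.smul_def,
          IsScalarTower.algebraMap_apply K K[X] (OpenRing Q r)]
        rfl }
  let E := Fin d → degreeLT K n
  let ε : E →ₗ[K] (Fin d → K[X]) := (degreeLT K n).subtype.compLeft (Fin d)
  have hε (v : E) (i : Fin d) : (ε v i).degree < r.degree := hn ▸ mem_degreeLT.1 (v i).2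
  have hεinj : Function.Injective ε := fun v v' h => funext fun i => Subtype.ext (congrFun h i)
  have : Module.Finite K (degreeLT K n) := Module.Finite.equiv (degreeLTEquiv K n).symm
  let ρ := algebraMap K[X] (OpenRing Q r) r
  let N : Submodule K (OpenRing Q r) := LinearMap.range (LinearMap.mulLeft K ρ ∘ₗ φ₀)
  have hN (z : OpenRing Q r) : z ∈ N ↔ ∃ b, ρ * ofVec Q r b = z := Iff.rfl
  let φ : E →ₗ[K] (OpenRing Q r) ⧸ N := N.mkQ ∘ₗ φ₀ ∘ₗ ε
  let τ : E →ₗ[K] (OpenRing Q r) ⧸ N := N.mkQ ∘ₗ T ∘ₗ φ₀ ∘ₗ ε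
  have hφi : Function.Injective φ := by
    rw [injective_iff_map_eq_zero]
    intro v hv
    obtain ⟨b, hb⟩ := (hN _).1 ((Submodule.Quotient.mk_eq_zero N).1 hv)
    exact hεinj ((hinj _ b (hε v) hb.symm).trans (map_zero ε).symm)
  have hτi : Function.Injective τ := by
    rw [injective_iff_map_eq_zero]
    intro v hv
    obtain ⟨b, hb⟩ := (hN _).1 ((Submodule.Quotient.mk_eq_zero N).1 hv)
    exact hεinj ((hTr _ b (hε v) hb.symm).trans (map_zero ε).symm)
  have hmem (v : Fin d → K[X]) : N.mkQ (ofVec Q r v) ∈ LinearMap.range φ := by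
    refine ⟨fun i => ⟨v i % r, mem_degreeLT.2 (hn ▸ degree_mod_lt _ hr)⟩, ?_⟩
    refine (Submodule.Quotient.eq N).2 ((hN _).2 ⟨fun i => -(v i / r), ?_⟩)
    change _ = ofVec Q r (fun i => v i % r) - ofVec Q r v
    rw [eq_sub_iff_add_eq, ← ofVec_smul, ← ofVec_add]
    congr 1
    funext i
    have := EuclideanDomain.div_add_mod (v i) r
    change r * -(v i / r) + v i = v i % r
    linear_combination -this
  have hle : LinearMap.range τ ≤ LinearMap.range φ := by
    rintro _ ⟨v, rfl⟩
    obtain ⟨v', hv'⟩ := hT (ε v)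
    change N.mkQ (T (ofVec Q r (ε v))) ∈ _
    rw [hv']
    exact hmem v'
  have heq := Submodule.eq_of_le_of_finrank_eq hle (by
    rw [LinearMap.finrank_range_of_inj hφi, LinearMap.finrank_range_of_inj hτi])
  obtain ⟨v, hv⟩ := heq.symm ▸ hmem w
  obtain ⟨b, hb⟩ := (hN _).1 ((Submodule.Quotient.eq N).1 hv)
  refine ⟨ε v, -b, hε v, ?_⟩
  have h1 : ofVec Q r (-b) = -ofVec Q r b := map_neg φ₀ b
  have h2 : ρ * ofVec Q r b = T (ofVec Q r (ε v)) - ofVec Q r w := hb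
  rw [h1]
  linear_combination -h2

end OpenRing

end Reduction

/-! ### Existence of reductions and the bound on denominators -/

section FiniteReduction

open IsLocalRing OpenRing

variable {O K : Type u} [CommRing O] [IsDomain O] [IsDiscreteValuationRing O] [Field K]
  [Algebra O K] [IsFractionRing O K] {p : ℕ} {r : O[X]} {QK : K[X][X]} {rK : K[X]}
  {Δ : Derivation K (OpenRing QK rK) (OpenRing QK rK)} {d : ℕ} {B : Subring (OpenRing QK rK)}

lemma natCast_ne_zero_of_maximalIdeal (hO : maximalIdeal O = Ideal.span {(p : O)}) :
    (p : K) ≠ 0 := by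
  rw [← map_natCast (algebraMap O K), map_ne_zero_iff _ (IsFractionRing.injective O K)]
  intro h
  apply IsDiscreteValuationRing.not_a_field O
  rw [hO, h, Ideal.span_singleton_eq_bot]

lemma ofVec_pow_natCast_smul {R : Type u} [CommRing R] (Q : R[X][X]) (r : R[X]) (N : ℕ)
    (w : Fin d → R[X]) : ofVec Q r ((p : R[X]) ^ N • w) = (p : OpenRing Q r) ^ N * ofVec Q r w := by
  rw [ofVec_smul, map_pow, map_natCast]

lemma exists_eq_pow_natCast_smul (hO : maximalIdeal O = Ideal.span {(p : O)}) (N : ℕ)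
    (w : Fin d → K[X]) : ∃ v : Fin d → K[X], w = (p : K[X]) ^ N • v := by
  refine ⟨(C ((p : K)⁻¹ ^ N) : K[X]) • w, ?_⟩
  have h1 : (p : K[X]) ^ N * C ((p : K)⁻¹ ^ N) = 1 := by
    rw [← C_eq_natCast, ← C_pow, ← C_mul, ← mul_pow,
      mul_inv_cancel₀ (natCast_ne_zero_of_maximalIdeal hO), one_pow, C_1]
  rw [← mul_smul, h1, one_smul]

/-- Modulo p, r^ℓ divides c; the degree of r is preserved because its leading coefficient is a unit,
so the degree bound forces c ≡ 0. -/
lemma natCast_dvd_of_pow_mul_eq {O : Type*} [CommRing O] [IsLocalRing O] {p : ℕ}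
    (hO : maximalIdeal O = Ideal.span {(p : O)}) {r c b α : O[X]} (hr : IsUnit r.leadingCoeff)
    {n ℓ : ℕ} (h : r ^ n * c = r ^ (n + ℓ) * b + (p : O[X]) * r ^ ℓ * α)
    (hc : c.degree < ((ℓ * r.natDegree : ℕ) : WithBot ℕ)) : (p : O[X]) ∣ c := by
  let q := residue O
  have h2 := congrArg (Polynomial.map q) h
  have hpq : q (p : O) = 0 := (residue_eq_zero_iff _).2 (hO ▸ Ideal.mem_span_singleton_self _)
  have hrq : r.map q ≠ 0 := fun h => by
    have := congrArg (coeff · r.natDegree) h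
    rw [coeff_map, coeff_zero, coeff_natDegree] at this
    exact (hr.map q).ne_zero this
  have hrd : (r.map q).natDegree = r.natDegree :=
    natDegree_map_of_leadingCoeff_ne_zero q (hr.map q).ne_zero
  have h3 : (r.map q) ^ n * c.map q = (r.map q) ^ n * ((r.map q) ^ ℓ * b.map q) := by
    simp only [Polynomial.map_mul, Polynomial.map_add, Polynomial.map_pow,
      Polynomial.map_natCast] at h2
    rw [h2, ← C_eq_natCast, ← map_natCast q, hpq, C_0]
    ring
  have h4 := mul_left_cancel₀ (pow_ne_zero n hrq) h3
  have h5 : c.map q = 0 := by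
    refine eq_zero_of_dvd_of_degree_lt (Dvd.intro _ h4.symm) ?_
    rw [degree_pow, degree_eq_natDegree hrq, hrd, nsmul_eq_mul, ← Nat.cast_mul]
    exact degree_map_le.trans_lt hc
  rw [← C_eq_natCast, C_dvd_iff_dvd_coeff]
  intro m
  rw [← Ideal.mem_span_singleton, ← hO, ← residue_eq_zero_iff]
  have := congrArg (coeff · m) h5
  rwa [coeff_map, coeff_zero] at this

theorem exists_finiteReduction (hO : maximalIdeal O = Ideal.span {(p : O)}) (hQ : QK.Monic)
    (hd : QK.natDegree = d) (hr : rK ≠ 0) (hx : Δ (x QK rK) = 1)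
    (hΔ : ∀ g, KaehlerDifferential.D K _ g = Δ g • KaehlerDifferential.D K _ (x QK rK))
    (hmem : ∀ z, z ∈ B ↔ ∃ w : Fin d → O[X],
      z = ofVec QK rK fun i => mapRingHom (algebraMap O K) (w i))
    (hB : ∀ g ∈ B, algebraMap K[X] _ rK * Δ g ∈ B)
    (hinj : ∀ m, 1 ≤ m → ∀ g ∈ B, ∀ k, ∀ b ∈ B, (p : OpenRing QK rK) ^ k *
        (algebraMap K[X] _ rK * Δ (g * invr QK rK ^ m) * algebraMap K[X] _ rK ^ m) =
        algebraMap K[X] _ rK * b →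
      ∃ N, ∃ b' ∈ B, (p : OpenRing QK rK) ^ N * g = algebraMap K[X] _ rK * b')
    (ℓ : ℕ) (w : Fin d → K[X]) : ∃ u, FiniteReduction QK rK ℓ w u := by
  let A := OpenRing QK rK
  set ρ := algebraMap K[X] (OpenRing QK rK) rK with hρ
  set σ := invr QK rK
  have hp : (p : K) ≠ 0 := natCast_ne_zero_of_maximalIdeal hO
  have hpA (N : ℕ) : IsUnit ((p : A) ^ N) := by
    rw [← map_natCast (algebraMap K A), ← map_pow]
    exact (IsUnit.mk0 _ (pow_ne_zero N hp)).map _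
  have hvec {v v' : Fin d → K[X]} (h : ofVec QK rK v = ofVec QK rK v') : v = v' :=
    ofVec_injective rK hQ hd (mem_nonZeroDivisors_of_ne_zero hr) h
  have hzero {N : ℕ} {v b : Fin d → K[X]} (hv : ∀ i, (v i).degree < rK.degree)
      (h : (p : A) ^ N * ofVec QK rK v = ρ * ofVec QK rK b) : v = 0 := by
    rw [← ofVec_pow_natCast_smul, ← ofVec_smul] at h
    funext i
    have h1 : (p : K[X]) ^ N * v i = rK * b i := congrFun (hvec h) i
    have h2 : IsUnit ((p : K[X]) ^ N) := by
      rw [← C_eq_natCast]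
      exact (isUnit_C.2 (IsUnit.mk0 _ hp)).pow N
    exact eq_zero_of_dvd_of_degree_lt (h2.dvd_mul_left.1 (Dvd.intro _ h1.symm)) (hv i)
  induction ℓ generalizing w with
  | zero => exact ⟨w, .done w⟩
  | succ ℓ ih =>
    -- T is the step operator with the denominator r^(ℓ+1) cleared, namely g ↦ rΔ(g) - (ℓ+1) r' g;
    -- it preserves polynomial functions.
    let T : A →ₗ[K] A := LinearMap.mulRight K (ρ ^ (ℓ + 1)) ∘ₗ LinearMap.mulLeft K ρ ∘ₗ
      (Δ : A →ₗ[K] A) ∘ₗ LinearMap.mulRight K (σ ^ (ℓ + 1))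
    have hT (g : A) : T g = ρ * Δ (g * σ ^ (ℓ + 1)) * ρ ^ (ℓ + 1) := rfl
    have hTmul (N : ℕ) (g : A) : T ((p : A) ^ N * g) = (p : A) ^ N * T g := by
      have h1 (z : A) : (p : A) ^ N * z = ((p : K) ^ N) • z := by
        rw [Algebra.smul_def, map_pow, map_natCast]
      rw [h1, map_smul, h1]
    have hΔρ : Δ ρ = algebraMap K[X] A (derivative rK) :=
      derivation_algebraMap_polynomial (L := OpenRing QK rK) Δ hx rK
    have hT₁ (v : Fin d → K[X]) : ∃ v' : Fin d → K[X], T (ofVec QK rK v) = ofVec QK rK v' := by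
      obtain ⟨N, c, hc⟩ := exists_pow_mul_eq_map (O := O) hO v
      obtain ⟨c', hc'⟩ := (hmem _).1
        (hB _ ((hmem _).2 ⟨c, rfl⟩))
      obtain ⟨v', hv'⟩ := exists_eq_pow_natCast_smul (O := O) hO N fun i => mapRingHom (algebraMap O K) (c' i)
      refine ⟨v' - ((ℓ + 1 : K[X]) * derivative rK) • v, (hpA N).mul_left_cancel ?_⟩
      rw [← hTmul, ← ofVec_pow_natCast_smul, hc, hT, derivation_mul_invr_pow, hc', hv',
        ← hc, hΔρ, ofVec_pow_natCast_smul, ofVec_pow_natCast_smul, sub_eq_add_neg v', ← neg_smul,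
        ofVec_add, ofVec_smul, map_neg, map_mul, map_add, map_natCast, map_one]
      push_cast
      ring
    have hT₂ (v b : Fin d → K[X]) (hv : ∀ i, (v i).degree < rK.degree)
        (h : T (ofVec QK rK v) = ρ * ofVec QK rK b) : v = 0 := by
      obtain ⟨N, c, hc⟩ := exists_pow_mul_eq_map (O := O) hO v
      obtain ⟨k, b', hb'⟩ := exists_pow_mul_eq_map (O := O) hO ((p : K[X]) ^ N • b)
      obtain ⟨M, b'', hb'', h2⟩ := hinj (ℓ + 1) (Nat.le_add_left _ _) _
        ((hmem _).2 ⟨c, rfl⟩) k _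
        ((hmem _).2 ⟨b', rfl⟩) (by
          rw [← hc, ← hb', ← hT, ofVec_pow_natCast_smul, hTmul, h, ofVec_pow_natCast_smul,
            ofVec_pow_natCast_smul]
          ring)
      obtain ⟨e, rfl⟩ := (hmem _).1 hb''
      rw [← hc, ofVec_pow_natCast_smul, ← mul_assoc, ← pow_add] at h2
      exact hzero hv h2
    obtain ⟨v, w', hv, hvw⟩ := exists_eq_sub_mul hr T hT₁ hT₂
      (fun v b hv h => hzero (N := 0) hv (by rwa [pow_zero, one_mul])) w
    obtain ⟨u, hu⟩ := ih w'
    refine ⟨u, .step ℓ w v w' u hv ((form_eq_add_iff hx hΔ w v w' ℓ).2 ?_) hu⟩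
    have h1 : ρ ^ (ℓ + 1) * σ ^ (ℓ + 1) = 1 := mul_pow_mul_invr_pow (ℓ + 1)
    have h2 : ρ * σ = 1 := algebraMap_mul_invr QK rK
    rw [hT] at hvw
    linear_combination -σ ^ (ℓ + 1) * hvw + ρ * Δ (ofVec QK rK v * σ ^ (ℓ + 1)) * h1 +
      ofVec QK rK w' * σ ^ ℓ * h2

/-- Some power of p clears V; as long as the exponent exceeds N, one factor p can be removed, since
p^a V is then divisible by p. -/
lemma exists_pow_smul_eq_map_of_eq_add (hO : maximalIdeal O = Ideal.span {(p : O)})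
    (hQ : QK.Monic) (hd : QK.natDegree = d) (hr : IsUnit r.leadingCoeff)
    (hrK : rK = mapRingHom (algebraMap O K) r) 
    (hmem : ∀ z, z ∈ B ↔ ∃ w : Fin d → O[X],
      z = ofVec QK rK fun i => mapRingHom (algebraMap O K) (w i))
    {ℓ N : ℕ}
    (happrox : ∀ a, N < a → ∀ g ∈ B, ∀ w ∈ B, ∀ z ∈ B, ∀ k,
      (p : OpenRing QK rK) ^ k * (algebraMap K[X] _ rK * Δ (g * invr QK rK ^ ℓ) -
        (p : OpenRing QK rK) ^ a * (w * invr QK rK ^ ℓ)) = z →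
      ∃ b ∈ B, ∃ α ∈ B, ∃ n, g * invr QK rK ^ ℓ = b + p * (α * invr QK rK ^ n))
    (w : Fin d → O[X]) {V u : Fin d → K[X]}
    (hV : ∀ i, (V i).degree < ((ℓ * r.natDegree : ℕ) : WithBot ℕ))
    (hVu : ofVec QK rK (fun i => mapRingHom (algebraMap O K) (w i)) * invr QK rK ^ ℓ =
      algebraMap K[X] _ rK * Δ (ofVec QK rK V * invr QK rK ^ ℓ) + ofVec QK rK u) :
    ∃ c : Fin d → O[X], (p : K[X]) ^ N • V = fun i => mapRingHom (algebraMap O K) (c i) := by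
  set f := algebraMap O K
  have hf : Function.Injective f := IsFractionRing.injective O K
  let A := OpenRing QK rK
  set ρ := algebraMap K[X] (OpenRing QK rK) rK with hρ
  set σ := invr QK rK
  have hr0 : r ≠ 0 := fun h => not_isUnit_zero (by rwa [h, leadingCoeff_zero] at hr)
  have hrK0 : rK ≠ 0 := hrK ▸ (Polynomial.map_ne_zero_iff hf).2 hr0
  have hp : (p : K) ≠ 0 := natCast_ne_zero_of_maximalIdeal hO
  have hvec {v v' : Fin d → K[X]} (h : ofVec QK rK v = ofVec QK rK v') : v = v' :=
    ofVec_injective rK hQ hd (mem_nonZeroDivisors_of_ne_zero hrK0) h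
  have hρσ (n : ℕ) : ρ ^ n * σ ^ n = 1 := mul_pow_mul_invr_pow n
  have hint (c : Fin d → O[X]) :
      ofVec QK rK (fun i => mapRingHom f (c i)) ∈ B :=
    (hmem _).2 ⟨c, rfl⟩
  have hΔp (n : ℕ) (g : A) : Δ ((p : A) ^ n * g) = (p : A) ^ n * Δ g := by
    have h1 (z : A) : (p : A) ^ n * z = ((p : K) ^ n) • z := by
      rw [Algebra.smul_def, map_pow, map_natCast]
    rw [h1, Derivation.map_smul, h1]
  have key (a : ℕ) (ha : N < a)
      (hc : ∃ c : Fin d → O[X], (p : K[X]) ^ a • V = fun i => mapRingHom f (c i)) :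
      ∃ c : Fin d → O[X], (p : K[X]) ^ (a - 1) • V = fun i => mapRingHom f (c i) := by
    obtain ⟨c, hc⟩ := hc
    -- Nothing is known yet about the denominators of u; any k that clears them suffices, as u has
    -- no pole at the zeros of r.
    obtain ⟨k, u', hu'⟩ := exists_pow_mul_eq_map (O := O) hO ((p : K[X]) ^ a • u)
    obtain ⟨b, hb, α, hα, n, h⟩ := happrox a ha _ (hint c) _ (hint w)
      (-ofVec QK rK (fun i => mapRingHom f (u' i))) (neg_mem (hint u')) k (by
        rw [← hc, ← hu', ofVec_pow_natCast_smul, mul_assoc ((p : A) ^ a), hΔp, hVu, ofVec_pow_natCast_smul,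
          ofVec_pow_natCast_smul]
        ring)
    obtain ⟨b, rfl⟩ := (hmem _).1 hb
    obtain ⟨α, rfl⟩ := (hmem _).1 hα
    have h1 : r ^ n • c = r ^ (n + ℓ) • b + ((p : O[X]) * r ^ ℓ) • α := by
      have h2 : rK ^ n • (fun i => mapRingHom f (c i)) = rK ^ (n + ℓ) • (fun i => mapRingHom f (b i)) +
          ((p : K[X]) * rK ^ ℓ) • fun i => mapRingHom f (α i) := by
        refine hvec ?_
        rw [ofVec_smul, ofVec_add, ofVec_smul, ofVec_smul, map_mul, map_pow, map_pow, map_pow,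
          map_natCast, ← hρ]
        linear_combination ρ ^ (n + ℓ) * h - ρ ^ n * ofVec QK rK (fun i => mapRingHom f (c i)) *
          hρσ ℓ + p * ρ ^ ℓ * ofVec QK rK (fun i => mapRingHom f (α i)) * hρσ n
      refine funext fun i => Polynomial.map_injective f hf ?_
      have h3 := congrFun h2 i
      rw [hrK] at h3
      simpa using h3
    have hdvd (i) : (p : O[X]) ∣ c i := by
      refine natCast_dvd_of_pow_mul_eq hO hr (congrFun h1 i) ?_
      rw [← degree_map_eq_of_injective hf]
      refine lt_of_eq_of_lt ?_ (hV i)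
      have : (p : K[X]) ^ a * V i = (c i).map f := congrFun hc i
      rw [← this, degree_mul, ← C_eq_natCast, ← C_pow, degree_C (pow_ne_zero a hp), zero_add]
    choose c' hc' using hdvd
    refine ⟨c', funext fun i => ?_⟩
    have h2 : (p : K[X]) ^ a * V i = mapRingHom f (c i) := congrFun hc i
    have hp' : (p : K[X]) ≠ 0 := by
      rw [← C_eq_natCast]
      exact C_ne_zero.2 hp
    refine mul_left_cancel₀ hp' ?_
    change p * (p ^ (a - 1) * V i) = _
    rw [← mul_assoc, ← pow_succ', Nat.sub_add_cancel (by omega), h2, hc' i, map_mul, map_natCast]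
  have h1 (m : ℕ) : (∃ c : Fin d → O[X],
      (p : K[X]) ^ (N + m) • V = fun i => mapRingHom f (c i)) →
      ∃ c : Fin d → O[X], (p : K[X]) ^ N • V = fun i => mapRingHom f (c i) := by
    induction m with
    | zero => exact id
    | succ m ih => exact fun h => ih (key (N + (m + 1)) (by omega) h)
  obtain ⟨m, c, hc⟩ := exists_pow_mul_eq_map (O := O) hO V
  refine h1 m ⟨(p : O[X]) ^ N • c, ?_⟩
  rw [pow_add, mul_smul, hc]
  funext i
  rw [Pi.smul_apply, Pi.smul_apply, smul_eq_mul, smul_eq_mul, map_mul, map_pow, map_natCast]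

theorem exists_eq_pow_mul_of_finiteReduction (hO : maximalIdeal O = Ideal.span {(p : O)})
    (hQ : QK.Monic) (hd : QK.natDegree = d) (hr : IsUnit r.leadingCoeff)
    (hrK : rK = mapRingHom (algebraMap O K) r) (hx : Δ (x QK rK) = 1)
    (hΔ : ∀ g, KaehlerDifferential.D K _ g = Δ g • KaehlerDifferential.D K _ (x QK rK))
    (hmem : ∀ z, z ∈ B ↔ ∃ w : Fin d → O[X],
      z = ofVec QK rK fun i => mapRingHom (algebraMap O K) (w i))
    (hXB : ∀ g, algebraMap K[X] _ (mapRingHom (algebraMap O K) g) ∈ B)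
    (hB : ∀ g ∈ B, algebraMap K[X] _ rK * Δ g ∈ B) {ℓ N : ℕ}
    (happrox : ∀ a, N < a → ∀ g ∈ B, ∀ w ∈ B, ∀ z ∈ B, ∀ k,
      (p : OpenRing QK rK) ^ k * (algebraMap K[X] _ rK * Δ (g * invr QK rK ^ ℓ) -
        (p : OpenRing QK rK) ^ a * (w * invr QK rK ^ ℓ)) = z →
      ∃ b ∈ B, ∃ α ∈ B, ∃ n, g * invr QK rK ^ ℓ = b + p * (α * invr QK rK ^ n))
    (w : Fin d → O[X]) {u : Fin d → K[X]}
    (h : FiniteReduction QK rK ℓ (fun i => mapRingHom (algebraMap O K) (w i)) u) :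
    ∃ c : Fin d → O[X], (fun i => mapRingHom (algebraMap O K) (c i)) = (p : K[X]) ^ N • u := by
  set f := algebraMap O K
  have hf : Function.Injective f := IsFractionRing.injective O K
  let A := OpenRing QK rK
  set ρ := algebraMap K[X] (OpenRing QK rK) rK with hρ
  set σ := invr QK rK
  have hr0 : r ≠ 0 := fun h => not_isUnit_zero (by rwa [h, leadingCoeff_zero] at hr)
  have hrK0 : rK ≠ 0 := hrK ▸ (Polynomial.map_ne_zero_iff hf).2 hr0
  have hp : (p : K) ≠ 0 := natCast_ne_zero_of_maximalIdeal hO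
  have hvec {v v' : Fin d → K[X]} (h : ofVec QK rK v = ofVec QK rK v') : v = v' :=
    ofVec_injective rK hQ hd (mem_nonZeroDivisors_of_ne_zero hrK0) h
  have hρσ (n : ℕ) : ρ ^ n * σ ^ n = 1 := mul_pow_mul_invr_pow n
  have hint (c : Fin d → O[X]) :
      ofVec QK rK (fun i => mapRingHom f (c i)) ∈ B :=
    (hmem _).2 ⟨c, rfl⟩
  have hpB : (p : A) ∈ B := natCast_mem _ p
  have hΔp (n : ℕ) (g : A) : Δ ((p : A) ^ n * g) = (p : A) ^ n * Δ g := by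
    have h1 (z : A) : (p : A) ^ n * z = ((p : K) ^ n) • z := by
      rw [Algebra.smul_def, map_pow, map_natCast]
    rw [h1, Derivation.map_smul, h1]
  obtain ⟨V, hV, hVu⟩ := exists_degree_lt_of_finiteReduction hrK0 hx hΔ h
  have hdeg : rK.natDegree = r.natDegree := by
    rw [hrK]
    exact natDegree_map_eq_of_injective hf r
  rw [hdeg] at hV
  obtain ⟨c, hc⟩ := exists_pow_smul_eq_map_of_eq_add hO hQ hd hr hrK hmem happrox w hV hVu
  have hT := derivation_mul_invr_pow Δ (ofVec QK rK (fun i => mapRingHom f (c i))) ℓ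
  have hΔρ : Δ ρ = algebraMap K[X] A (mapRingHom f (derivative r)) := by
    refine (derivation_algebraMap_polynomial (L := OpenRing QK rK) Δ hx rK).trans ?_
    rw [show derivative rK = mapRingHom f (derivative r) by
      rw [hrK, coe_mapRingHom, derivative_map]]
  -- The telescoped identity times p^N r^ℓ expresses r^ℓ p^N u by w, p^N V and its image under r
  -- d/dx, all of which are integral.
  have hmem' : ofVec QK rK ((rK ^ ℓ * (p : K[X]) ^ N) • u) ∈ B := by
    have h1 : ofVec QK rK ((rK ^ ℓ * (p : K[X]) ^ N) • u) =
        p ^ N * ofVec QK rK (fun i => mapRingHom f (w i)) -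
          (ρ * Δ (ofVec QK rK (fun i => mapRingHom f (c i))) -
            ℓ * Δ ρ * ofVec QK rK (fun i => mapRingHom f (c i))) := by
      rw [← hT, ← hc, ofVec_pow_natCast_smul, mul_assoc ((p : A) ^ N) _ (σ ^ ℓ), hΔp, ofVec_smul, map_mul, map_pow, map_pow,
        map_natCast]
      linear_combination (-p ^ N * ρ ^ ℓ) * hVu +
        p ^ N * ofVec QK rK (fun i => mapRingHom f (w i)) * hρσ ℓ
    rw [h1]
    refine sub_mem (mul_mem (pow_mem hpB N) (hint w)) (sub_mem (hB _ (hint c)) (mul_mem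
      (mul_mem (natCast_mem _ ℓ) ?_) (hint c)))
    rw [hΔρ]
    exact hXB _
  obtain ⟨e, he⟩ := (hmem _).1 hmem'
  have h1 (i) : r.map f ^ ℓ * ((p : K[X]) ^ N * u i) = (e i).map f := by
    have : rK ^ ℓ * (p : K[X]) ^ N * u i = mapRingHom f (e i) := congrFun (hvec he) i
    rw [hrK] at this
    rw [← mul_assoc]
    exact this
  choose e' he' using fun i => dvd_of_map_dvd_map_of_isUnit f hf hr ℓ (Dvd.intro _ (h1 i))
  refine ⟨e', funext fun i => ?_⟩
  refine mul_left_cancel₀ (pow_ne_zero ℓ hrK0) ?_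
  have h2 : rK ^ ℓ * ((p : K[X]) ^ N * u i) = (e i).map f := by
    rw [← h1 i, hrK]
    rfl
  refine Eq.trans ?_ h2.symm
  rw [he' i, Polynomial.map_mul, Polynomial.map_pow, hrK]
  rfl

end FiniteReduction

/-! ### Facts about Witt vectors and irreducibility over K(x) -/

section Witt

open IsLocalRing

lemma irreducible_map_map {O K F : Type u} [CommRing O] [IsDomain O] [IsDiscreteValuationRing O]
    [Field K] [Algebra O K] [IsFractionRing O K] {p : ℕ}
    (hO : maximalIdeal O = Ideal.span {(p : O)}) [Field F] [Algebra K[X] F] [IsFractionRing K[X] F]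
    {Q : O[X][X]} (hQ : Q.Monic) (h : Irreducible Q) :
    Irreducible ((Q.map (mapRingHom (algebraMap O K))).map (algebraMap K[X] F)) := by
  let m := mapRingHom (algebraMap O K)
  let : Algebra O[X] F := ((algebraMap K[X] F).comp m).toAlgebra
  have hinj : Function.Injective (algebraMap O[X] F) :=
    (IsFractionRing.injective K[X] F).comp
      (Polynomial.map_injective _ (IsFractionRing.injective O K))
  have hp : (p : K[X]) ≠ 0 := by
    rw [← C_eq_natCast]
    exact C_ne_zero.2 (natCast_ne_zero_of_maximalIdeal (K := K) hO)
  have hclear (g : K[X]) : ∃ (N : ℕ) (c : O[X]), (p : K[X]) ^ N * g = m c := by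
    obtain ⟨N, c, hc⟩ := exists_pow_mul_eq_map (O := O) hO fun _ : Fin 1 => g
    exact ⟨N, c 0, congrFun hc 0⟩
  have := (faithfulSMul_iff_algebraMap_injective O[X] F).2 hinj
  have : IsFractionRing O[X] F := by
    refine IsFractionRing.of_field _ _ fun z => ?_
    obtain ⟨a, b, hb, rfl⟩ := IsFractionRing.div_surjective (A := K[X]) z
    obtain ⟨N, a', ha'⟩ := hclear a
    obtain ⟨M, b', hb'⟩ := hclear b
    refine ⟨(p : O[X]) ^ M * a', (p : O[X]) ^ N * b', ?_⟩
    change _ = algebraMap K[X] F (m _) / algebraMap K[X] F (m _)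
    rw [map_mul m _ a', map_mul m _ b', ← ha', ← hb']
    simp only [map_mul, map_pow, map_natCast]
    have h1 : algebraMap K[X] F b ≠ 0 := IsFractionRing.to_map_ne_zero_of_mem_nonZeroDivisors hb
    have h2 : (p : F) ≠ 0 := by
      rw [← map_natCast (algebraMap K[X] F)]
      exact (map_ne_zero_iff _ (IsFractionRing.injective K[X] F)).2 hp
    field_simp
  rw [Polynomial.map_map]
  exact (hQ.irreducible_iff_irreducible_map_fraction_map (K := F)).1 h

variable (p : ℕ) [Fact p.Prime] (k : Type u) [Field k] [CharP k p]

lemma charZero_wittVector [PerfectRing k p] : CharZero (WittVector p k) := by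
  obtain ⟨q, hq⟩ := CharP.exists (WittVector p k)
  rcases CharP.char_is_prime_or_zero (WittVector p k) q with h | rfl
  · have h1 : (q : k) = 0 := by
      rw [← map_natCast (WittVector.constantCoeff (p := p) (R := k)), CharP.cast_eq_zero, map_zero]
    have h2 := (Nat.prime_dvd_prime_iff_eq Fact.out h).1 ((CharP.cast_eq_zero_iff k p q).1 h1)
    subst h2
    exact ((WittVector.irreducible (k := k) p).ne_zero (CharP.cast_eq_zero _ _)).elim
  · exact CharP.charP_to_charZero _

variable {p k}

lemma isPrimitive_of_modp_ne_zero {f : (Zq p k)[X]} (hf : modp p k f ≠ 0) : f.IsPrimitive := by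
  rintro a ⟨g, rfl⟩
  by_contra ha
  refine hf ?_
  have h1 : WittVector.constantCoeff a = 0 := by
    by_contra h
    exact ha (WittVector.isUnit_of_coeff_zero_ne_zero a h)
  rw [map_mul, coe_mapRingHom, map_C, h1, C_0, zero_mul]

end Witt

end PlaneCurve

/-! ### Assembly -/

theorem mainTheorem7
    -- `k = 𝔽_q` is a finite field of characteristic `p`
    (p : ℕ) [Fact p.Prime] (k : Type u) [Field k] [Finite k] [CharP k p]
    -- the lift `Q ∈ ℤ_q[x][y]` of the equation of the curve, monic in `y`
    (Q : (PlaneCurve.Zq p k)[X][X]) (hQ : Q.Monic)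
    (hirr : Irreducible (Q.map (PlaneCurve.modp p k)))
    (hsep : ((Q.map (PlaneCurve.modp p k)).map (algebraMap k[X] (RatFunc k))).Separable)
    -- the squarefree part of its discriminant
    (r : (PlaneCurve.Zq p k)[X]) (hr : PlaneCurve.IsSquarefreePart Q.discr r)
    -- the smooth proper curve `𝒳`, containing `𝒰` as the complement of a smooth divisor
    (𝒳 : Scheme.{u}) (π : 𝒳 ⟶ Spec (.of (PlaneCurve.Zq p k)))
    [IsProper π] [SmoothOfRelativeDimension 1 π]
    (j : Spec (.of (PlaneCurve.OpenRing Q r)) ⟶ 𝒳) [IsOpenImmersion j]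
    (hj : j ≫ π = Spec.map (CommRingCat.ofHom
      (algebraMap (PlaneCurve.Zq p k) (PlaneCurve.OpenRing Q r))))
    (hU : PlaneCurve.IsSmoothDivisorComplement π (Set.range j))
    -- `𝒱` is the complement of a smooth divisor on the projective line
    (hV : PlaneCurve.IsSmoothDivisorComplement (PlaneCurve.ProjLine.toSpec (PlaneCurve.Zq p k))
      (PlaneCurve.ProjLine.openOf r))
    -- the zero locus of `Q` in the affine plane over `ℚ_q` is smooth
    (hsmooth : Algebra.Smooth (PlaneCurve.Qq p k) (AdjoinRoot (Q.map (PlaneCurve.toQq p k))))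
    -- the integral form
    (ℓ : ℕ) (hℓ : 1 ≤ ℓ) (w : Fin Q.natDegree → (PlaneCurve.Zq p k)[X])
    (hw : ∀ i, (w i).degree < r.degree) :
    (∃ u : Fin Q.natDegree → (PlaneCurve.Qq p k)[X],
      PlaneCurve.FiniteReduction (Q.map (PlaneCurve.toQq p k)) (PlaneCurve.toQq p k r) ℓ
        (fun i => PlaneCurve.toQq p k (w i)) u) ∧
    ∀ u : Fin Q.natDegree → (PlaneCurve.Qq p k)[X],
      PlaneCurve.FiniteReduction (Q.map (PlaneCurve.toQq p k)) (PlaneCurve.toQq p k r) ℓ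
        (fun i => PlaneCurve.toQq p k (w i)) u →
      ∀ i, ∃ c : (PlaneCurve.Zq p k)[X],
        PlaneCurve.toQq p k c =
          (p : (PlaneCurve.Qq p k)[X]) ^
            Nat.log p (ℓ * PlaneCurve.maxFiniteRamification π j) * u i := by
  have hperf : PerfectRing k p := inferInstance
  let O := PlaneCurve.Zq p k
  let K := PlaneCurve.Qq p k
  have hO : IsLocalRing.maximalIdeal O = Ideal.span {(p : O)} :=
    (IsDiscreteValuationRing.irreducible_iff_uniformizer _).1 (WittVector.irreducible p)
  have : CharZero O := PlaneCurve.charZero_wittVector p k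
  have : Finite (IsLocalRing.ResidueField O) := by
    have h : Finite (O ⧸ Ideal.span {(p : O)}) :=
      Finite.of_equiv k (WittVector.quotientPEquiv (p := p) (k := k)).symm
    rw [← hO] at h
    exact h
  have hf : Function.Injective (algebraMap O K) := IsFractionRing.injective O K
  have hQirr : Irreducible Q := hQ.irreducible_of_irreducible_map _ _ hirr
  have hd : Q.natDegree ≠ 0 := by
    intro h
    rw [hQ.natDegree_eq_zero] at h
    exact hQirr.not_isUnit (h ▸ isUnit_one)
  -- Separability modulo p makes the discriminant primitive, so it divides a power of r and 𝒰 is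
  -- étale over the line.
  have hdisc : PlaneCurve.modp p k Q.discr ≠ 0 := by
    intro h
    rw [Polynomial.map_map] at hsep
    refine PlaneCurve.map_discr_ne_zero _ hQ hd hsep ?_
    rw [RingHom.comp_apply, h, map_zero]
  have hprim := PlaneCurve.isPrimitive_of_modp_ne_zero hdisc
  have hr0 : r ≠ 0 := by
    rintro rfl
    obtain ⟨g, -, hg⟩ := hr
    exact hprim.ne_zero (hg.trans (mul_zero g))
  have hlc := PlaneCurve.isUnit_leadingCoeff_of_isSmoothDivisorComplement hr0 hV
  have hcop := PlaneCurve.isCoprime_derivative_of_isSmoothDivisorComplement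
    (hr.squarefree hprim.ne_zero) hV
  have hdiscr : ∃ n a b, Q * a + derivative Q * b = C (r ^ n) := by
    obtain ⟨n, c, hc⟩ := hr.exists_dvd_pow hprim
    obtain ⟨a, b, hab⟩ := PlaneCurve.exists_mul_add_mul_eq_discr hQ hd
    refine ⟨n, a * C c, b * C c, ?_⟩
    rw [hc, C_mul, ← hab]
    ring
  have hrK0 : PlaneCurve.toQq p k r ≠ 0 := (Polynomial.map_ne_zero_iff hf).2 hr0
  have hQK : (Q.map (PlaneCurve.toQq p k)).Monic := hQ.map _
  have hdK : (Q.map (PlaneCurve.toQq p k)).natDegree = Q.natDegree := hQ.natDegree_map _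
  have : IsDomain (PlaneCurve.OpenRing (Q.map (PlaneCurve.toQq p k)) (PlaneCurve.toQq p k r)) :=
    PlaneCurve.OpenRing.isDomain_of_irreducible_map (algebraMap K[X] (RatFunc K))
      (IsFractionRing.injective _ _) hrK0 hQK (PlaneCurve.irreducible_map_map hO hQ hQirr)
  have : IsDomain (AdjoinRoot (Q.map (PlaneCurve.toQq p k))) :=
    (PlaneCurve.OpenRing.fromPlane_injective (PlaneCurve.toQq p k r) hQK
      (mem_nonZeroDivisors_of_ne_zero hrK0)).isDomain
      (PlaneCurve.OpenRing.fromPlane (Q.map (PlaneCurve.toQq p k)) (PlaneCurve.toQq p k r))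
  obtain ⟨D, i, _, _, hi⟩ := hU
  obtain ⟨Δ, hx, hΔ, hB, hinj, happrox⟩ :=
    PlaneCurve.exists_derivation_of_isSmoothDivisorComplement K hO hQ hlc hcop hdiscr
      (⟨j, inferInstance, hj⟩ : PlaneCurve.AffineChart π (PlaneCurve.OpenRing Q r)) i hi
      (L := FractionRing
        (PlaneCurve.OpenRing (Q.map (PlaneCurve.toQq p k)) (PlaneCurve.toQq p k r)))
  have hmem := fun z => PlaneCurve.OpenRing.mem_integralFunctions_iff (algebraMap O K) r hQ (z := z)
  refine ⟨PlaneCurve.exists_finiteReduction hO hQK hdK hrK0 hx hΔ hmem hB hinj ℓ _, fun u hu i => ?_⟩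
  obtain ⟨c, hc⟩ := PlaneCurve.exists_eq_pow_mul_of_finiteReduction hO hQK hdK hlc rfl hx hΔ hmem
    (PlaneCurve.OpenRing.algebraMap_mem_integralFunctions _ r) hB (happrox ℓ) w hu
  exact ⟨c i, congrFun hc i⟩
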